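/- Let $n,m\ge 2$, $W=\mathbb R^m$ with standard basis $w_1,\dots,w_m$, and let $\mathfrak g=(\mathfrak{sl}_2\times\mathfrak{gl}(W))\ltimes V$, $V=\mathbb V_n\otimes W$ (abelian ideal), be the point symmetry algebra of the trivial ODE $\mathbf u_{n+1}=0$. Here $\mathfrak{sl}_2=\langle \mathsf X,\mathsf H,\mathsf Y\rangle$ with $[\mathsf X,\mathsf Y]=\mathsf H$, $[\mathsf H,\mathsf X]=2\mathsf X$, $[\mathsf H,\mathsf Y]=-2\mathsf Y$; $e_a{}^b w_c=\delta_c{}^b w_a$; $\mathbb V_n$ has basis $E_0,\dots,E_n$ with $\mathsf XE_i=E_{i+1}$, $\mathsf HE_i=(2i-n)E_i$, $\mathsf YE_i=i(n+1-i)E_{i-1}$; $E_{i,a}=E_i\otimes w_a$, with $E_{i,a}=0$ if $i<0$ or $i>n$; $E^{i,a}$ is the dual basis of $V^*$. Put $\mathsf Z_1=-\frac12(\mathsf H+n\,\mathrm{id})$, $\mathsf Z_2=-\mathrm{id}$, let $\mathfrak g=\bigoplus_k\mathfrak g_k$ be the grading by eigenvalues of $\mathrm{ad}(\mathsf Z_1+\mathsf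 Z_2)$, and $\mathfrak g^i=\bigoplus_{k\ge i}\mathfrak g_k$, $\mathfrak g_-=\bigoplus_{k<0}\mathfrak g_k=\mathbb R\mathsf X\oplus V$. Let $G_0\cong\mathbb R^\times\times GL_m$ be the group of pairs $(\mathrm{diag}(s,s^{-1}),A)\in SL_2\times GL_m$, acting on $\mathfrak g$ by $\mathrm{Ad}$; its Lie algebra is $\mathfrak g_0=\mathbb R\mathsf H\oplus\mathfrak{gl}(W)$. Give $\mathfrak g$ the inner product for which $\mathsf X,\mathsf H,\mathsf Y,e_a{}^b,E_{i,a}$ are orthogonal with squared lengths $1,2,1,1,\frac{i!}{(n-i)!}$. Let $\partial$ be the Lie algebra cohomology differential on $C^k(\mathfrak g_-,\mathfrak g)=\bigwedge^k\mathfrak g_-^*\otimes\mathfrak g$, $\partial^*$ its adjoint for the induced inner products, and $\square=\partial\partial^*+\partial^*\partial$. An *irreducible C-class module* is a nonzero irreducible $G_0$-submodule $\mathbb U\subset\ker\square\subset C^2(\mathfrak g_-,\mathfrak g)$ such that * $\mathbb U$ has bi-grade $(1,1)$ or $(2,2)$, i.e. $(\mathsf Z_1,\mathsf Z_2)$ acts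 on $\mathbb U$ by these scalars; * every $\phi\in\mathbb U$ is strongly regular: $\phi(\mathfrak g^i\cap\mathfrak g_-,\mathfrak g^j\cap\mathfrak g_-)\subset\mathfrak g^{i+j+1}\cap\mathfrak g^{\min(i,j)-1}$ for all $i,j$; * if $n\ge3$, every $\phi\in\mathbb U$ satisfies the Doubrov–Medvedev condition: with $F=\mathrm{span}\{E_0,\dots,E_{n-1}\}\otimes W$ there is a linear map $B:F\to\mathbb R\mathsf X$ such that the $V$-component of $\phi(x,y)$ is congruent to $B(x)\cdot y-B(y)\cdot x$ modulo $F$ for all $x,y\in F$. A *lowest weight vector* of $\mathbb U$ is a nonzero element annihilated by all strictly lower triangular matrices in $\mathfrak{sl}(W)$. Let $\epsilon_a(\mathrm{diag}(h_1,\dots,h_m))=h_a$, and write $\mathbb B_4$, $\mathbb A_2^{\rm tr}$, $\mathbb A_2^{\rm tf}$ for an irreducible C-class module with, respectively, bi-grade $(2,2)$ and $\mathfrak{sl}(W)$-lowest weight $-2\epsilon_1$; bi-grade $(1,1)$ and lowest weight $-\epsilon_1$; bi-grade $(1,1)$ and lowest weight $\epsilon_m-2\epsilon_1$. **Theorem.**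 Every irreducible C-class module is $\mathbb B_4$ (only for $n=2$), $\mathbb A_2^{\rm tr}$ (only for $n\ge3$) or $\mathbb A_2^{\rm tf}$ (for $n\ge 2$), and for these $n$ each of them exists and is a unique subspace of $\ker\square$. The lowest weight vector $\Phi_{\mathbb U}\in\mathbb U$ is unique up to a nonzero scale, and its nonzero multiples are exactly the nonzero multiples of the following harmonic 2-cochains. 1. $\mathbb B_4$, $n=2$: $$E^{2,1}\wedge E^{1,1}\otimes\mathsf X-\tfrac12E^{2,1}\wedge E^{0,1}\otimes\mathsf H-\tfrac12E^{1,1}\wedge E^{0,1}\otimes\mathsf Y+\sum_{a=1}^m\left(E^{2,1}\wedge E^{0,a}-E^{1,1}\wedge E^{1,a}+E^{0,1}\wedge E^{2,a}\right)\otimes e_a{}^1.$$ 2. $\mathbb A_2^{\rm tr}$, $n\ge3$: with $\Phi^{i,j}=\sum_{a=1}^mE^{i,1}\wedge E^{j,a}\otimes E_{i+j-1,a}$, $$\alpha\sum_{i=0}^n\left[\Phi^{2,i}+\left(\tfrac n2-i\right)\Phi^{1,i}-\tfrac12i(n+1-i)\Phi^{0,i}\right]+\beta\sum_{i=0}^n\left[(n+1-i)(\Phi^{i,0}-\Phi^{0,i})+\Phi^{i,1}-\Phi^{1,i}\right],$$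 where $\beta\neq0$ and $\alpha=\dfrac{-6(n-1)(m+1)}{mn(n+1)+6}\,\beta$. 3. $\mathbb A_2^{\rm tf}$, $n\ge2$: with $\Phi^{i,j}=E^{i,1}\wedge E^{j,1}\otimes E_{i+j-1,m}$, $$\sum_{j=0}^n\left[(n+1-j)\Phi^{0,j}+\Phi^{1,j}\right].$$ -/

import Mathlib

open LieModule.Cohomology

namespace CClass

/-! ### The symmetry algebra of the trivial equation

`𝔤 = (𝔰𝔩₂ × 𝔤𝔩(W)) ⋉ V` with `V = 𝕍ₙ ⊗ W`, `W = ℝᵐ`, where `V` is an abelian ideal.  -/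

/-- The element `x 𝖷 + h 𝖧 + y 𝖸 + ∑ gl a b • e_a^b + ∑ v i a • E_{i,a}` of `𝔤`.  The rows of `v`
are indexed by `0, …, n`; the basis `w_1, …, w_m` of `W` is indexed by `Fin m`, the element
`a : Fin m` standing for the label `a + 1`. -/
@[ext] structure SymAlg (n m : ℕ) where
  x : ℝ
  h : ℝ
  y : ℝ
  gl : Matrix (Fin m) (Fin m) ℝ
  v : Matrix (Fin (n + 1)) (Fin m) ℝ

namespace SymAlg

variable {n m : ℕ}

/-- As a set, `𝔤` is the product of its coordinate spaces. -/
def toProd : SymAlg n m ≃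
    ℝ × ℝ × ℝ × Matrix (Fin m) (Fin m) ℝ × Matrix (Fin (n + 1)) (Fin m) ℝ where
  toFun u := (u.x, u.h, u.y, u.gl, u.v)
  invFun p := ⟨p.1, p.2.1, p.2.2.1, p.2.2.2.1, p.2.2.2.2⟩
  left_inv _ := rfl
  right_inv _ := rfl

instance : AddCommGroup (SymAlg n m) := toProd.addCommGroup
noncomputable instance : Module ℝ (SymAlg n m) := toProd.module ℝ

@[simp] lemma zero_x : (0 : SymAlg n m).x = 0 := rfl
@[simp] lemma zero_h : (0 : SymAlg n m).h = 0 := rfl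
@[simp] lemma zero_y : (0 : SymAlg n m).y = 0 := rfl
@[simp] lemma zero_gl : (0 : SymAlg n m).gl = 0 := rfl
@[simp] lemma zero_v : (0 : SymAlg n m).v = 0 := rfl
@[simp] lemma add_x (u w : SymAlg n m) : (u + w).x = u.x + w.x := rfl
@[simp] lemma add_h (u w : SymAlg n m) : (u + w).h = u.h + w.h := rfl
@[simp] lemma add_y (u w : SymAlg n m) : (u + w).y = u.y + w.y := rfl
@[simp] lemma add_gl (u w : SymAlg n m) : (u + w).gl = u.gl + w.gl := rfl
@[simp] lemma add_v (u w : SymAlg n m) : (u + w).v = u.v + w.v := rfl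
@[simp] lemma neg_x (u : SymAlg n m) : (-u).x = -u.x := rfl
@[simp] lemma neg_h (u : SymAlg n m) : (-u).h = -u.h := rfl
@[simp] lemma neg_y (u : SymAlg n m) : (-u).y = -u.y := rfl
@[simp] lemma neg_gl (u : SymAlg n m) : (-u).gl = -u.gl := rfl
@[simp] lemma neg_v (u : SymAlg n m) : (-u).v = -u.v := rfl
@[simp] lemma sub_x (u w : SymAlg n m) : (u - w).x = u.x - w.x := rfl
@[simp] lemma sub_h (u w : SymAlg n m) : (u - w).h = u.h - w.h := rfl
@[simp] lemma sub_y (u w : SymAlg n m) : (u - w).y = u.y - w.y := rfl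
@[simp] lemma sub_gl (u w : SymAlg n m) : (u - w).gl = u.gl - w.gl := rfl
@[simp] lemma sub_v (u w : SymAlg n m) : (u - w).v = u.v - w.v := rfl
@[simp] lemma smul_x (c : ℝ) (u : SymAlg n m) : (c • u).x = c * u.x := rfl
@[simp] lemma smul_h (c : ℝ) (u : SymAlg n m) : (c • u).h = c * u.h := rfl
@[simp] lemma smul_y (c : ℝ) (u : SymAlg n m) : (c • u).y = c * u.y := rfl
@[simp] lemma smul_gl (c : ℝ) (u : SymAlg n m) : (c • u).gl = c • u.gl := rfl
@[simp] lemma smul_v (c : ℝ) (u : SymAlg n m) : (c • u).v = c • u.v := rfl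

/-- The linear equivalence underlying `toProd`. -/
noncomputable def toProdl : SymAlg n m ≃ₗ[ℝ]
    ℝ × ℝ × ℝ × Matrix (Fin m) (Fin m) ℝ × Matrix (Fin (n + 1)) (Fin m) ℝ :=
  { toProd with
    map_add' := fun _ _ => rfl
    map_smul' := fun _ _ => rfl }

instance : FiniteDimensional ℝ (SymAlg n m) :=
  Module.Finite.equiv (toProdl (n := n) (m := m)).symm

end SymAlg

/-- The matrix of `𝖷` on `𝕍ₙ` in the basis `E_0, …, E_n`: `𝖷 E_j = E_{j+1}`. -/
def rhoX (n : ℕ) : Matrix (Fin (n + 1)) (Fin (n + 1)) ℝ :=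
  Matrix.of fun i j => if (i : ℕ) = j + 1 then 1 else 0

/-- The matrix of `𝖧` on `𝕍ₙ`: `𝖧 E_j = (2j - n) E_j`. -/
def rhoH (n : ℕ) : Matrix (Fin (n + 1)) (Fin (n + 1)) ℝ :=
  Matrix.of fun i j => if (i : ℕ) = j then 2 * (j : ℝ) - n else 0

/-- The matrix of `𝖸` on `𝕍ₙ`: `𝖸 E_j = j (n + 1 - j) E_{j-1}`. -/
def rhoY (n : ℕ) : Matrix (Fin (n + 1)) (Fin (n + 1)) ℝ :=
  Matrix.of fun i j => if (i : ℕ) + 1 = j then (j : ℝ) * (n + 1 - j) else 0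

lemma rhoX_mul_rhoY (n : ℕ) (i j : Fin (n + 1)) :
    (rhoX n * rhoY n) i j = if (i : ℕ) = j then (j : ℝ) * (n + 1 - j) else 0 := by
  rw [Matrix.mul_apply]
  by_cases hi : (i : ℕ) = 0
  · rw [Finset.sum_eq_zero (fun k _ => by simp [rhoX, hi])]
    split_ifs with h
    · simp [← h, hi]
    · rfl
  · have hi' : (i : ℕ) - 1 < n + 1 := by omega
    rw [Finset.sum_eq_single (⟨(i : ℕ) - 1, hi'⟩ : Fin (n + 1))]
    · have h1 : (i : ℕ) - 1 + 1 = i := by omega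
      simp [rhoX, rhoY, h1]
    · intro k _ hk
      have : (i : ℕ) ≠ k + 1 := fun h => hk (Fin.ext (by simp; omega))
      simp [rhoX, this]
    · simp

lemma rhoY_mul_rhoX (n : ℕ) (i j : Fin (n + 1)) :
    (rhoY n * rhoX n) i j = if (i : ℕ) = j then ((j : ℝ) + 1) * (n - j) else 0 := by
  rw [Matrix.mul_apply]
  by_cases hi : (i : ℕ) = n
  · rw [Finset.sum_eq_zero (fun k _ => by
      have : (i : ℕ) + 1 ≠ k := by omega
      simp [rhoY, this])]
    split_ifs with h
    · simp [← h, hi]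
    · rfl
  · have hi' : (i : ℕ) + 1 < n + 1 := by omega
    rw [Finset.sum_eq_single (⟨(i : ℕ) + 1, hi'⟩ : Fin (n + 1))]
    · by_cases h : (i : ℕ) = j
      · simp [rhoX, rhoY, h]
      · simp [rhoX, rhoY, h]
    · intro k _ hk
      have : (i : ℕ) + 1 ≠ k := fun h => hk (Fin.ext (by simp [h]))
      simp [rhoY, this]
    · simp

lemma rhoH_eq_diagonal (n : ℕ) :
    rhoH n = Matrix.diagonal (fun i : Fin (n + 1) => 2 * (i : ℝ) - n) := by
  ext i j
  by_cases h : i = j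
  · simp [rhoH, h]
  · have : (i : ℕ) ≠ j := fun h' => h (Fin.ext h')
    simp [rhoH, h, this]

lemma rho_XY (n : ℕ) : rhoX n * rhoY n - rhoY n * rhoX n = rhoH n := by
  ext i j
  rw [Matrix.sub_apply, rhoX_mul_rhoY, rhoY_mul_rhoX]
  by_cases h : (i : ℕ) = j
  · simp only [h, if_true, rhoH, Matrix.of_apply]; ring
  · simp [h, rhoH]

lemma rho_HX (n : ℕ) : rhoH n * rhoX n - rhoX n * rhoH n = (2 : ℝ) • rhoX n := by
  ext i j
  rw [rhoH_eq_diagonal, Matrix.sub_apply, Matrix.diagonal_mul, Matrix.mul_diagonal]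
  by_cases h : (i : ℕ) = j + 1
  · simp [rhoX, h]; ring
  · simp [rhoX, h]

lemma rho_HY (n : ℕ) : rhoH n * rhoY n - rhoY n * rhoH n = (-2 : ℝ) • rhoY n := by
  ext i j
  rw [rhoH_eq_diagonal, Matrix.sub_apply, Matrix.diagonal_mul, Matrix.mul_diagonal]
  by_cases h : (i : ℕ) + 1 = j
  · simp [rhoY, ← h]; ring
  · simp [rhoY, h]

namespace SymAlg

variable {n m : ℕ}

/-- The matrix on `𝕍ₙ` of the `𝔰𝔩₂`-component of `u`. -/
def sl (u : SymAlg n m) : Matrix (Fin (n + 1)) (Fin (n + 1)) ℝ :=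
  u.x • rhoX n + u.h • rhoH n + u.y • rhoY n

/-- The action of the `𝔮`-component of `u` on `V = 𝕍ₙ ⊗ W`, where `𝔮 = 𝔰𝔩₂ × 𝔤𝔩(W)`. -/
def actV (u : SymAlg n m) (w : Matrix (Fin (n + 1)) (Fin m) ℝ) :
    Matrix (Fin (n + 1)) (Fin m) ℝ :=
  u.sl * w + w * u.gl.transpose

/-- The bracket of `𝔤 = (𝔰𝔩₂ × 𝔤𝔩(W)) ⋉ V`, with `[𝖷,𝖸] = 𝖧`, `[𝖧,𝖷] = 2𝖷`, `[𝖧,𝖸] = -2𝖸`. -/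
instance : Bracket (SymAlg n m) (SymAlg n m) where
  bracket u w :=
    { x := 2 * (u.h * w.x - u.x * w.h)
      h := u.x * w.y - u.y * w.x
      y := 2 * (u.y * w.h - u.h * w.y)
      gl := u.gl * w.gl - w.gl * u.gl
      v := u.actV w.v - w.actV u.v }

@[simp] lemma lie_x (u w : SymAlg n m) : ⁅u, w⁆.x = 2 * (u.h * w.x - u.x * w.h) := rfl
@[simp] lemma lie_h (u w : SymAlg n m) : ⁅u, w⁆.h = u.x * w.y - u.y * w.x := rfl
@[simp] lemma lie_y (u w : SymAlg n m) : ⁅u, w⁆.y = 2 * (u.y * w.h - u.h * w.y) := rfl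
@[simp] lemma lie_gl (u w : SymAlg n m) : ⁅u, w⁆.gl = u.gl * w.gl - w.gl * u.gl := rfl
@[simp] lemma lie_v (u w : SymAlg n m) : ⁅u, w⁆.v = u.actV w.v - w.actV u.v := rfl

lemma sl_add (u w : SymAlg n m) : (u + w).sl = u.sl + w.sl := by
  simp only [sl, add_x, add_h, add_y, add_smul]; abel

lemma sl_lie (u w : SymAlg n m) : ⁅u, w⁆.sl = u.sl * w.sl - w.sl * u.sl := by
  have h1 := rho_XY n
  have h2 := rho_HX n
  have h3 := rho_HY n
  rw [sub_eq_iff_eq_add] at h1 h2 h3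
  simp only [sl, lie_x, lie_h, lie_y, add_mul, mul_add, smul_mul_assoc, mul_smul_comm, h1, h2, h3,
    smul_add, smul_smul]
  module

lemma actV_lie (u w : SymAlg n m) (z : Matrix (Fin (n + 1)) (Fin m) ℝ) :
    ⁅u, w⁆.actV z = u.actV (w.actV z) - w.actV (u.actV z) := by
  simp only [actV, sl_lie, lie_gl, Matrix.transpose_sub, Matrix.transpose_mul, Matrix.sub_mul,
    Matrix.mul_sub, Matrix.mul_add, Matrix.add_mul, Matrix.mul_assoc]
  abel

lemma actV_sub (u : SymAlg n m) (z z' : Matrix (Fin (n + 1)) (Fin m) ℝ) :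
    u.actV (z - z') = u.actV z - u.actV z' := by
  simp only [actV, Matrix.mul_sub, Matrix.sub_mul]; abel

lemma actV_add (u : SymAlg n m) (z z' : Matrix (Fin (n + 1)) (Fin m) ℝ) :
    u.actV (z + z') = u.actV z + u.actV z' := by
  simp only [actV, Matrix.mul_add, Matrix.add_mul]; abel

lemma actV_smul (c : ℝ) (u : SymAlg n m) (z : Matrix (Fin (n + 1)) (Fin m) ℝ) :
    u.actV (c • z) = c • u.actV z := by
  simp only [actV, Matrix.mul_smul, Matrix.smul_mul, smul_add]

lemma add_actV (u w : SymAlg n m) (z : Matrix (Fin (n + 1)) (Fin m) ℝ) :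
    (u + w).actV z = u.actV z + w.actV z := by
  simp only [actV, sl_add, add_gl, Matrix.transpose_add, Matrix.mul_add, Matrix.add_mul]; abel

lemma smul_actV (c : ℝ) (u : SymAlg n m) (z : Matrix (Fin (n + 1)) (Fin m) ℝ) :
    (c • u).actV z = c • u.actV z := by
  have : (c • u).sl = c • u.sl := by
    simp only [sl, smul_x, smul_h, smul_y, smul_add, smul_smul]
  simp only [actV, this, smul_gl, Matrix.transpose_smul, Matrix.mul_smul, Matrix.smul_mul, smul_add]

instance : LieRing (SymAlg n m) where
  add_lie u w z := by
    ext1 <;> simp only [lie_x, lie_h, lie_y, lie_gl, lie_v, add_x, add_h, add_y, add_gl, add_v,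
      add_actV, actV_add, add_mul, mul_add]
    · ring
    · ring
    · ring
    · abel
    · abel
  lie_add u w z := by
    ext1 <;> simp only [lie_x, lie_h, lie_y, lie_gl, lie_v, add_x, add_h, add_y, add_gl, add_v,
      add_actV, actV_add, add_mul, mul_add]
    · ring
    · ring
    · ring
    · abel
    · abel
  lie_self u := by
    ext1 <;> simp only [lie_x, lie_h, lie_y, lie_gl, lie_v, zero_x, zero_h, zero_y, zero_gl, zero_v,
      sub_self]
    · ring
    · ring
    · ring
  leibniz_lie u w z := by
    ext1
    · simp only [lie_x, lie_h, add_x]; ring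
    · simp only [lie_x, lie_h, lie_y, add_h]; ring
    · simp only [lie_h, lie_y, add_y]; ring
    · simp only [lie_gl, add_gl]; noncomm_ring
    · simp only [lie_v, add_v, actV_lie, actV_sub]; abel

noncomputable instance : LieAlgebra ℝ (SymAlg n m) where
  lie_smul c u w := by
    ext1 <;> simp only [lie_x, lie_h, lie_y, lie_gl, lie_v, smul_x, smul_h, smul_y, smul_gl, smul_v,
      smul_actV, actV_smul, smul_sub, Matrix.mul_smul, Matrix.smul_mul]
    · ring
    · ring
    · ring

end SymAlg

/-! ### Basis elements, gradings, distinguished subalgebras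

Basis elements carry the labels used in the literature: `E_{k,a}` with `0 ≤ k ≤ n`, `1 ≤ a ≤ m`, and
`e_a^b` with `1 ≤ a, b ≤ m`.  Elements with labels out of range are zero. -/

section Basis

variable (n m : ℕ)

/-- `𝖷`. -/
def elX : SymAlg n m := ⟨1, 0, 0, 0, 0⟩
/-- `𝖧`. -/
def elH : SymAlg n m := ⟨0, 1, 0, 0, 0⟩
/-- `𝖸`. -/
def elY : SymAlg n m := ⟨0, 0, 1, 0, 0⟩
/-- The element of `𝔤𝔩(W)` with matrix `N`. -/
def ofGl (N : Matrix (Fin m) (Fin m) ℝ) : SymAlg n m := ⟨0, 0, 0, N, 0⟩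
/-- `e_a^b`, the matrix unit with `e_a^b w_b = w_a`. -/
def elE (a b : ℕ) : SymAlg n m :=
  ofGl n m (Matrix.of fun i j => if (i : ℕ) + 1 = a ∧ (j : ℕ) + 1 = b then 1 else 0)
/-- `E_{k,a}`, which is zero unless `0 ≤ k ≤ n`. -/
def elV (k : ℤ) (a : ℕ) : SymAlg n m :=
  ⟨0, 0, 0, 0, Matrix.of fun i j => if ((i : ℕ) : ℤ) = k ∧ (j : ℕ) + 1 = a then 1 else 0⟩

/-- `𝖹₁ = -(𝖧 + n id) / 2`. -/
noncomputable def elZ₁ : SymAlg n m := ⟨0, -1 / 2, 0, (-(n : ℝ) / 2) • 1, 0⟩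
/-- `𝖹₂ = -id`. -/
def elZ₂ : SymAlg n m := ⟨0, 0, 0, -1, 0⟩
/-- The grading element `𝖹 = 𝖹₁ + 𝖹₂`. -/
noncomputable def elZ : SymAlg n m := elZ₁ n m + elZ₂ n m

/-- The graded component `𝔤_k`, an eigenspace of `ad 𝖹`. -/
noncomputable def gr (k : ℤ) : Submodule ℝ (SymAlg n m) :=
  Module.End.eigenspace (LieAlgebra.ad ℝ (SymAlg n m) (elZ n m) : Module.End ℝ (SymAlg n m)) (k : ℝ)

/-- The canonical filtration `𝔤^i = ∑_{k ≥ i} 𝔤_k`. -/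
noncomputable def filt (i : ℤ) : Submodule ℝ (SymAlg n m) := ⨆ k : ℤ, ⨆ _ : i ≤ k, gr n m k

/-- `𝔤₋ = ℝ 𝖷 ⊕ V`, the sum of the graded components of negative degree. -/
noncomputable def gMinus : LieSubalgebra ℝ (SymAlg n m) where
  carrier := {u | u.h = 0 ∧ u.y = 0 ∧ u.gl = 0}
  zero_mem' := by simp
  add_mem' := by
    rintro u w ⟨h1, h2, h3⟩ ⟨k1, k2, k3⟩
    simp [h1, h2, h3, k1, k2, k3]
  smul_mem' := by
    rintro c u ⟨h1, h2, h3⟩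
    simp [h1, h2, h3]
  lie_mem' := by
    rintro u w ⟨h1, h2, h3⟩ ⟨k1, k2, k3⟩
    simp [h1, h2, h3, k1, k2, k3]

/-- `𝔤₀ = ℝ 𝖧 ⊕ 𝔤𝔩(W)`, the graded component of degree zero. -/
noncomputable def gZero : LieSubalgebra ℝ (SymAlg n m) where
  carrier := {u | u.x = 0 ∧ u.y = 0 ∧ u.v = 0}
  zero_mem' := by simp
  add_mem' := by
    rintro u w ⟨h1, h2, h3⟩ ⟨k1, k2, k3⟩
    simp [h1, h2, h3, k1, k2, k3]
  smul_mem' := by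
    rintro c u ⟨h1, h2, h3⟩
    simp [h1, h2, h3]
  lie_mem' := by
    rintro u w ⟨h1, h2, h3⟩ ⟨k1, k2, k3⟩
    simp [h1, h2, h3, k1, k2, k3, SymAlg.actV]

variable {n m}

lemma mem_gMinus {u : SymAlg n m} : u ∈ gMinus n m ↔ u.h = 0 ∧ u.y = 0 ∧ u.gl = 0 := Iff.rfl

lemma mem_gZero {u : SymAlg n m} : u ∈ gZero n m ↔ u.x = 0 ∧ u.y = 0 ∧ u.v = 0 := Iff.rfl

lemma ofGl_mem (N : Matrix (Fin m) (Fin m) ℝ) : ofGl n m N ∈ gZero n m := ⟨rfl, rfl, rfl⟩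

lemma elZ₁_mem : elZ₁ n m ∈ gZero n m := ⟨rfl, rfl, rfl⟩

lemma elZ₂_mem : elZ₂ n m ∈ gZero n m := ⟨rfl, rfl, rfl⟩

end Basis

/-! ### Cochains on `𝔤₋` with values in `𝔤`, and harmonicity -/

/-- `C¹(𝔤₋, 𝔤)`. -/
abbrev C1 (n m : ℕ) := oneCochain ℝ (gMinus n m) (SymAlg n m)

/-- `C²(𝔤₋, 𝔤)`. -/
noncomputable abbrev C2 (n m : ℕ) := twoCochain ℝ (gMinus n m) (SymAlg n m)

/-- Trilinear maps `𝔤₋ × 𝔤₋ × 𝔤₋ → 𝔤`, among which `C³(𝔤₋, 𝔤)` is the space of alternating ones. -/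
abbrev T3 (n m : ℕ) :=
  gMinus n m →ₗ[ℝ] gMinus n m →ₗ[ℝ] gMinus n m →ₗ[ℝ] SymAlg n m

section Inner

variable (n m : ℕ)

/-- The squared length `k! / (n - k)!` of `E_{k,a}`. -/
noncomputable def lenV (k : Fin (n + 1)) : ℝ := ((k : ℕ).factorial : ℝ) / ((n - k : ℕ).factorial : ℝ)

/-- The inner product on `𝔤` for which `𝖷, 𝖧, 𝖸, e_a^b, E_{k,a}` is an orthogonal basis with squared
lengths `1, 2, 1, 1, k! / (n - k)!`. -/
noncomputable def ipG : LinearMap.BilinForm ℝ (SymAlg n m) :=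
  LinearMap.mk₂ ℝ (fun u w => u.x * w.x + 2 * (u.h * w.h) + u.y * w.y
      + ∑ a, ∑ b, u.gl a b * w.gl a b + ∑ k, ∑ a, lenV n k * (u.v k a * w.v k a))
    (by intro u u' w; simp only [SymAlg.add_x, SymAlg.add_h, SymAlg.add_y, SymAlg.add_gl,
          SymAlg.add_v, Matrix.add_apply, add_mul, mul_add, Finset.sum_add_distrib]; ring)
    (by intro c u w; simp only [SymAlg.smul_x, SymAlg.smul_h, SymAlg.smul_y, SymAlg.smul_gl,
          SymAlg.smul_v, Matrix.smul_apply, smul_eq_mul, mul_add, Finset.mul_sum]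
        congr 1; congr 1; ring; all_goals (repeat (refine Finset.sum_congr rfl fun _ _ => ?_)); ring)
    (by intro u w w'; simp only [SymAlg.add_x, SymAlg.add_h, SymAlg.add_y, SymAlg.add_gl,
          SymAlg.add_v, Matrix.add_apply, mul_add, Finset.sum_add_distrib]; ring)
    (by intro c u w; simp only [SymAlg.smul_x, SymAlg.smul_h, SymAlg.smul_y, SymAlg.smul_gl,
          SymAlg.smul_v, Matrix.smul_apply, smul_eq_mul, mul_add, Finset.mul_sum]
        congr 1; congr 1; ring; all_goals (repeat (refine Finset.sum_congr rfl fun _ _ => ?_)); ring)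

/-- Index set of the orthogonal basis `𝖷, E_{k,a}` of `𝔤₋`; `none` stands for `𝖷`. -/
abbrev NegIdx := Option (Fin (n + 1) × Fin m)

variable {n m}

/-- The orthogonal basis `𝖷, E_{k,a}` of `𝔤₋`. -/
noncomputable def negBasis : NegIdx n m → gMinus n m
  | none => ⟨elX n m, rfl, rfl, rfl⟩
  | some p => ⟨⟨0, 0, 0, 0, Matrix.single p.1 p.2 1⟩, rfl, rfl, rfl⟩

/-- Squared lengths of the basis elements of `𝔤₋`. -/
noncomputable def negLen : NegIdx n m → ℝ
  | none => 1
  | some p => lenV n p.1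

variable (n m)

/-- Evaluation of a 1-cochain on a basis element. -/
noncomputable def ev1 (i : NegIdx n m) : C1 n m →ₗ[ℝ] SymAlg n m :=
  LinearMap.applyₗ (negBasis i)

/-- Evaluation of a 2-cochain on a pair of basis elements. -/
noncomputable def ev2 (i j : NegIdx n m) : C2 n m →ₗ[ℝ] SymAlg n m :=
  LinearMap.applyₗ (negBasis j) ∘ₗ LinearMap.applyₗ (negBasis i) ∘ₗ Submodule.subtype _

/-- Evaluation of a trilinear map on a triple of basis elements. -/
noncomputable def ev3 (i j k : NegIdx n m) : T3 n m →ₗ[ℝ] SymAlg n m :=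
  LinearMap.applyₗ (negBasis k) ∘ₗ LinearMap.applyₗ (negBasis j) ∘ₗ LinearMap.applyₗ (negBasis i)

/-- The induced inner product on `C¹(𝔤₋, 𝔤) = 𝔤₋^* ⊗ 𝔤`. -/
noncomputable def ip1 : LinearMap.BilinForm ℝ (C1 n m) :=
  ∑ i, (negLen i)⁻¹ • (ipG n m).compl₁₂ (ev1 n m i) (ev1 n m i)

/-- The induced inner product on `C²(𝔤₋, 𝔤) = ⋀² 𝔤₋^* ⊗ 𝔤`; the factor `1/2` accounts for summing
over ordered instead of unordered pairs of basis elements. -/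
noncomputable def ip2 : LinearMap.BilinForm ℝ (C2 n m) :=
  (1 / 2 : ℝ) • ∑ i, ∑ j, (negLen i * negLen j)⁻¹ •
    (ipG n m).compl₁₂ (ev2 n m i j) (ev2 n m i j)

/-- The inner product on trilinear maps which restricts to the induced inner product on
`C³(𝔤₋, 𝔤) = ⋀³ 𝔤₋^* ⊗ 𝔤`. -/
noncomputable def ip3 : LinearMap.BilinForm ℝ (T3 n m) :=
  (1 / 6 : ℝ) • ∑ i, ∑ j, ∑ k, (negLen i * negLen j * negLen k)⁻¹ •
    (ipG n m).compl₁₂ (ev3 n m i j k) (ev3 n m i j k)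

variable {n m}

lemma lenV_pos (k : Fin (n + 1)) : 0 < lenV n k := by unfold lenV; positivity

lemma negLen_pos : ∀ i : NegIdx n m, 0 < negLen i
  | none => one_pos
  | some p => lenV_pos p.1

lemma ipG_apply (u w : SymAlg n m) : ipG n m u w = u.x * w.x + 2 * (u.h * w.h) + u.y * w.y
    + ∑ a, ∑ b, u.gl a b * w.gl a b + ∑ k, ∑ a, lenV n k * (u.v k a * w.v k a) := rfl

lemma ip1_apply (φ ψ : C1 n m) : ip1 n m φ ψ =
    ∑ i, (negLen i)⁻¹ * ipG n m (φ (negBasis i)) (ψ (negBasis i)) := by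
  simp only [ip1, LinearMap.sum_apply, LinearMap.smul_apply, smul_eq_mul, LinearMap.compl₁₂_apply]
  rfl

lemma ip2_apply (φ ψ : C2 n m) : ip2 n m φ ψ =
    1 / 2 * ∑ i, ∑ j, (negLen i * negLen j)⁻¹ *
      ipG n m (φ (negBasis i) (negBasis j)) (ψ (negBasis i) (negBasis j)) := by
  simp only [ip2, LinearMap.sum_apply, LinearMap.smul_apply, smul_eq_mul, LinearMap.compl₁₂_apply]
  rfl

lemma ip3_apply (φ ψ : T3 n m) : ip3 n m φ ψ =
    1 / 6 * ∑ i, ∑ j, ∑ k, (negLen i * negLen j * negLen k)⁻¹ *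
      ipG n m (φ (negBasis i) (negBasis j) (negBasis k))
        (ψ (negBasis i) (negBasis j) (negBasis k)) := by
  simp only [ip3, LinearMap.sum_apply, LinearMap.smul_apply, smul_eq_mul, LinearMap.compl₁₂_apply]
  rfl

lemma ipG_comm (u w : SymAlg n m) : ipG n m u w = ipG n m w u := by
  simp only [ipG_apply, mul_comm]

lemma ipG_self_nonneg (u : SymAlg n m) : 0 ≤ ipG n m u u := by
  rw [ipG_apply]
  have h1 : 0 ≤ ∑ a, ∑ b, u.gl a b * u.gl a b :=
    Finset.sum_nonneg fun a _ => Finset.sum_nonneg fun b _ => mul_self_nonneg _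
  have h2 : 0 ≤ ∑ k, ∑ a, lenV n k * (u.v k a * u.v k a) :=
    Finset.sum_nonneg fun k _ => Finset.sum_nonneg fun a _ =>
      mul_nonneg (lenV_pos k).le (mul_self_nonneg _)
  nlinarith [mul_self_nonneg u.x, mul_self_nonneg u.h, mul_self_nonneg u.y]

lemma ipG_self_eq_zero {u : SymAlg n m} (hu : ipG n m u u = 0) : u = 0 := by
  rw [ipG_apply] at hu
  have h1 : 0 ≤ ∑ a, ∑ b, u.gl a b * u.gl a b :=
    Finset.sum_nonneg fun a _ => Finset.sum_nonneg fun b _ => mul_self_nonneg _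
  have h2 : 0 ≤ ∑ k, ∑ a, lenV n k * (u.v k a * u.v k a) :=
    Finset.sum_nonneg fun k _ => Finset.sum_nonneg fun a _ =>
      mul_nonneg (lenV_pos k).le (mul_self_nonneg _)
  have hx := mul_self_nonneg u.x
  have hh := mul_self_nonneg u.h
  have hy := mul_self_nonneg u.y
  have h1' : ∑ a, ∑ b, u.gl a b * u.gl a b = 0 := by linarith
  have h2' : ∑ k, ∑ a, lenV n k * (u.v k a * u.v k a) = 0 := by linarith
  ext a b
  · exact mul_self_eq_zero.mp (by linarith)
  · exact mul_self_eq_zero.mp (by linarith)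
  · exact mul_self_eq_zero.mp (by linarith)
  · have h3 := (Finset.sum_eq_zero_iff_of_nonneg
      (fun a _ => Finset.sum_nonneg fun b _ => mul_self_nonneg (u.gl a b))).mp h1' a
      (Finset.mem_univ a)
    have h4 := (Finset.sum_eq_zero_iff_of_nonneg (fun b _ => mul_self_nonneg (u.gl a b))).mp h3 b
      (Finset.mem_univ b)
    exact mul_self_eq_zero.mp h4
  · have h3 := (Finset.sum_eq_zero_iff_of_nonneg (fun k _ => Finset.sum_nonneg fun a _ =>
      mul_nonneg (lenV_pos k).le (mul_self_nonneg (u.v k a)))).mp h2' a (Finset.mem_univ a)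
    have h4 := (Finset.sum_eq_zero_iff_of_nonneg (fun b _ =>
      mul_nonneg (lenV_pos a).le (mul_self_nonneg (u.v a b)))).mp h3 b (Finset.mem_univ b)
    exact mul_self_eq_zero.mp ((mul_eq_zero.mp h4).resolve_left (lenV_pos a).ne')

/-- Every element of `𝔤₋` is a combination of the elements of `negBasis`. -/
lemma gMinus_expand (u : gMinus n m) : u = u.1.x • negBasis (n := n) (m := m) none +
    ∑ p : Fin (n + 1) × Fin m, u.1.v p.1 p.2 • negBasis (some p) := by
  obtain ⟨⟨x, h, y, gl, v⟩, h1, h2, h3⟩ := u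
  simp only at h1 h2 h3
  subst h1 h2 h3
  refine Subtype.ext ?_
  have key : ∀ s : Finset (Fin (n + 1) × Fin m),
      ((∑ p ∈ s, v p.1 p.2 • negBasis (n := n) (m := m) (some p) : gMinus n m) : SymAlg n m) =
        ⟨0, 0, 0, 0, ∑ p ∈ s, Matrix.single p.1 p.2 (v p.1 p.2)⟩ := by
    intro s
    induction s using Finset.induction_on with
    | empty => simp; rfl
    | insert p s hp ih =>
      rw [Finset.sum_insert hp, Finset.sum_insert hp]
      push_cast at ih ⊢
      rw [ih]
      ext1 <;> simp [negBasis]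
  push_cast at key ⊢
  rw [key]
  ext1 <;> simp [negBasis, elX]
  rw [Fintype.sum_prod_type]
  exact Matrix.matrix_eq_sum_single v

lemma linearMap_ext_negBasis {M : Type*} [AddCommGroup M] [Module ℝ M]
    {f g : gMinus n m →ₗ[ℝ] M} (h : ∀ i, f (negBasis i) = g (negBasis i)) : f = g := by
  ext u
  rw [gMinus_expand u]
  simp only [map_add, map_smul, map_sum, h]

lemma ip1_self_eq_zero {φ : C1 n m} (h : ip1 n m φ φ = 0) : φ = 0 := by
  rw [ip1_apply, Finset.sum_eq_zero_iff_of_nonneg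
    (fun i _ => mul_nonneg (inv_nonneg.mpr (negLen_pos i).le) (ipG_self_nonneg _))] at h
  refine linearMap_ext_negBasis fun i => ?_
  exact ipG_self_eq_zero
    ((mul_eq_zero.mp (h i (Finset.mem_univ i))).resolve_left (inv_pos.mpr (negLen_pos i)).ne')

lemma ip2_self_eq_zero {φ : C2 n m} (h : ip2 n m φ φ = 0) : φ = 0 := by
  have hn : ∀ i j : NegIdx n m, 0 ≤ (negLen i * negLen j)⁻¹ *
      ipG n m (φ (negBasis i) (negBasis j)) (φ (negBasis i) (negBasis j)) := fun i j =>
    mul_nonneg (inv_nonneg.mpr (mul_pos (negLen_pos i) (negLen_pos j)).le) (ipG_self_nonneg _)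
  rw [ip2_apply, mul_eq_zero, or_iff_right (by norm_num), Finset.sum_eq_zero_iff_of_nonneg
    (fun i _ => Finset.sum_nonneg fun j _ => hn i j)] at h
  refine Subtype.ext (linearMap_ext_negBasis fun i => linearMap_ext_negBasis fun j => ?_)
  have h1 := h i (Finset.mem_univ i)
  rw [Finset.sum_eq_zero_iff_of_nonneg (fun j _ => hn i j)] at h1
  exact ipG_self_eq_zero ((mul_eq_zero.mp (h1 j (Finset.mem_univ j))).resolve_left
    (inv_pos.mpr (mul_pos (negLen_pos i) (negLen_pos j))).ne')

lemma ip1_nondegenerate : (ip1 n m).Nondegenerate :=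
  ⟨fun φ h => ip1_self_eq_zero (h φ), fun φ h => ip1_self_eq_zero (h φ)⟩

lemma ip2_nondegenerate : (ip2 n m).Nondegenerate :=
  ⟨fun φ h => ip2_self_eq_zero (h φ), fun φ h => ip2_self_eq_zero (h φ)⟩

end Inner

section Harmonic

variable (n m : ℕ)

instance : FiniteDimensional ℝ (gMinus n m) :=
  inferInstanceAs (FiniteDimensional ℝ (gMinus n m).toSubmodule)

instance : FiniteDimensional ℝ (C1 n m) :=
  inferInstanceAs (FiniteDimensional ℝ (gMinus n m →ₗ[ℝ] SymAlg n m))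

/-- The adjoint of `f` with respect to bilinear forms `B₁` (nondegenerate) and `B₂`. -/
noncomputable def adjointOf {E F : Type*} [AddCommGroup E] [Module ℝ E] [FiniteDimensional ℝ E]
    [AddCommGroup F] [Module ℝ F] (B₁ : LinearMap.BilinForm ℝ E) (h₁ : B₁.Nondegenerate)
    (B₂ : LinearMap.BilinForm ℝ F) (f : E →ₗ[ℝ] F) : F →ₗ[ℝ] E :=
  (B₁.toDual h₁).symm.toLinearMap ∘ₗ f.dualMap ∘ₗ B₂

lemma adjointOf_apply {E F : Type*} [AddCommGroup E] [Module ℝ E] [FiniteDimensional ℝ E]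
    [AddCommGroup F] [Module ℝ F] (B₁ : LinearMap.BilinForm ℝ E) (h₁ : B₁.Nondegenerate)
    (B₂ : LinearMap.BilinForm ℝ F) (f : E →ₗ[ℝ] F) (w : F) (v : E) :
    B₁ (adjointOf B₁ h₁ B₂ f w) v = B₂ w (f v) := by
  simp only [adjointOf, LinearMap.comp_apply, LinearEquiv.coe_coe,
    LinearMap.BilinForm.apply_toDual_symm_apply]
  rfl

/-- The differential `∂ : C¹(𝔤₋, 𝔤) → C²(𝔤₋, 𝔤)`. -/
noncomputable abbrev d1 : C1 n m →ₗ[ℝ] C2 n m := d₁₂ ℝ (gMinus n m) (SymAlg n m)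

/-- The differential `∂` on `C²(𝔤₋, 𝔤)`, with values among the alternating trilinear maps. -/
noncomputable abbrev d2 : C2 n m →ₗ[ℝ] T3 n m := d₂₃ ℝ (gMinus n m) (SymAlg n m)

/-- The codifferential `∂^* : C²(𝔤₋, 𝔤) → C¹(𝔤₋, 𝔤)`, adjoint to `∂`. -/
noncomputable def codiff2 : C2 n m →ₗ[ℝ] C1 n m :=
  adjointOf (E := C1 n m) (F := C2 n m) (ip1 n m) ip1_nondegenerate (ip2 n m) (d1 n m)

/-- The codifferential `∂^*` from degree 3 to `C²(𝔤₋, 𝔤)`, adjoint to `∂`. -/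
noncomputable def codiff3 : T3 n m →ₗ[ℝ] C2 n m :=
  adjointOf (E := C2 n m) (F := T3 n m) (ip2 n m) ip2_nondegenerate (ip3 n m) (d2 n m)

/-- `□ = ∂ ∂^* + ∂^* ∂` on `C²(𝔤₋, 𝔤)`. -/
noncomputable def box : C2 n m →ₗ[ℝ] C2 n m :=
  d1 n m ∘ₗ codiff2 n m + codiff3 n m ∘ₗ d2 n m

/-- The harmonic 2-cochains, `ker □ ⊂ C²(𝔤₋, 𝔤)`. -/
noncomputable def harmonic : Submodule ℝ (C2 n m) := LinearMap.ker (box n m)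

end Harmonic

/-! ### The actions of `G₀` and `𝔤₀` on 2-cochains -/

section Actions

/-- `G₀ = {g ∈ P : Ad_g 𝔤₀ ⊂ 𝔤₀}`, where `P = ST₂ × GL_m`: the group of pairs of a diagonal matrix
`diag(s, s⁻¹) ∈ SL₂` and a matrix `A ∈ GL_m`. -/
abbrev G0 (m : ℕ) := ℝˣ × GL (Fin m) ℝ

variable {n m : ℕ}

/-- The adjoint action on `𝔤` of `(diag(s, s⁻¹), A) ∈ G₀`; it multiplies `E_k` by `s^(2k - n)`. -/
noncomputable def Ad (g : G0 m) : SymAlg n m →ₗ[ℝ] SymAlg n m where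
  toFun u :=
    { x := (g.1 : ℝ) ^ (2 : ℤ) * u.x
      h := u.h
      y := (g.1 : ℝ) ^ (-2 : ℤ) * u.y
      gl := (g.2 : Matrix (Fin m) (Fin m) ℝ) * u.gl * (g.2⁻¹ : GL (Fin m) ℝ)
      v := Matrix.diagonal (fun k : Fin (n + 1) => (g.1 : ℝ) ^ (2 * ((k : ℕ) : ℤ) - n)) * u.v *
        (g.2 : Matrix (Fin m) (Fin m) ℝ).transpose }
  map_add' u w := by
    ext1 <;> simp [mul_add, Matrix.mul_add, Matrix.add_mul]
  map_smul' c u := by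
    ext1 <;> simp [mul_left_comm]

lemma Ad_mem_gMinus (g : G0 m) {u : SymAlg n m} (hu : u ∈ gMinus n m) :
    Ad g u ∈ gMinus n m := by
  obtain ⟨h1, h2, h3⟩ := hu
  simp [mem_gMinus, Ad, h1, h2, h3]

/-- The restriction of the adjoint action of `G₀` to `𝔤₋`. -/
noncomputable def AdMinus (g : G0 m) : gMinus n m →ₗ[ℝ] gMinus n m :=
  (Ad g ∘ₗ (gMinus n m).toSubmodule.subtype).codRestrict (gMinus n m).toSubmodule
    fun u => Ad_mem_gMinus g u.2

/-- The action of `G₀` on `C²(𝔤₋, 𝔤)`: `(g · φ)(u, w) = Ad_g φ(Ad_g⁻¹ u, Ad_g⁻¹ w)`. -/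
noncomputable def groupAct (g : G0 m) (φ : C2 n m) : C2 n m :=
  ⟨(φ.1.compl₁₂ (AdMinus g⁻¹) (AdMinus g⁻¹)).compr₂ (Ad g), fun u => by simp⟩

lemma lie_mem_gMinus {a u : SymAlg n m} (ha : a ∈ gZero n m) (hu : u ∈ gMinus n m) :
    ⁅a, u⁆ ∈ gMinus n m := by
  obtain ⟨h1, h2, h3⟩ := hu
  obtain ⟨k1, k2, k3⟩ := ha
  simp [mem_gMinus, h1, h2, h3, k1, k2]

/-- The restriction of `ad a`, `a ∈ 𝔤₀`, to `𝔤₋`. -/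
noncomputable def adMinus (a : gZero n m) : gMinus n m →ₗ[ℝ] gMinus n m :=
  ((LieAlgebra.ad ℝ (SymAlg n m) a.1 : Module.End ℝ (SymAlg n m)) ∘ₗ
      (gMinus n m).toSubmodule.subtype).codRestrict (gMinus n m).toSubmodule
    fun u => lie_mem_gMinus a.2 u.2

/-- The action of `𝔤₀` on `C²(𝔤₋, 𝔤)`:
`(a · φ)(u, w) = [a, φ(u, w)] - φ([a, u], w) - φ(u, [a, w])`. -/
noncomputable def lieAct (a : gZero n m) (φ : C2 n m) : C2 n m :=
  ⟨φ.1.compr₂ (LieAlgebra.ad ℝ (SymAlg n m) a.1 : Module.End ℝ (SymAlg n m)) -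
      φ.1.compl₁₂ (adMinus a) LinearMap.id - φ.1.compl₁₂ LinearMap.id (adMinus a), fun u => by
    have := twoCochain_skew φ u (adMinus a u)
    simp [← this]⟩

lemma groupAct_apply (g : G0 m) (φ : C2 n m) (u w : gMinus n m) :
    groupAct g φ u w = Ad g (φ (AdMinus g⁻¹ u) (AdMinus g⁻¹ w)) := rfl

lemma lieAct_apply (a : gZero n m) (φ : C2 n m) (u w : gMinus n m) :
    lieAct a φ u w = ⁅(a : SymAlg n m), φ u w⁆ - φ (adMinus a u) w - φ u (adMinus a w) := rfl

lemma adMinus_coe (a : gZero n m) (u : gMinus n m) :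
    (adMinus a u : SymAlg n m) = ⁅(a : SymAlg n m), (u : SymAlg n m)⁆ := rfl

end Actions

/-! ### Irreducible C-class modules -/

section Modules

variable {n m : ℕ}

/-- Strong regularity: `φ(𝔤^i, 𝔤^j) ⊂ 𝔤^{i+j+1} ∩ 𝔤^{min(i,j)-1}` for all `i, j`. -/
def IsStronglyRegular (φ : C2 n m) : Prop :=
  ∀ (i j : ℤ) (u w : gMinus n m), (u : SymAlg n m) ∈ filt n m i → (w : SymAlg n m) ∈ filt n m j →
    φ u w ∈ filt n m (i + j + 1) ⊓ filt n m (min i j - 1)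

variable (n m) in
/-- `F = span{E_0, …, E_{n-1}} ⊗ W ⊂ V`, as a subspace of `𝔤₋`. -/
noncomputable def subF : Submodule ℝ (gMinus n m) where
  carrier := {u | (u : SymAlg n m).x = 0 ∧ (u : SymAlg n m).v (Fin.last n) = 0}
  zero_mem' := ⟨rfl, rfl⟩
  add_mem' := by
    rintro u w ⟨h1, h2⟩ ⟨k1, k2⟩
    refine ⟨by simp [h1, k1], ?_⟩
    ext a
    have h3 := congrFun h2 a
    have k3 := congrFun k2 a
    simp only [Pi.zero_apply] at h3 k3
    simp [h3, k3]
  smul_mem' := by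
    rintro c u ⟨h1, h2⟩
    refine ⟨by simp [h1], ?_⟩
    ext a
    have h3 := congrFun h2 a
    simp only [Pi.zero_apply] at h3
    simp [h3]

/-- The projection of the `V`-component of an element of `𝔤` to `V / F ≅ W`: its `E_n`-part. -/
def modF (u : SymAlg n m) : Fin m → ℝ := u.v (Fin.last n)

/-- The Doubrov–Medvedev condition: the restriction of `φ` to `⋀² F`, taken modulo `F`, is of the
form `(u, w) ↦ B(u) · w - B(w) · u mod F` for some linear `B : F → ℝ 𝖷` (written `u ↦ B u • 𝖷`). -/
def IsDM (φ : C2 n m) : Prop :=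
  ∃ B : subF n m →ₗ[ℝ] ℝ, ∀ u w : subF n m,
    modF (φ u.1 w.1) = modF (⁅B u • elX n m, (w.1 : SymAlg n m)⁆ -
      ⁅B w • elX n m, (u.1 : SymAlg n m)⁆)

/-- All elements of `U` have bi-grade `(s, t)`, i.e. `𝖹₁` and `𝖹₂` act on `U` as `s` and `t`. -/
def HasBigrade (U : Submodule ℝ (C2 n m)) (s t : ℝ) : Prop :=
  ∀ φ ∈ U, lieAct ⟨elZ₁ n m, elZ₁_mem⟩ φ = s • φ ∧ lieAct ⟨elZ₂ n m, elZ₂_mem⟩ φ = t • φ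

/-- `U` is invariant under `G₀`. -/
def IsG0Submodule (U : Submodule ℝ (C2 n m)) : Prop :=
  ∀ (g : G0 m), ∀ φ ∈ U, groupAct g φ ∈ U

/-- `U` is an irreducible C-class module: a nonzero irreducible `G₀`-submodule of `ker □`, of
bi-grade `(1,1)` (type `𝔸₂`) or `(2,2)` (type `𝔹₄`), which consists of strongly regular cochains
and, for equations of order `n + 1 ≥ 4`, satisfies the Doubrov–Medvedev condition. -/
structure IsIrreducibleCClassModule (U : Submodule ℝ (C2 n m)) : Prop where
  ne_bot : U ≠ ⊥
  invariant : IsG0Submodule U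
  irreducible : ∀ U' : Submodule ℝ (C2 n m), IsG0Submodule U' → U' ≤ U → U' = ⊥ ∨ U' = U
  harmonic : U ≤ harmonic n m
  bigrade : HasBigrade U 1 1 ∨ HasBigrade U 2 2
  stronglyRegular : ∀ φ ∈ U, IsStronglyRegular φ
  dm : 3 ≤ n → ∀ φ ∈ U, IsDM φ

/-- `φ` is a lowest weight vector of `U`: a nonzero element annihilated by all lowering operators,
i.e. by all strictly lower triangular matrices in `𝔰𝔩(W)`. -/
def IsLowestWeightVector (U : Submodule ℝ (C2 n m)) (φ : C2 n m) : Prop :=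
  φ ∈ U ∧ φ ≠ 0 ∧ ∀ N : Matrix (Fin m) (Fin m) ℝ, (∀ a b, a ≤ b → N a b = 0) →
    lieAct ⟨ofGl n m N, ofGl_mem N⟩ φ = 0

/-- `φ` has `𝔰𝔩(W)`-weight `∑ l_a ε_a`: every diagonal trace-free matrix `diag(d)` multiplies it by
`∑ l_a d_a`. -/
def HasWeight (φ : C2 n m) (l : Fin m → ℝ) : Prop :=
  ∀ d : Fin m → ℝ, ∑ a, d a = 0 →
    lieAct ⟨ofGl n m (Matrix.diagonal d), ofGl_mem _⟩ φ = (∑ a, l a * d a) • φ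

/-- The weight `ε_k`, `1 ≤ k ≤ m`. -/
def eps (m : ℕ) (k : ℕ) : Fin m → ℝ := fun a => if (a : ℕ) + 1 = k then 1 else 0

/-- `U` is an irreducible C-class module with bi-grade `(s,t)` and `𝔰𝔩(W)`-lowest weight `l`. -/
def IsModuleOfType (U : Submodule ℝ (C2 n m)) (s t : ℝ) (l : Fin m → ℝ) : Prop :=
  IsIrreducibleCClassModule U ∧ HasBigrade U s t ∧ ∃ φ, IsLowestWeightVector U φ ∧ HasWeight φ l

/-- The module `𝔹₄ ≅ S² W^*`. -/
def IsB4 (U : Submodule ℝ (C2 n m)) : Prop := IsModuleOfType U 2 2 ((-2 : ℝ) • eps m 1)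

/-- The module `𝔸₂^tr ≅ W^*`. -/
def IsA2tr (U : Submodule ℝ (C2 n m)) : Prop := IsModuleOfType U 1 1 (-eps m 1)

/-- The module `𝔸₂^tf ≅ (S² W^* ⊗ W)₀`. -/
def IsA2tf (U : Submodule ℝ (C2 n m)) : Prop := IsModuleOfType U 1 1 (eps m m - (2 : ℝ) • eps m 1)

end Modules

/-! ### The explicit 2-cochains -/

section Table

variable (n m : ℕ)

/-- The dual basis element `E^{k,a}`, for labels `k ≤ n` and `1 ≤ a ≤ m`. -/
noncomputable def dualV (k a : ℕ) : gMinus n m →ₗ[ℝ] ℝ where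
  toFun u := ∑ i : Fin (n + 1), ∑ b : Fin m,
    if (i : ℕ) = k ∧ (b : ℕ) + 1 = a then (u : SymAlg n m).v i b else 0
  map_add' u w := by
    simp only [← Finset.sum_add_distrib]
    refine Finset.sum_congr rfl fun i _ => Finset.sum_congr rfl fun b _ => ?_
    split_ifs <;> simp
  map_smul' c u := by
    simp only [Finset.smul_sum]
    refine Finset.sum_congr rfl fun i _ => Finset.sum_congr rfl fun b _ => ?_
    split_ifs <;> simp

variable {n m}

/-- The 2-cochain `f ∧ g ⊗ A`, i.e. `(u, w) ↦ (f(u) g(w) - g(u) f(w)) A`. -/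
noncomputable def wedge (f g : gMinus n m →ₗ[ℝ] ℝ) (A : SymAlg n m) : C2 n m :=
  ⟨f.smulRight (g.smulRight A) - g.smulRight (f.smulRight A), fun u => by
    simp [smul_smul, mul_comm]⟩

lemma wedge_apply (f g : gMinus n m →ₗ[ℝ] ℝ) (A : SymAlg n m) (u w : gMinus n m) :
    wedge f g A u w = (f u * g w - g u * f w) • A := by
  have : wedge f g A u w = f u • g w • A - g u • f w • A := rfl
  rw [this, smul_smul, smul_smul, sub_smul]

variable (n m)

/-- The lowest weight vector of `𝔹₄` (used for `n = 2`). -/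
noncomputable def PhiB4 : C2 n m :=
  wedge (dualV n m 2 1) (dualV n m 1 1) (elX n m)
    - (1 / 2 : ℝ) • wedge (dualV n m 2 1) (dualV n m 0 1) (elH n m)
    - (1 / 2 : ℝ) • wedge (dualV n m 1 1) (dualV n m 0 1) (elY n m)
    + ∑ a ∈ Finset.Icc 1 m,
        (wedge (dualV n m 2 1) (dualV n m 0 a) (elE n m a 1)
          - wedge (dualV n m 1 1) (dualV n m 1 a) (elE n m a 1)
          + wedge (dualV n m 0 1) (dualV n m 2 a) (elE n m a 1))

/-- `∑_a E^{i,1} ∧ E^{j,a} ⊗ E_{i+j-1,a}`. -/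
noncomputable def phiTr (i j : ℕ) : C2 n m :=
  ∑ a ∈ Finset.Icc 1 m, wedge (dualV n m i 1) (dualV n m j a) (elV n m ((i : ℤ) + j - 1) a)

/-- The family of 2-cochains containing the lowest weight vectors of `𝔸₂^tr`. -/
noncomputable def PhiA2tr (α β : ℝ) : C2 n m :=
  α • ∑ i ∈ Finset.range (n + 1), (phiTr n m 2 i + ((n : ℝ) / 2 - i) • phiTr n m 1 i
      - (1 / 2 * (i : ℝ) * (n + 1 - i)) • phiTr n m 0 i)
    + β • ∑ i ∈ Finset.range (n + 1), (((n : ℝ) + 1 - i) • (phiTr n m i 0 - phiTr n m 0 i)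
      + phiTr n m i 1 - phiTr n m 1 i)

/-- `E^{i,1} ∧ E^{j,1} ⊗ E_{i+j-1,m}`. -/
noncomputable def phiTf (i j : ℕ) : C2 n m :=
  wedge (dualV n m i 1) (dualV n m j 1) (elV n m ((i : ℤ) + j - 1) m)

/-- The lowest weight vector of `𝔸₂^tf`. -/
noncomputable def PhiA2tf : C2 n m :=
  ∑ j ∈ Finset.range (n + 1), (((n : ℝ) + 1 - j) • phiTf n m 0 j + phiTf n m 1 j)

end Table

end CClass

open CClass

/-!
A module of the required kind contains a lowest weight vector, because strictly lower triangular
matrices raise a finite filtration of `𝔤` by height (`exists_isLowestWeightVector`), and by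
irreducibility it is generated by this vector. So the task is to find all harmonic lowest weight
vectors in the two bi-grades, and to decide which of them generate irreducible modules. A cochain is
harmonic if and only if it is closed and orthogonal to all coboundaries (`mem_harmonic`), and `G₀`
preserves all the conditions (`isG0Submodule_cclassSpace`), as the adjoint of the action of `g` is
the action of its transpose. A submodule generated by a lowest weight vector `Φ` is irreducible as
soon as all its lowest weight vectors are multiples of `Φ` (`isIrreducible_genBy`).

Bi-grade `(2, 2)`. There are no coboundaries, and a cocycle vanishes on `𝖷`. Equivariance under `𝖷`
and the Bianchi identity express it by the symmetric form `yPart`, and they force this form to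
vanish if `n ≥ 3` (`eq_zero_of_bigrade_two`). For `n = 2` a symmetric form which is annihilated by
the lowering operators is a multiple of `(w^1)²` (`bilin_lowest`), and `PhiB4` realizes it.

Bi-grade `(1, 1)`. Subtracting a coboundary makes a cocycle vanish on `𝖷` and, by the
Doubrov–Medvedev condition, on `E_i ⊗ W, E_j ⊗ W` with `i, j ≥ 2`, `i + j = n + 1`. By descending
induction along `𝖷` the remaining cocycle is determined by a symmetric `W`-valued form on `W`
(`normalized_cocycle`), which therefore determines a harmonic `φ`, as an exact harmonic cochain is
zero (`classForm_spec`). If `φ` is annihilated by the lowering operators, so is its form, which then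
lies in the span of `w^1 ⊙ id` and `(w^1)² ⊗ w_m` (`form_lowest`); these are the forms of `PhiA2tr`
and `PhiA2tf` up to scale. Hence `φ` is a combination of these two cochains
(`exists_eq_smul_add_smul`). They have different weights, so that an irreducible module contains one
of them. Two `G₀`-invariant linear conditions, `traceFree` and `scalarDiag`, show that neither of
them lies in the submodule generated by the other one.

That the explicit cochains are closed and coclosed is checked on their coefficients: `IsNormalForm`
collects the structure which `PhiA2tr` and `PhiA2tf` share, and `IsNormalForm.coclosed` reduces
coclosedness to four sums, which for `PhiA2tr` amount to the relation between `α` and `β`.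
-/


open LieModule.Cohomology

namespace CClass

variable {n m : ℕ}

/-! ### Homogeneous elements of `𝔤₋` -/

/-- The element `E_k ⊗ w` of `V ⊂ 𝔤`, as a linear function of `w ∈ W`; it vanishes for `k > n`. -/
def vecG (n k : ℕ) : (Fin m → ℝ) →ₗ[ℝ] SymAlg n m where
  toFun w := ⟨0, 0, 0, 0, Matrix.of fun i a => if (i : ℕ) = k then w a else 0⟩
  map_add' w w' := by
    ext i a
    · simp
    · simp
    · simp
    · simp
    · simp only [Matrix.of_apply, Matrix.add_apply, SymAlg.add_v]
      split_ifs <;> simp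
  map_smul' c w := by
    ext i a <;> simp

lemma vecG_mem (k : ℕ) (w : Fin m → ℝ) : vecG n k w ∈ gMinus n m := ⟨rfl, rfl, rfl⟩

/-- The element `E_k ⊗ w` of `𝔤₋`, as a linear function of `w ∈ W`; it vanishes for `k > n`. -/
noncomputable def vec (n k : ℕ) : (Fin m → ℝ) →ₗ[ℝ] gMinus n m :=
  (vecG n k).codRestrict (gMinus n m).toSubmodule (vecG_mem k)

@[simp] lemma coe_vec (k : ℕ) (w : Fin m → ℝ) : (vec n k w : SymAlg n m) = vecG n k w := rfl

/-- `𝖷` as an element of `𝔤₋`. -/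
noncomputable def negX (n m : ℕ) : gMinus n m := ⟨elX n m, rfl, rfl, rfl⟩

@[simp] lemma coe_negX : (negX n m : SymAlg n m) = elX n m := rfl

@[simp] lemma vecG_x (k : ℕ) (w : Fin m → ℝ) : (vecG n k w).x = 0 := rfl
@[simp] lemma vecG_h (k : ℕ) (w : Fin m → ℝ) : (vecG n k w).h = 0 := rfl
@[simp] lemma vecG_y (k : ℕ) (w : Fin m → ℝ) : (vecG n k w).y = 0 := rfl
@[simp] lemma vecG_gl (k : ℕ) (w : Fin m → ℝ) : (vecG n k w).gl = 0 := rfl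
lemma vecG_v (k : ℕ) (w : Fin m → ℝ) (i : Fin (n + 1)) (a : Fin m) :
    (vecG n k w).v i a = if (i : ℕ) = k then w a else 0 := rfl

lemma vecG_v_row (k : ℕ) (w : Fin m → ℝ) (i : Fin (n + 1)) :
    (vecG n k w).v i = if (i : ℕ) = k then w else 0 := by
  ext a
  rw [vecG_v]
  split_ifs <;> rfl

lemma vecG_eq_zero {k : ℕ} (hk : n < k) (w : Fin m → ℝ) : vecG n k w = 0 := by
  ext i a
  · rfl
  · rfl
  · rfl
  · rfl
  · rw [vecG_v, if_neg (by omega)]; rfl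

lemma vec_eq_zero {k : ℕ} (hk : n < k) (w : Fin m → ℝ) : vec n k w = 0 :=
  Subtype.ext (vecG_eq_zero hk w)

lemma vecG_inj {k : ℕ} (hk : k ≤ n) {w w' : Fin m → ℝ} (h : vecG n k w = vecG n k w') : w = w' := by
  ext a
  have := congrArg (fun u : SymAlg n m => u.v ⟨k, by omega⟩ a) h
  simpa [vecG_v] using this

lemma vecG_sl (k : ℕ) (w : Fin m → ℝ) : (vecG n k w).sl = 0 := by
  simp [SymAlg.sl]

lemma sl_mul_vecG (M : Matrix (Fin (n + 1)) (Fin (n + 1)) ℝ) {k : ℕ} (hk : k < n + 1)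
    (w : Fin m → ℝ) (i : Fin (n + 1)) (a : Fin m) :
    (M * (vecG n k w).v) i a = M i ⟨k, hk⟩ * w a := by
  rw [Matrix.mul_apply, Finset.sum_eq_single ⟨k, hk⟩]
  · simp [vecG_v]
  · intro j _ hj
    rw [vecG_v, if_neg (fun h => hj (Fin.ext h)), mul_zero]
  · simp

/-- The bracket of an arbitrary element with `E_k ⊗ w`. At `k = 0` and `k = n + 1` the coefficient
`k (n + 1 - k)` vanishes, so that the truncated subtraction `k - 1` is harmless. -/
lemma lie_vecG (u : SymAlg n m) (k : ℕ) (w : Fin m → ℝ) :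
    ⁅u, vecG n k w⁆ = u.x • vecG n (k + 1) w + (u.h * (2 * k - n)) • vecG n k w
      + (u.y * (k * (n + 1 - k))) • vecG n (k - 1) w + vecG n k (u.gl.mulVec w) := by
  ext i a
  · simp
  · simp
  · simp
  · simp
  rcases le_or_gt k n with hk | hk
  · have hk' : k < n + 1 := by omega
    simp only [SymAlg.lie_v, SymAlg.actV, vecG_sl, vecG_gl, Matrix.transpose_zero, Matrix.zero_mul,
      Matrix.mul_zero, add_zero, sub_zero, Matrix.add_apply, SymAlg.add_v, SymAlg.smul_v,
      Matrix.smul_apply, vecG_v, smul_eq_mul]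
    rw [sl_mul_vecG _ hk']
    have h1 : ((vecG n k w).v * u.gl.transpose) i a =
        if (i : ℕ) = k then u.gl.mulVec w a else 0 := by
      rw [Matrix.mul_apply]
      simp only [vecG_v, Matrix.transpose_apply, Matrix.mulVec, dotProduct]
      split_ifs
      · exact Finset.sum_congr rfl fun _ _ => mul_comm _ _
      · simp
    rw [h1]
    simp only [SymAlg.sl, rhoX, rhoH, rhoY, Matrix.add_apply, Matrix.smul_apply, Matrix.of_apply,
      smul_eq_mul]
    rcases Nat.eq_zero_or_pos k with rfl | hpos
    · simp only [Nat.cast_zero, zero_mul, mul_zero, ite_self, add_zero]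
      split_ifs <;> ring
    · have h2 : ((i : ℕ) + 1 = k) ↔ ((i : ℕ) = k - 1) := by omega
      simp only [h2]
      split_ifs <;> ring
  · have h1 : ((k : ℝ) * (n + 1 - k)) • vecG (m := m) n (k - 1) w = 0 := by
      rcases Nat.lt_or_ge (n + 1) k with h | h
      · rw [vecG_eq_zero (by omega), smul_zero]
      · have : (k : ℝ) = n + 1 := by exact_mod_cast (by omega : k = n + 1)
        rw [this, sub_self, mul_zero, zero_smul]
    have h2 : (u.y * ((k : ℝ) * (n + 1 - k))) • vecG (m := m) n (k - 1) w = 0 := by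
      rw [mul_smul, h1, smul_zero]
    simp [h2, vecG_eq_zero hk, vecG_eq_zero (Nat.lt_succ_of_lt hk)]

lemma elX_lie_vecG (k : ℕ) (w : Fin m → ℝ) : ⁅elX n m, vecG n k w⁆ = vecG n (k + 1) w := by
  simp [lie_vecG, elX]

lemma ofGl_lie_vecG (N : Matrix (Fin m) (Fin m) ℝ) (k : ℕ) (w : Fin m → ℝ) :
    ⁅ofGl n m N, vecG n k w⁆ = vecG n k (N.mulVec w) := by
  simp [lie_vecG, ofGl]

lemma elZ₁_lie_vecG (k : ℕ) (w : Fin m → ℝ) :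
    ⁅elZ₁ n m, vecG n k w⁆ = (-(k : ℝ)) • vecG n k w := by
  simp only [lie_vecG, elZ₁, zero_smul, zero_mul, Matrix.smul_mulVec, Matrix.one_mulVec, map_smul]
  module

lemma elZ₂_lie_vecG (k : ℕ) (w : Fin m → ℝ) : ⁅elZ₂ n m, vecG n k w⁆ = -vecG n k w := by
  simp [lie_vecG, elZ₂, Matrix.neg_mulVec]

lemma vecG_lie_vecG (k l : ℕ) (v w : Fin m → ℝ) : ⁅vecG n k v, vecG n l w⁆ = 0 := by
  simp [lie_vecG]

lemma lie_elX (u : SymAlg n m) (hv : u.v = 0) :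
    ⁅u, elX n m⁆ = (2 * u.h) • elX n m - u.y • elH n m := by
  ext1 <;> simp [elX, elH, SymAlg.actV, hv]

lemma negX_lie_vec (k : ℕ) (w : Fin m → ℝ) : ⁅negX n m, vec n k w⁆ = vec n (k + 1) w :=
  Subtype.ext (elX_lie_vecG k w)

lemma vec_lie_vec (k l : ℕ) (v w : Fin m → ℝ) : ⁅vec n k v, vec n l w⁆ = 0 :=
  Subtype.ext (vecG_lie_vecG k l v w)

lemma negBasis_none : negBasis (n := n) (m := m) none = negX n m := rfl

lemma negBasis_some (p : Fin (n + 1) × Fin m) :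
    negBasis (some p) = vec n p.1 (Pi.single p.2 1) := by
  refine Subtype.ext ?_
  change (⟨0, 0, 0, 0, Matrix.single p.1 p.2 1⟩ : SymAlg n m) = vecG n p.1 (Pi.single p.2 1)
  ext i a
  · rfl
  · rfl
  · rfl
  · rfl
  · rw [vecG_v]
    simp only [Matrix.single_apply, Pi.single_apply, Fin.ext_iff]
    split_ifs <;> simp_all

/-- Every element of `𝔤₋` is `x 𝖷 + ∑ E_k ⊗ u_k`. -/
lemma gMinus_eq_sum (u : gMinus n m) :
    u = (u : SymAlg n m).x • negX n m + ∑ k : Fin (n + 1), vec n k ((u : SymAlg n m).v k) := by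
  conv_lhs => rw [gMinus_expand u]
  rw [negBasis_none, Fintype.sum_prod_type]
  congr 1
  refine Finset.sum_congr rfl fun k _ => ?_
  simp only [negBasis_some, ← map_smul, ← map_sum]
  congr 1
  ext a
  simp [Finset.sum_apply, Pi.single_apply]

/-- A linear map on `𝔤₋` is determined by its values on `𝖷` and on all `E_k ⊗ w`. -/
lemma gMinus_hom_ext {M : Type*} [AddCommGroup M] [Module ℝ M] {f g : gMinus n m →ₗ[ℝ] M}
    (hX : f (negX n m) = g (negX n m))
    (hV : ∀ k ≤ n, ∀ w, f (vec n k w) = g (vec n k w)) : f = g := by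
  ext u
  rw [gMinus_eq_sum u]
  simp only [map_add, map_smul, map_sum, hX]
  congr 1
  exact Finset.sum_congr rfl fun k _ => hV k (by omega) _

lemma C2_skew (φ : C2 n m) (u w : gMinus n m) : φ w u = -φ u w := (twoCochain_skew φ u w).symm

/-- A 2-cochain is determined by its values on pairs `𝖷, E_k ⊗ w` and `E_k ⊗ v, E_l ⊗ w`. -/
lemma C2_ext {φ ψ : C2 n m}
    (hX : ∀ k ≤ n, ∀ w, φ (negX n m) (vec n k w) = ψ (negX n m) (vec n k w))
    (hV : ∀ k ≤ n, ∀ l ≤ n, ∀ v w, φ (vec n k v) (vec n l w) = ψ (vec n k v) (vec n l w)) :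
    φ = ψ := by
  have key : φ.1 = ψ.1 := by
    refine gMinus_hom_ext (gMinus_hom_ext ?_ hX) fun k hk v => gMinus_hom_ext ?_ ?_
    · exact (twoCochain_alt φ _).trans (twoCochain_alt ψ _).symm
    · change φ _ _ = ψ _ _
      rw [C2_skew φ, C2_skew ψ, hX k hk]
    · exact fun l hl w => hV k hk l hl v w
  exact Subtype.ext key

lemma C2_sub_apply (φ ψ : C2 n m) (u w : gMinus n m) : (φ - ψ) u w = φ u w - ψ u w := rfl
lemma C2_zero_apply (u w : gMinus n m) : (0 : C2 n m) u w = 0 := rfl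

/-- Evaluation of 2-cochains at a pair of elements, as a linear map. -/
noncomputable def evalAt (u w : gMinus n m) : C2 n m →ₗ[ℝ] SymAlg n m :=
  LinearMap.applyₗ w ∘ₗ LinearMap.applyₗ u ∘ₗ Submodule.subtype _

lemma C2_sum_apply {ι : Type*} (s : Finset ι) (φ : ι → C2 n m) (u w : gMinus n m) :
    (∑ i ∈ s, φ i) u w = ∑ i ∈ s, φ i u w := map_sum (evalAt u w) φ s

/-! ### The cocycle condition -/

lemma gMinus_lie (u : gMinus n m) (a : SymAlg n m) : ⁅u, a⁆ = ⁅(u : SymAlg n m), a⁆ := rfl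

lemma d1_apply (ψ : C1 n m) (u w : gMinus n m) :
    d1 n m ψ u w = ⁅(u : SymAlg n m), ψ w⁆ - ⁅(w : SymAlg n m), ψ u⁆ - ψ ⁅u, w⁆ := rfl

lemma d1_vec_vec (ψ : C1 n m) (k l : ℕ) (v w : Fin m → ℝ) :
    d1 n m ψ (vec n k v) (vec n l w) = ⁅ψ (vec n k v), vecG n l w⁆ - ⁅ψ (vec n l w), vecG n k v⁆ := by
  rw [d1_apply, vec_lie_vec, map_zero, sub_zero, coe_vec, coe_vec, ← lie_skew (vecG n k v),
    ← lie_skew (vecG n l w)]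
  abel

lemma d1_negX_vec (ψ : C1 n m) (hX : ψ (negX n m) = 0) (k : ℕ) (w : Fin m → ℝ) :
    d1 n m ψ (negX n m) (vec n k w) = ⁅elX n m, ψ (vec n k w)⁆ - ψ (vec n (k + 1) w) := by
  rw [d1_apply, hX, lie_zero, sub_zero, negX_lie_vec, coe_negX]

lemma cocycle_negX_vec_vec {φ : C2 n m} (h : d2 n m φ = 0) (k l : ℕ) (v w : Fin m → ℝ) :
    ⁅elX n m, φ (vec n k v) (vec n l w)⁆ = φ (vec n (k + 1) v) (vec n l w) +
      φ (vec n k v) (vec n (l + 1) w) + ⁅φ (negX n m) (vec n k v), vecG n l w⁆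
      - ⁅φ (negX n m) (vec n l w), vecG n k v⁆ := by
  have := congrArg (fun t : T3 n m => t (negX n m) (vec n k v) (vec n l w)) h
  simp only [d₂₃_apply, negX_lie_vec, vec_lie_vec, map_zero, LinearMap.zero_apply,
    gMinus_lie, coe_vec, coe_negX] at this
  rw [C2_skew φ (vec n k v) (vec n (l + 1) w)] at this
  rw [← lie_skew (φ (negX n m) (vec n k v)), ← lie_skew (φ (negX n m) (vec n l w))]
  rw [← sub_eq_zero, ← this]
  abel

lemma cocycle_vec_vec_vec {φ : C2 n m} (h : d2 n m φ = 0) (i j k : ℕ) (u v w : Fin m → ℝ) :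
    ⁅φ (vec n i u) (vec n j v), vecG n k w⁆ + ⁅φ (vec n j v) (vec n k w), vecG n i u⁆
      + ⁅φ (vec n k w) (vec n i u), vecG n j v⁆ = 0 := by
  have := congrArg (fun t : T3 n m => t (vec n i u) (vec n j v) (vec n k w)) h
  simp only [d₂₃_apply, vec_lie_vec, LinearMap.zero_apply, gMinus_lie, coe_vec] at this
  have h0 : φ (0 : gMinus n m) = 0 := φ.1.map_zero
  rw [h0] at this
  simp only [LinearMap.zero_apply, sub_zero, add_zero] at this
  rw [C2_skew φ (vec n i u) (vec n k w), neg_lie, ← lie_skew (φ (vec n i u) (vec n j v)),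
    ← lie_skew (φ (vec n j v) (vec n k w)), ← lie_skew (φ (vec n i u) (vec n k w))]
  rw [← neg_eq_zero, ← this]
  abel

/-- A cochain which vanishes on `𝖷`, is `𝖷`-equivariant on `V × V` and satisfies the Bianchi
identity is a cocycle. -/
lemma d2_eq_zero {φ : C2 n m} (hX : ∀ k w, φ (negX n m) (vec n k w) = 0)
    (h1 : ∀ k ≤ n, ∀ l ≤ n, ∀ v w, ⁅elX n m, φ (vec n k v) (vec n l w)⁆ =
      φ (vec n (k + 1) v) (vec n l w) + φ (vec n k v) (vec n (l + 1) w))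
    (h2 : ∀ i ≤ n, ∀ j ≤ n, ∀ k ≤ n, ∀ u v w, ⁅φ (vec n i u) (vec n j v), vecG n k w⁆
      + ⁅φ (vec n j v) (vec n k w), vecG n i u⁆ + ⁅φ (vec n k w) (vec n i u), vecG n j v⁆ = 0) :
    d2 n m φ = 0 := by
  have h0 : φ (0 : gMinus n m) = 0 := φ.1.map_zero
  have hXX : φ (negX n m) (negX n m) = 0 := twoCochain_alt φ _
  have hX' : ∀ k w, φ (vec n k w) (negX n m) = 0 := fun k w => by rw [C2_skew, hX, neg_zero]
  have hvX : ∀ k w, ⁅vec (m := m) n k w, negX n m⁆ = -vec n (k + 1) w := fun k w => by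
    rw [← negX_lie_vec, lie_skew]
  have hneg : ∀ u : gMinus n m, φ (-u) = -φ u := fun u => φ.1.map_neg u
  have h1' : ∀ k ≤ n, ∀ l ≤ n, ∀ v w, ⁅elX n m, φ (vec n k v) (vec n l w)⁆ =
      φ (vec n (k + 1) v) (vec n l w) - φ (vec n (l + 1) w) (vec n k v) := fun k hk l hl v w => by
    rw [C2_skew φ (vec n k v) (vec n (l + 1) w), h1 k hk l hl, sub_neg_eq_add]
  refine gMinus_hom_ext (gMinus_hom_ext (gMinus_hom_ext ?_ ?_) ?_) ?_
  · simp
  · intro k hk w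
    simp [d₂₃_apply, hX, hXX, negX_lie_vec, hX', h0]
  · intro k hk v
    refine gMinus_hom_ext ?_ ?_
    · simp [d₂₃_apply, hX, hXX, negX_lie_vec, hX', h0, hvX, hneg]
    · intro l hl w
      simp only [d₂₃_apply, negX_lie_vec, vec_lie_vec, gMinus_lie, coe_vec, coe_negX, hX, h0,
        h1' k hk l hl]
      simp
  · intro i hi u
    refine gMinus_hom_ext (gMinus_hom_ext ?_ ?_) ?_
    · simp [d₂₃_apply, hXX, hX', h0, hvX, hneg]
    · intro k hk w
      simp only [d₂₃_apply, negX_lie_vec, vec_lie_vec, gMinus_lie, coe_vec, coe_negX, hX, h0,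
        hvX, hneg, hX', h1' i hi k hk]
      simp
    · intro j hj v
      refine gMinus_hom_ext ?_ ?_
      · simp only [d₂₃_apply, vec_lie_vec, gMinus_lie, coe_vec, coe_negX, h0, hvX, hneg, hX',
          h1' i hi j hj]
        simp
        abel
      · intro k hk w
        have := h2 i hi j hj k hk u v w
        rw [C2_skew φ (vec n i u) (vec n k w), neg_lie, ← lie_skew (φ (vec n i u) (vec n j v)),
          ← lie_skew (φ (vec n j v) (vec n k w)), ← lie_skew (φ (vec n i u) (vec n k w))] at this
        simp only [d₂₃_apply, vec_lie_vec, gMinus_lie, coe_vec, h0, LinearMap.zero_apply,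
          sub_zero, add_zero]
        rw [← neg_eq_zero, ← this]
        abel

/-! ### The action of `G₀` -/

lemma C2_ext_apply {φ ψ : C2 n m} (h : ∀ u w, φ u w = ψ u w) : φ = ψ :=
  C2_ext (fun _ _ _ => h _ _) (fun _ _ _ _ _ _ => h _ _)

lemma C2_sub_mem {U : Submodule ℝ (C2 n m)} {φ ψ : C2 n m} (hφ : φ ∈ U) (hψ : ψ ∈ U) :
    φ - ψ ∈ U := by
  have : φ - ψ = φ + (-1 : ℝ) • ψ := C2_ext_apply fun u w => by
    simp only [C2_sub_apply, add_apply_apply, smul_apply_apply]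
    module
  rw [this]
  exact U.add_mem hφ (U.smul_mem _ hψ)

lemma Ad_mul (g h : G0 m) (u : SymAlg n m) : Ad (g * h) u = Ad g (Ad h u) := by
  ext1
  · simp [Ad, mul_pow, mul_assoc]
  · simp [Ad]
  · simp [Ad, mul_pow, mul_assoc, mul_left_comm]
  · simp [Ad, Matrix.mul_assoc]
  · ext i a
    simp only [Ad, LinearMap.coe_mk, AddHom.coe_mk, Prod.fst_mul, Prod.snd_mul, Units.val_mul,
      Matrix.transpose_mul, mul_zpow]
    rw [← Matrix.diagonal_mul_diagonal]
    simp only [Matrix.mul_assoc]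

lemma Ad_one (u : SymAlg n m) : Ad 1 u = u := by
  ext1 <;> simp [Ad]

lemma sl_Ad_mul (g : G0 m) (u : SymAlg n m) :
    (Ad g u).sl * Matrix.diagonal (fun k : Fin (n + 1) => (g.1 : ℝ) ^ (2 * ((k : ℕ) : ℤ) - n)) =
    Matrix.diagonal (fun k : Fin (n + 1) => (g.1 : ℝ) ^ (2 * ((k : ℕ) : ℤ) - n)) * u.sl := by
  ext i j
  have hs : (g.1 : ℝ) ≠ 0 := g.1.ne_zero
  rw [Matrix.mul_diagonal, Matrix.diagonal_mul]
  simp only [SymAlg.sl, rhoX, rhoH, rhoY, Matrix.add_apply, Matrix.smul_apply, Matrix.of_apply,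
    smul_eq_mul, Ad, LinearMap.coe_mk, AddHom.coe_mk]
  have h1 : (i : ℕ) = j + 1 → (g.1 : ℝ) ^ (2 : ℤ) * (g.1 : ℝ) ^ (2 * ((j : ℕ) : ℤ) - n) =
      (g.1 : ℝ) ^ (2 * ((i : ℕ) : ℤ) - n) := fun h => by
    rw [← zpow_add₀ hs, h]; congr 1; push_cast; ring
  have h2 : (i : ℕ) + 1 = j → (g.1 : ℝ) ^ (-2 : ℤ) * (g.1 : ℝ) ^ (2 * ((j : ℕ) : ℤ) - n) =
      (g.1 : ℝ) ^ (2 * ((i : ℕ) : ℤ) - n) := fun h => by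
    rw [← zpow_add₀ hs, ← h]; congr 1; push_cast; ring
  by_cases e1 : (i : ℕ) = j + 1
  · rw [← h1 e1, if_pos e1, if_neg (by omega), if_neg (by omega)]; ring
  by_cases e2 : (i : ℕ) + 1 = j
  · rw [← h2 e2, if_pos e2, if_neg (by omega), if_neg (by omega)]; ring
  rw [if_neg e1, if_neg e2]
  by_cases e3 : (i : ℕ) = j
  · rw [if_pos e3, e3]; ring
  · rw [if_neg e3]; ring

lemma Ad_lie (g : G0 m) (u w : SymAlg n m) : Ad g ⁅u, w⁆ = ⁅Ad g u, Ad g w⁆ := by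
  have hs : (g.1 : ℝ) ≠ 0 := g.1.ne_zero
  have hss : (g.1 : ℝ) ^ (2 : ℤ) * (g.1 : ℝ) ^ (-2 : ℤ) = 1 := by
    rw [← zpow_add₀ hs]; simp
  have hA : ((g.2⁻¹ : GL (Fin m) ℝ) : Matrix (Fin m) (Fin m) ℝ) * (g.2 : Matrix (Fin m) (Fin m) ℝ)
      = 1 := by rw [← Units.val_mul, inv_mul_cancel, Units.val_one]
  have hact : ∀ (u : SymAlg n m) (z : Matrix (Fin (n + 1)) (Fin m) ℝ),
      Matrix.diagonal (fun k : Fin (n + 1) => (g.1 : ℝ) ^ (2 * ((k : ℕ) : ℤ) - n)) * u.actV z *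
        (g.2 : Matrix (Fin m) (Fin m) ℝ).transpose =
      (Ad g u).actV (Matrix.diagonal (fun k : Fin (n + 1) =>
        (g.1 : ℝ) ^ (2 * ((k : ℕ) : ℤ) - n)) * z * (g.2 : Matrix (Fin m) (Fin m) ℝ).transpose) := by
    intro u z
    have hgl : (Ad g u).gl = (g.2 : Matrix (Fin m) (Fin m) ℝ) * u.gl *
      (g.2⁻¹ : GL (Fin m) ℝ) := rfl
    rw [SymAlg.actV, SymAlg.actV, ← Matrix.mul_assoc, ← Matrix.mul_assoc, sl_Ad_mul, hgl]
    simp only [Matrix.mul_add, Matrix.add_mul, Matrix.mul_assoc, Matrix.transpose_mul]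
    have hT := congrArg Matrix.transpose hA
    rw [Matrix.transpose_mul, Matrix.transpose_one] at hT
    rw [← Matrix.mul_assoc (g.2 : Matrix (Fin m) (Fin m) ℝ).transpose, hT, Matrix.one_mul]
  ext1
  · simp [Ad]; ring
  · simp only [Ad, LinearMap.coe_mk, AddHom.coe_mk, SymAlg.lie_h]
    linear_combination (-(u.x * w.y - u.y * w.x)) * hss
  · simp [Ad]; ring
  · simp only [Ad, LinearMap.coe_mk, AddHom.coe_mk, SymAlg.lie_gl, Matrix.mul_sub, Matrix.sub_mul,
      Matrix.mul_assoc]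
    rw [← Matrix.mul_assoc _ (g.2 : Matrix (Fin m) (Fin m) ℝ),
      ← Matrix.mul_assoc _ (g.2 : Matrix (Fin m) (Fin m) ℝ), hA]
    simp
  · rw [SymAlg.lie_v]
    change _ = (Ad g u).actV (Matrix.diagonal _ * w.v * _)
      - (Ad g w).actV (Matrix.diagonal _ * u.v * _)
    rw [← hact, ← hact, ← Matrix.sub_mul, ← Matrix.mul_sub]
    rfl

lemma coe_AdMinus (g : G0 m) (u : gMinus n m) : (AdMinus g u : SymAlg n m) = Ad g u := rfl

lemma AdMinus_mul (g h : G0 m) (u : gMinus n m) :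
    AdMinus (g * h) u = AdMinus g (AdMinus h u) := Subtype.ext (Ad_mul g h u.1)

lemma AdMinus_one (u : gMinus n m) : AdMinus 1 u = u := Subtype.ext (Ad_one _)

lemma Ad_inv_apply (g : G0 m) (u : SymAlg n m) : Ad g⁻¹ (Ad g u) = u := by
  rw [← Ad_mul, inv_mul_cancel, Ad_one]

lemma Ad_apply_inv (g : G0 m) (u : SymAlg n m) : Ad g (Ad g⁻¹ u) = u := by
  rw [← Ad_mul, mul_inv_cancel, Ad_one]

lemma AdMinus_lie (g : G0 m) (u w : gMinus n m) :
    AdMinus g ⁅u, w⁆ = ⁅AdMinus g u, AdMinus g w⁆ := Subtype.ext (Ad_lie g u.1 w.1)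

lemma Ad_vecG (g : G0 m) (k : ℕ) (w : Fin m → ℝ) : Ad g (vecG n k w) =
    vecG n k ((g.1 : ℝ) ^ (2 * (k : ℤ) - n) • (g.2 : Matrix (Fin m) (Fin m) ℝ).mulVec w) := by
  ext i a
  · simp [Ad]
  · simp [Ad]
  · simp [Ad]
  · simp [Ad]
  · simp only [Ad, LinearMap.coe_mk, AddHom.coe_mk, Matrix.mul_assoc]
    rw [Matrix.diagonal_mul, vecG_v, Matrix.mul_apply]
    simp only [vecG_v, Matrix.transpose_apply, Pi.smul_apply, Matrix.mulVec, dotProduct,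
      smul_eq_mul]
    split_ifs with h
    · rw [h]; simp only [mul_comm]
    · simp

lemma AdMinus_vec (g : G0 m) (k : ℕ) (w : Fin m → ℝ) : AdMinus g (vec n k w) =
    vec n k ((g.1 : ℝ) ^ (2 * (k : ℤ) - n) • (g.2 : Matrix (Fin m) (Fin m) ℝ).mulVec w) :=
  Subtype.ext (Ad_vecG g k w)

lemma Ad_elX (g : G0 m) : Ad g (elX n m) = ((g.1 : ℝ) ^ (2 : ℤ)) • elX n m := by
  ext1 <;> simp [Ad, elX]

/-- The action of an element of `G₀` on `C²(𝔤₋, 𝔤)` as a linear map. -/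
noncomputable def groupActHom (g : G0 m) : C2 n m →ₗ[ℝ] C2 n m where
  toFun := groupAct g
  map_add' _ _ := C2_ext_apply fun _ _ => map_add (Ad g) _ _
  map_smul' _ _ := C2_ext_apply fun _ _ => map_smul (Ad g) _ _

lemma groupActHom_apply (g : G0 m) (φ : C2 n m) : groupActHom g φ = groupAct g φ := rfl

lemma groupAct_mul (g h : G0 m) (φ : C2 n m) : groupAct (g * h) φ = groupAct g (groupAct h φ) :=
  C2_ext_apply fun u w => by simp only [groupAct_apply, mul_inv_rev, AdMinus_mul, Ad_mul]

lemma groupAct_one (φ : C2 n m) : groupAct 1 φ = φ :=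
  C2_ext_apply fun u w => by simp only [groupAct_apply, inv_one, AdMinus_one, Ad_one]

/-- The action of an element of `𝔤₀` on `C²(𝔤₋, 𝔤)` as a linear map. -/
noncomputable def lieActHom (a : gZero n m) : C2 n m →ₗ[ℝ] C2 n m where
  toFun := lieAct a
  map_add' φ ψ := C2_ext_apply fun u w => by
    simp only [lieAct_apply, add_apply_apply, lie_add]
    abel
  map_smul' c φ := C2_ext_apply fun u w => by
    simp only [lieAct_apply, smul_apply_apply, lie_smul, smul_sub, RingHom.id_apply]

lemma lieActHom_apply (a : gZero n m) (φ : C2 n m) : lieActHom a φ = lieAct a φ := rfl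

/-- The action of `N ∈ 𝔤𝔩(W)` on 2-cochains. -/
noncomputable def glAct (N : Matrix (Fin m) (Fin m) ℝ) : C2 n m →ₗ[ℝ] C2 n m :=
  lieActHom ⟨ofGl n m N, ofGl_mem N⟩

/-- The action of `N ∈ 𝔤𝔩(W)` on `𝔤₋`. -/
noncomputable def glMinus (N : Matrix (Fin m) (Fin m) ℝ) : gMinus n m →ₗ[ℝ] gMinus n m :=
  adMinus ⟨ofGl n m N, ofGl_mem N⟩

lemma coe_glMinus (N : Matrix (Fin m) (Fin m) ℝ) (u : gMinus n m) :
    (glMinus N u : SymAlg n m) = ⁅ofGl n m N, (u : SymAlg n m)⁆ := rfl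

lemma lieAct_ofGl (N : Matrix (Fin m) (Fin m) ℝ) (φ : C2 n m) :
    lieAct ⟨ofGl n m N, ofGl_mem N⟩ φ = glAct N φ := rfl

lemma glAct_apply (N : Matrix (Fin m) (Fin m) ℝ) (φ : C2 n m) (u w : gMinus n m) :
    glAct N φ u w = ⁅ofGl n m N, φ u w⁆ - φ (glMinus N u) w - φ u (glMinus N w) := rfl

lemma glMinus_vec (N : Matrix (Fin m) (Fin m) ℝ) (k : ℕ) (w : Fin m → ℝ) :
    glMinus N (vec n k w) = vec n k (N.mulVec w) := Subtype.ext (ofGl_lie_vecG N k w)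

lemma glMinus_negX (N : Matrix (Fin m) (Fin m) ℝ) : glMinus N (negX n m) = 0 := by
  refine Subtype.ext ?_
  rw [coe_glMinus, coe_negX, lie_elX _ rfl]
  simp [ofGl]

lemma ofGl_add (M N : Matrix (Fin m) (Fin m) ℝ) :
    ofGl n m (M + N) = ofGl n m M + ofGl n m N := by ext1 <;> simp [ofGl]

lemma ofGl_lie_ofGl (M N : Matrix (Fin m) (Fin m) ℝ) :
    ⁅ofGl n m M, ofGl n m N⁆ = ofGl n m (M * N - N * M) := by
  ext1 <;> simp [ofGl, SymAlg.actV]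

lemma glMinus_lie (M N : Matrix (Fin m) (Fin m) ℝ) (u : gMinus n m) :
    glMinus (M * N - N * M) u = glMinus M (glMinus N u) - glMinus N (glMinus M u) := by
  refine Subtype.ext ?_
  simp only [coe_glMinus, AddSubgroupClass.coe_sub, ← ofGl_lie_ofGl, lie_lie]

lemma glAct_lie (M N : Matrix (Fin m) (Fin m) ℝ) (φ : C2 n m) :
    glAct (M * N - N * M) φ = glAct M (glAct N φ) - glAct N (glAct M φ) := by
  refine C2_ext_apply fun u w => ?_
  have hs : ∀ u w : gMinus n m, φ (u - w) = φ u - φ w := fun u w => φ.1.map_sub u w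
  simp only [C2_sub_apply, glAct_apply, glMinus_lie, ← ofGl_lie_ofGl, lie_lie, lie_sub, hs,
    map_sub, LinearMap.sub_apply]
  abel

lemma glAct_add (M N : Matrix (Fin m) (Fin m) ℝ) (φ : C2 n m) :
    glAct (M + N) φ = glAct M φ + glAct N φ := by
  refine C2_ext_apply fun u w => ?_
  have hs : ∀ u w : gMinus n m, φ (u + w) = φ u + φ w := fun u w => φ.1.map_add u w
  have h1 : ∀ u : gMinus n m, glMinus (M + N) u = glMinus M u + glMinus N u := fun u =>
    Subtype.ext (by simp only [coe_glMinus, ofGl_add, add_lie]; rfl)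
  simp only [add_apply_apply, glAct_apply, ofGl_add, add_lie, h1, hs, map_add,
    LinearMap.add_apply]
  abel

lemma glAct_sum {ι : Type*} (s : Finset ι) (N : ι → Matrix (Fin m) (Fin m) ℝ) (φ : C2 n m) :
    glAct (∑ i ∈ s, N i) φ = ∑ i ∈ s, glAct (N i) φ :=
  map_sum (AddMonoidHom.mk' (fun N => glAct N φ) fun M N => glAct_add M N φ) N s

/-- The unipotent element `1 + t N` of `G₀`, for `N² = 0`. -/
noncomputable def unip (N : Matrix (Fin m) (Fin m) ℝ) (hN : N * N = 0) (t : ℝ) : G0 m :=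
  (1, ⟨1 + t • N, 1 - t • N, by
      simp [mul_sub, add_mul, hN], by simp [sub_mul, mul_add, hN]⟩)

lemma Ad_unip (N : Matrix (Fin m) (Fin m) ℝ) (hN : N * N = 0) (t : ℝ) (u : SymAlg n m) :
    Ad (unip N hN t) u = u + t • ⁅ofGl n m N, u⁆ + (t ^ 2) • ofGl n m (-(N * u.gl * N)) := by
  ext1
  · simp [Ad, unip, ofGl]
  · simp [Ad, unip, ofGl]
  · simp [Ad, unip, ofGl]
  · change (1 + t • N) * u.gl * (1 - t • N) = u.gl + t • (N * u.gl - u.gl * N)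
      + t ^ 2 • (-(N * u.gl * N))
    simp only [add_mul, mul_sub, one_mul, mul_one, Matrix.smul_mul, Matrix.mul_smul, smul_sub]
    module
  · change Matrix.diagonal (fun k : Fin (n + 1) => ((1 : ℝˣ) : ℝ) ^ (2 * ((k : ℕ) : ℤ) - n)) * u.v *
      (1 + t • N).transpose = u.v + t • ((ofGl n m N).actV u.v - u.actV 0) + t ^ 2 • 0
    simp [SymAlg.actV, ofGl, SymAlg.sl, Matrix.mul_add]

lemma AdMinus_unip_inv (N : Matrix (Fin m) (Fin m) ℝ) (hN : N * N = 0) (t : ℝ) (u : gMinus n m) :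
    AdMinus (unip N hN t)⁻¹ u = u - t • glMinus N u := by
  have h1 : (unip N hN t)⁻¹ = unip N hN (-t) := by
    refine Prod.ext (by simp [unip]) (Units.ext ?_)
    change 1 - t • N = 1 + (-t) • N
    module
  refine Subtype.ext ?_
  rw [h1, coe_AdMinus, Ad_unip, u.2.2.2]
  simp only [mul_zero, zero_mul, neg_zero]
  have : ofGl n m 0 = 0 := rfl
  rw [this, smul_zero, add_zero, neg_smul, ← sub_eq_add_neg]
  rfl

/-- A `G₀`-submodule is stable under the elements of square zero in `𝔤𝔩(W)`: since
`t ↦ (1 + t N) · φ` is a polynomial of degree at most four, its derivative at `0` is a combination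
of its values at `±1` and `±2`. -/
lemma glAct_mem_of_sq_zero {U : Submodule ℝ (C2 n m)} (hU : IsG0Submodule U)
    {N : Matrix (Fin m) (Fin m) ℝ} (hN : N * N = 0) {φ : C2 n m} (hφ : φ ∈ U) : glAct N φ ∈ U := by
  have key : glAct N φ = (12 : ℝ)⁻¹ • ((8 : ℝ) • (groupAct (unip N hN 1) φ -
      groupAct (unip N hN (-1)) φ) - (groupAct (unip N hN 2) φ - groupAct (unip N hN (-2)) φ)) := by
    refine C2_ext_apply fun u w => ?_
    have hs : ∀ u w : gMinus n m, φ (u - w) = φ u - φ w := fun u w => φ.1.map_sub u w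
    have hm : ∀ (c : ℝ) (u : gMinus n m), φ (c • u) = c • φ u := fun c u => φ.1.map_smul c u
    have ho : ∀ M : Matrix (Fin m) (Fin m) ℝ, ofGl n m (-M) = -ofGl n m M := fun M => by
      ext1 <;> simp [ofGl]
    simp only [smul_apply_apply, C2_sub_apply, groupAct_apply, AdMinus_unip_inv, Ad_unip,
      glAct_apply, hs, hm, map_sub, map_smul, LinearMap.sub_apply, LinearMap.smul_apply, ho]
    module
  rw [key]
  exact U.smul_mem _ (C2_sub_mem (U.smul_mem _ (C2_sub_mem (hU _ _ hφ) (hU _ _ hφ)))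
    (C2_sub_mem (hU _ _ hφ) (hU _ _ hφ)))

/-- A `G₀`-submodule is stable under the matrices in `𝔤𝔩(W)` with zero diagonal. -/
lemma glAct_mem {U : Submodule ℝ (C2 n m)} (hU : IsG0Submodule U)
    {N : Matrix (Fin m) (Fin m) ℝ} (hN : ∀ a, N a a = 0) {φ : C2 n m} (hφ : φ ∈ U) :
    glAct N φ ∈ U := by
  rw [Matrix.matrix_eq_sum_single N, glAct_sum]
  refine U.sum_mem fun a _ => ?_
  rw [glAct_sum]
  refine U.sum_mem fun b _ => glAct_mem_of_sq_zero hU ?_ hφ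
  rcases eq_or_ne a b with rfl | h
  · simp [hN]
  · rw [Matrix.single_mul_single_of_ne (h := h.symm)]

/-- A `G₀`-submodule is stable under `diag(1, 0, …, 0, -1) = [e_1^m, e_m^1]`. -/
lemma glAct_diagonal_mem {U : Submodule ℝ (C2 n m)} (hU : IsG0Submodule U) {a b : Fin m}
    (hab : a ≠ b) {φ : C2 n m} (hφ : φ ∈ U) :
    glAct (Matrix.diagonal (Pi.single a 1 - Pi.single b 1)) φ ∈ U := by
  have h1 : Matrix.diagonal (Pi.single a 1 - Pi.single b 1) =
      Matrix.single a b (1 : ℝ) * Matrix.single b a 1 -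
        Matrix.single b a 1 * Matrix.single a b (1 : ℝ) := by
    simp only [Matrix.single_mul_single_same, mul_one, ← Matrix.diagonal_single,
      Matrix.diagonal_sub]
    rfl
  have h2 : ∀ c, Matrix.single a b (1 : ℝ) c c = 0 := fun c => by
    rw [Matrix.single_apply, if_neg]; rintro ⟨rfl, h⟩; exact hab h.symm
  have h3 : ∀ c, Matrix.single b a (1 : ℝ) c c = 0 := fun c => by
    rw [Matrix.single_apply, if_neg]; rintro ⟨rfl, h⟩; exact hab h
  rw [h1, glAct_lie]
  exact C2_sub_mem (glAct_mem hU h2 (glAct_mem hU h3 hφ)) (glAct_mem hU h3 (glAct_mem hU h2 hφ))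

/-! ### Existence of lowest weight vectors -/

/-- The filtration of `𝔤` by height of `𝔤𝔩(W)`-weights: `e_a^b` has height `a - b`, `E_{k,a}` has
height `a`, and `𝖷`, `𝖧`, `𝖸` have height zero. -/
def heightFilt (n m : ℕ) (k : ℤ) : Submodule ℝ (SymAlg n m) where
  carrier := {u | (0 < k → u.x = 0 ∧ u.h = 0 ∧ u.y = 0) ∧
    (∀ a b : Fin m, (a : ℤ) - b < k → u.gl a b = 0) ∧
    ∀ (i : Fin (n + 1)) (a : Fin m), (a : ℤ) < k → u.v i a = 0}
  zero_mem' := by simp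
  add_mem' := by
    rintro u w ⟨h1, h2, h3⟩ ⟨k1, k2, k3⟩
    refine ⟨fun h => ?_, fun a b h => ?_, fun i a h => ?_⟩
    · simp [h1 h, k1 h]
    · simp [h2 a b h, k2 a b h]
    · simp [h3 i a h, k3 i a h]
  smul_mem' := by
    rintro c u ⟨h1, h2, h3⟩
    refine ⟨fun h => ?_, fun a b h => ?_, fun i a h => ?_⟩
    · simp [h1 h]
    · simp [h2 a b h]
    · simp [h3 i a h]

lemma lie_mem_heightFilt {N : Matrix (Fin m) (Fin m) ℝ} (hN : ∀ a b, a ≤ b → N a b = 0) {k : ℤ}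
    {u : SymAlg n m} (hu : u ∈ heightFilt n m k) : ⁅ofGl n m N, u⁆ ∈ heightFilt n m (k + 1) := by
  obtain ⟨-, h2, h3⟩ := hu
  refine ⟨fun _ => by simp [ofGl], fun a b h => ?_, fun i a h => ?_⟩
  · simp only [SymAlg.lie_gl, ofGl, Matrix.sub_apply, Matrix.mul_apply]
    rw [Finset.sum_eq_zero, Finset.sum_eq_zero, sub_zero]
    · intro c _
      rcases le_or_gt c b with hc | hc
      · rw [hN c b hc, mul_zero]
      · have : (b : ℕ) < c := hc
        rw [h2 a c (by omega), zero_mul]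
    · intro c _
      rcases le_or_gt a c with hc | hc
      · rw [hN a c hc, zero_mul]
      · have : (c : ℕ) < a := hc
        rw [h2 c b (by omega), mul_zero]
  · have : ⁅ofGl n m N, u⁆.v i a = ∑ c, u.v i c * N a c := by
      simp [ofGl, SymAlg.actV, SymAlg.sl, Matrix.mul_apply]
    rw [this]
    refine Finset.sum_eq_zero fun c _ => ?_
    rcases le_or_gt a c with hc | hc
    · rw [hN a c hc, mul_zero]
    · have : (c : ℕ) < a := hc
      rw [h3 i c (by omega), zero_mul]

/-- Every nonzero `G₀`-submodule of `C²(𝔤₋, 𝔤)` contains a lowest weight vector: strictly lower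
triangular matrices raise the height. -/
lemma exists_isLowestWeightVector {U : Submodule ℝ (C2 n m)} (hU : IsG0Submodule U) (h0 : U ≠ ⊥) :
    ∃ φ, IsLowestWeightVector U φ := by
  let F (k : ℤ) (φ : C2 n m) : Prop := ∀ (r s : ℤ) (u w : gMinus n m),
    (u : SymAlg n m) ∈ heightFilt n m r → (w : SymAlg n m) ∈ heightFilt n m s →
      φ u w ∈ heightFilt n m (k + r + s)
  have htop : ∀ (k : ℤ) (u : SymAlg n m), k ≤ -m → u ∈ heightFilt n m k := fun k u hk =>
    ⟨fun h => by omega, fun a b h => by omega, fun i a h => by omega⟩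
  have hbot : ∀ (k : ℤ) (u : SymAlg n m), (m : ℤ) < k → u ∈ heightFilt n m k → u = 0 := by
    rintro k u hk ⟨h1, h2, h3⟩
    have h1' := h1 (by omega)
    ext a b
    · exact h1'.1
    · exact h1'.2.1
    · exact h1'.2.2
    · exact h2 a b (by omega)
    · exact h3 a b (by omega)
  have hF0 : ∀ φ, F (-(3 * m)) φ := by
    intro φ r s u w hu hw
    rcases le_or_gt r m with hr | hr
    · rcases le_or_gt s m with hs | hs
      · exact htop _ _ (by omega)
      · rw [show w = 0 from Subtype.ext (hbot s w hs hw), map_zero]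
        exact Submodule.zero_mem _
    · have : φ (0 : gMinus n m) = 0 := φ.1.map_zero
      rw [show u = 0 from Subtype.ext (hbot r u hr hu), this]
      exact Submodule.zero_mem _
  have hF1 : ∀ φ, F (3 * m + 1) φ → φ = 0 := by
    intro φ hφ
    refine C2_ext_apply fun u w => ?_
    exact hbot _ _ (by omega) (hφ (-m) (-m) u w (htop _ _ le_rfl) (htop _ _ le_rfl))
  have hstep : ∀ k φ, F k φ → ∀ N : Matrix (Fin m) (Fin m) ℝ, (∀ a b, a ≤ b → N a b = 0) →
      F (k + 1) (glAct N φ) := by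
    intro k φ hφ N hN r s u w hu hw
    rw [glAct_apply]
    refine Submodule.sub_mem _ (Submodule.sub_mem _ ?_ ?_) ?_
    · rw [show k + 1 + r + s = k + r + s + 1 by ring]
      exact lie_mem_heightFilt hN (hφ r s u w hu hw)
    · rw [show k + 1 + r + s = k + (r + 1) + s by ring]
      exact hφ _ _ _ _ (lie_mem_heightFilt hN hu) hw
    · rw [show k + 1 + r + s = k + r + (s + 1) by ring]
      exact hφ _ _ _ _ hu (lie_mem_heightFilt hN hw)
  have main : ∀ t : ℕ, ∀ φ ∈ U, φ ≠ 0 → F (3 * m + 1 - t) φ → ∃ φ, IsLowestWeightVector U φ := by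
    intro t
    induction t with
    | zero => exact fun φ _ h hF => absurd (hF1 φ (by simpa using hF)) h
    | succ t ih =>
      intro φ hφ hne hF
      by_cases hall : ∀ N : Matrix (Fin m) (Fin m) ℝ, (∀ a b, a ≤ b → N a b = 0) → glAct N φ = 0
      · exact ⟨φ, hφ, hne, hall⟩
      · push Not at hall
        obtain ⟨N, hN, hNφ⟩ := hall
        refine ih (glAct N φ) (glAct_mem hU (fun a => hN a a le_rfl) hφ) hNφ ?_
        have := hstep _ φ hF N hN
        rwa [show (3 * m + 1 - ((t + 1 : ℕ) : ℤ) + 1) = 3 * m + 1 - t by push_cast; ring] at this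
  obtain ⟨φ, hφ, hne⟩ := U.ne_bot_iff.mp h0
  refine main (6 * m + 1) φ hφ hne ?_
  rw [show (3 * (m : ℤ) + 1 - ((6 * m + 1 : ℕ) : ℤ)) = -(3 * m) by push_cast; ring]
  exact hF0 φ

/-! ### Harmonic cochains are the closed and coclosed ones -/

lemma ip2_comm (φ ψ : C2 n m) : ip2 n m φ ψ = ip2 n m ψ φ := by
  simp only [ip2_apply, ipG_comm]

lemma ip1_self_nonneg (ψ : C1 n m) : 0 ≤ ip1 n m ψ ψ := by
  rw [ip1_apply]
  exact Finset.sum_nonneg fun i _ => mul_nonneg (inv_nonneg.mpr (negLen_pos i).le)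
    (ipG_self_nonneg _)

lemma ip3_nonneg_aux (t : T3 n m) (i j k : NegIdx n m) : 0 ≤ (negLen i * negLen j * negLen k)⁻¹ *
    ipG n m (t (negBasis i) (negBasis j) (negBasis k)) (t (negBasis i) (negBasis j) (negBasis k)) :=
  mul_nonneg (inv_nonneg.mpr (mul_pos (mul_pos (negLen_pos i) (negLen_pos j)) (negLen_pos k)).le)
    (ipG_self_nonneg _)

lemma ip3_self_nonneg (t : T3 n m) : 0 ≤ ip3 n m t t := by
  rw [ip3_apply]
  exact mul_nonneg (by norm_num) (Finset.sum_nonneg fun i _ => Finset.sum_nonneg fun j _ =>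
    Finset.sum_nonneg fun k _ => ip3_nonneg_aux t i j k)

lemma ip3_self_eq_zero {t : T3 n m} (h : ip3 n m t t = 0) : t = 0 := by
  rw [ip3_apply, mul_eq_zero, or_iff_right (by norm_num), Finset.sum_eq_zero_iff_of_nonneg
    (fun i _ => Finset.sum_nonneg fun j _ => Finset.sum_nonneg fun k _ =>
      ip3_nonneg_aux t i j k)] at h
  refine linearMap_ext_negBasis fun i => linearMap_ext_negBasis fun j =>
    linearMap_ext_negBasis fun k => ?_
  have h1 := h i (Finset.mem_univ i)
  rw [Finset.sum_eq_zero_iff_of_nonneg (fun j _ => Finset.sum_nonneg fun k _ =>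
    ip3_nonneg_aux t i j k)] at h1
  have h2 := h1 j (Finset.mem_univ j)
  rw [Finset.sum_eq_zero_iff_of_nonneg (fun k _ => ip3_nonneg_aux t i j k)] at h2
  exact ipG_self_eq_zero ((mul_eq_zero.mp (h2 k (Finset.mem_univ k))).resolve_left
    (inv_pos.mpr (mul_pos (mul_pos (negLen_pos i) (negLen_pos j)) (negLen_pos k))).ne')

lemma codiff2_apply (φ : C2 n m) (ψ : C1 n m) :
    ip1 n m (codiff2 n m φ) ψ = ip2 n m φ (d1 n m ψ) := by
  rw [codiff2, adjointOf_apply]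

lemma codiff3_apply (t : T3 n m) (φ : C2 n m) :
    ip2 n m (codiff3 n m t) φ = ip3 n m t (d2 n m φ) :=
  adjointOf_apply (E := C2 n m) (F := T3 n m) (ip2 n m) ip2_nondegenerate (ip3 n m) (d2 n m) t φ

/-- Harmonic means closed and orthogonal to all coboundaries, as `⟨□ φ, φ⟩ = |∂^* φ|² + |∂ φ|²`. -/
lemma mem_harmonic {φ : C2 n m} :
    φ ∈ harmonic n m ↔ d2 n m φ = 0 ∧ ∀ ψ, ip2 n m φ (d1 n m ψ) = 0 := by
  constructor
  · intro h
    have h0 : box n m φ = 0 := h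
    have h1 : ip2 n m (box n m φ) φ = ip1 n m (codiff2 n m φ) (codiff2 n m φ) +
        ip3 n m (d2 n m φ) (d2 n m φ) := by
      change ip2 n m (d1 n m (codiff2 n m φ) + codiff3 n m (d2 n m φ)) φ = _
      rw [map_add, LinearMap.add_apply, codiff3_apply, ip2_comm, codiff2_apply]
    rw [h0, map_zero, LinearMap.zero_apply] at h1
    have h2 := ip1_self_nonneg (codiff2 n m φ)
    have h3 := ip3_self_nonneg (d2 n m φ)
    refine ⟨ip3_self_eq_zero (by linarith), fun ψ => ?_⟩
    rw [← codiff2_apply, ip1_self_eq_zero (φ := codiff2 n m φ) (by linarith), map_zero,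
      LinearMap.zero_apply]
  · rintro ⟨h1, h2⟩
    have h3 : codiff2 n m φ = 0 := ip1_self_eq_zero (by rw [codiff2_apply, h2])
    change d1 n m (codiff2 n m φ) + codiff3 n m (d2 n m φ) = 0
    rw [h1, h3, map_zero, map_zero, add_zero]

/-- An exact coclosed cochain vanishes. -/
lemma exact_eq_zero {ψ : C1 n m} (h : ∀ ψ', ip2 n m (d1 n m ψ) (d1 n m ψ') = 0) :
    d1 n m ψ = 0 := ip2_self_eq_zero (h ψ)

lemma d2_d1 (ψ : C1 n m) : d2 n m (d1 n m ψ) = 0 :=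
  LinearMap.congr_fun (d₂₃_comp_d₁₂ ℝ (gMinus n m) (SymAlg n m)) ψ

/-! ### Adjoints of elements of `G₀` -/

/-- The transpose `(diag(s, s⁻¹), Aᵀ)` of an element of `G₀`. -/
def transp (g : G0 m) : G0 m :=
  (g.1, ⟨(g.2 : Matrix (Fin m) (Fin m) ℝ).transpose,
    ((g.2⁻¹ : GL (Fin m) ℝ) : Matrix (Fin m) (Fin m) ℝ).transpose,
    by rw [← Matrix.transpose_mul, ← Units.val_mul, inv_mul_cancel, Units.val_one,
      Matrix.transpose_one],
    by rw [← Matrix.transpose_mul, ← Units.val_mul, mul_inv_cancel, Units.val_one,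
      Matrix.transpose_one]⟩)

lemma transp_inv (g : G0 m) : transp g⁻¹ = (transp g)⁻¹ := by
  refine Prod.ext rfl (Units.ext ?_)
  rfl

lemma sum_mul_eq_trace {ι κ : Type*} [Fintype ι] [Fintype κ] (u w : Matrix ι κ ℝ) :
    ∑ a, ∑ b, u a b * w a b = (u.transpose * w).trace := by
  simp only [Matrix.trace, Matrix.diag, Matrix.mul_apply, Matrix.transpose_apply]
  exact Finset.sum_comm

lemma ipG_Ad (g : G0 m) (u w : SymAlg n m) : ipG n m (Ad g u) w = ipG n m u (Ad (transp g) w) := by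
  rw [ipG_apply, ipG_apply]
  have h1 : ∑ a, ∑ b, (Ad g u).gl a b * w.gl a b =
      ∑ a, ∑ b, u.gl a b * (Ad (transp g) w).gl a b := by
    rw [sum_mul_eq_trace, sum_mul_eq_trace]
    change ((_ * u.gl * _).transpose * w.gl).trace = (u.gl.transpose * (_ * w.gl * _)).trace
    rw [Matrix.transpose_mul, Matrix.transpose_mul, Matrix.mul_assoc, Matrix.trace_mul_comm]
    simp only [Matrix.mul_assoc]
    rfl
  have h2 : ∑ k, ∑ a, lenV n k * ((Ad g u).v k a * w.v k a) =
      ∑ k, ∑ a, lenV n k * (u.v k a * (Ad (transp g) w).v k a) := by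
    refine Finset.sum_congr rfl fun k _ => ?_
    rw [← Finset.mul_sum, ← Finset.mul_sum]
    congr 1
    have h3 : ∀ (g : G0 m) (u : SymAlg n m) (a : Fin m), (Ad g u).v k a =
        (g.1 : ℝ) ^ (2 * ((k : ℕ) : ℤ) - n) *
          ∑ b, u.v k b * (g.2 : Matrix (Fin m) (Fin m) ℝ) a b := fun g u a => by
      simp only [Ad, LinearMap.coe_mk, AddHom.coe_mk, Matrix.mul_assoc]
      rw [Matrix.diagonal_mul, Matrix.mul_apply]
      rfl
    simp only [h3, Finset.mul_sum, Finset.sum_mul]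
    rw [Finset.sum_comm]
    refine Finset.sum_congr rfl fun _ _ => Finset.sum_congr rfl fun _ _ => ?_
    simp only [transp, Matrix.transpose_apply]
    ring
  rw [h1, h2]
  simp only [Ad, transp, LinearMap.coe_mk, AddHom.coe_mk]
  ring

lemma gMinus_eq_sum_ipG (u : gMinus n m) :
    u = ∑ i, ((negLen i)⁻¹ * ipG n m (negBasis i : gMinus n m) u) • negBasis i := by
  conv_lhs => rw [gMinus_expand u]
  rw [Fintype.sum_option]
  congr 1
  · congr 1
    simp [ipG_apply, negBasis, negLen, elX]
  · refine Finset.sum_congr rfl fun p _ => ?_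
    congr 1
    have h1 : ipG n m (negBasis (some p) : gMinus n m) u =
        lenV n p.1 * (u : SymAlg n m).v p.1 p.2 := by
      rw [ipG_apply]
      change (0 : ℝ) * _ + 2 * (0 * _) + 0 * _ + (∑ a, ∑ b, (0 : ℝ) * _) +
        (∑ k, ∑ a, lenV n k * (Matrix.single p.1 p.2 (1 : ℝ) k a * (u : SymAlg n m).v k a)) = _
      simp only [zero_mul, mul_zero, Finset.sum_const_zero, add_zero, zero_add]
      rw [Finset.sum_eq_single p.1, Finset.sum_eq_single p.2]
      · simp
      · intro b _ hb
        simp [hb.symm]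
      · simp
      · intro k _ hk
        simp [hk.symm]
      · simp
    rw [h1]
    change _ = (lenV n p.1)⁻¹ * _
    rw [inv_mul_cancel_left₀ (lenV_pos p.1).ne']

/-- Contraction with the inverse metric of `𝔤₋`: an endomorphism can be moved to the other slot of
a bilinear map, where it is replaced by its adjoint. -/
lemma sum_negBasis_adjoint (L L' : gMinus n m →ₗ[ℝ] gMinus n m)
    (h : ∀ u w : gMinus n m, ipG n m (L u) w = ipG n m (u : SymAlg n m) (L' w))
    (F : gMinus n m →ₗ[ℝ] gMinus n m →ₗ[ℝ] ℝ) :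
    ∑ i, (negLen i)⁻¹ * F (L (negBasis i)) (negBasis i) =
      ∑ i, (negLen i)⁻¹ * F (negBasis i) (L' (negBasis i)) := by
  have h1 : ∀ i, (negLen i)⁻¹ * F (L (negBasis i)) (negBasis i) = ∑ k, (negLen i)⁻¹ *
      (negLen k)⁻¹ * ipG n m (negBasis k : gMinus n m) (L (negBasis i)) *
        F (negBasis k) (negBasis i) := by
    intro i
    conv_lhs => rw [gMinus_eq_sum_ipG (L (negBasis i))]
    simp only [map_sum, map_smul, LinearMap.sum_apply, LinearMap.smul_apply, smul_eq_mul,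
      Finset.mul_sum, mul_assoc]
  have h2 : ∀ k, (negLen k)⁻¹ * F (negBasis k) (L' (negBasis k)) = ∑ i, (negLen i)⁻¹ *
      (negLen k)⁻¹ * ipG n m (negBasis k : gMinus n m) (L (negBasis i)) *
        F (negBasis k) (negBasis i) := by
    intro k
    conv_lhs => rw [gMinus_eq_sum_ipG (L' (negBasis k))]
    simp only [map_sum, map_smul, smul_eq_mul, Finset.mul_sum, ← h]
    refine Finset.sum_congr rfl fun i _ => ?_
    rw [ipG_comm (L (negBasis i) : gMinus n m).1]
    ring
  simp only [h1, h2]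
  exact Finset.sum_comm

lemma ip2_eq_iterated (φ ψ : C2 n m) : ip2 n m φ ψ = 1 / 2 * ∑ i, (negLen i)⁻¹ *
    ∑ j, (negLen j)⁻¹ * ipG n m (φ (negBasis i) (negBasis j)) (ψ (negBasis i) (negBasis j)) := by
  rw [ip2_apply]
  simp only [Finset.mul_sum, mul_inv, mul_assoc]

/-- The action of `G₀` on 2-cochains is compatible with transposition. -/
lemma ip2_groupAct (g : G0 m) (φ ψ : C2 n m) :
    ip2 n m (groupAct g φ) ψ = ip2 n m φ (groupAct (transp g) ψ) := by
  have hadj : ∀ u w : gMinus n m, ipG n m (AdMinus g⁻¹ u) w =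
      ipG n m (u : SymAlg n m) (AdMinus (transp g)⁻¹ w) := fun u w => by
    rw [coe_AdMinus, coe_AdMinus, ipG_Ad, transp_inv]
  rw [ip2_eq_iterated, ip2_eq_iterated]
  congr 1
  have h1 : ∀ i, ∑ j, (negLen j)⁻¹ * ipG n m (groupAct g φ (negBasis i) (negBasis j))
      (ψ (negBasis i) (negBasis j)) = ∑ j, (negLen j)⁻¹ *
        ipG n m (φ (AdMinus g⁻¹ (negBasis i)) (negBasis j))
          (Ad (transp g) (ψ (negBasis i) (AdMinus (transp g)⁻¹ (negBasis j)))) := by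
    intro i
    simp only [groupAct_apply, ipG_Ad]
    exact sum_negBasis_adjoint (AdMinus g⁻¹) (AdMinus (transp g)⁻¹) hadj
      ((ipG n m).compl₁₂ (φ.1 (AdMinus g⁻¹ (negBasis i))) (Ad (transp g) ∘ₗ ψ.1 (negBasis i)))
  simp only [h1]
  have h2 := sum_negBasis_adjoint (AdMinus g⁻¹) (AdMinus (transp g)⁻¹) hadj
    (∑ j : NegIdx n m, (negLen j)⁻¹ • (ipG n m).compl₁₂ (φ.1.flip (negBasis j))
      (Ad (transp g) ∘ₗ ψ.1.flip (AdMinus (transp g)⁻¹ (negBasis j))))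
  simp only [LinearMap.sum_apply, LinearMap.smul_apply, smul_eq_mul, LinearMap.compl₁₂_apply,
    LinearMap.comp_apply, LinearMap.flip_apply] at h2
  exact h2

/-! ### Invariance of the defining conditions under `G₀` -/

lemma groupAct_d1 (g : G0 m) (ψ : C1 n m) :
    groupAct g (d1 n m ψ) = d1 n m (Ad g ∘ₗ ψ ∘ₗ AdMinus g⁻¹) := by
  refine C2_ext_apply fun u w => ?_
  rw [groupAct_apply, d1_apply, d1_apply, map_sub, map_sub, Ad_lie, Ad_lie, coe_AdMinus,
    coe_AdMinus, Ad_apply_inv, Ad_apply_inv, ← AdMinus_lie]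
  rfl

lemma groupAct_mem_harmonic (g : G0 m) {φ : C2 n m} (h : φ ∈ harmonic n m) :
    groupAct g φ ∈ harmonic n m := by
  rw [mem_harmonic] at h ⊢
  refine ⟨?_, fun ψ => by rw [ip2_groupAct, groupAct_d1, h.2]⟩
  refine LinearMap.ext fun x => LinearMap.ext fun y => LinearMap.ext fun z => ?_
  have key := congrArg (fun t : T3 n m =>
    Ad g (t (AdMinus g⁻¹ x) (AdMinus g⁻¹ y) (AdMinus g⁻¹ z))) h.1
  simp only [d₂₃_apply, gMinus_lie, map_add, map_sub, Ad_lie, coe_AdMinus, Ad_apply_inv,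
    LinearMap.zero_apply, map_zero, ← AdMinus_lie] at key
  simp only [d₂₃_apply, gMinus_lie, groupAct_apply, LinearMap.zero_apply]
  exact key

lemma Ad_elZ₁ (g : G0 m) : Ad g (elZ₁ n m) = elZ₁ n m := by
  ext1 <;> simp [Ad, elZ₁]

lemma Ad_elZ₂ (g : G0 m) : Ad g (elZ₂ n m) = elZ₂ n m := by
  ext1 <;> simp [Ad, elZ₂]

lemma lieAct_groupAct (g : G0 m) (a : gZero n m) (ha : Ad g (a : SymAlg n m) = a)
    (φ : C2 n m) : lieAct a (groupAct g φ) = groupAct g (lieAct a φ) := by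
  have ha' : Ad g⁻¹ (a : SymAlg n m) = a := by rw [← ha, Ad_inv_apply, ha]
  have h1 : ∀ u : gMinus n m, AdMinus g⁻¹ (adMinus a u) = adMinus a (AdMinus g⁻¹ u) := fun u =>
    Subtype.ext (by rw [coe_AdMinus, adMinus_coe, adMinus_coe, Ad_lie, ha', coe_AdMinus])
  refine C2_ext_apply fun u w => ?_
  simp only [lieAct_apply, groupAct_apply, map_sub, Ad_lie, ha, h1]

lemma Ad_mem_gr (g : G0 m) {k : ℤ} {u : SymAlg n m} (hu : u ∈ gr n m k) : Ad g u ∈ gr n m k := by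
  rw [gr, Module.End.mem_eigenspace_iff] at hu ⊢
  have hZ : Ad g (elZ n m) = elZ n m := by rw [elZ, map_add, Ad_elZ₁, Ad_elZ₂]
  change ⁅elZ n m, u⁆ = _ at hu
  change ⁅elZ n m, Ad g u⁆ = _
  rw [← hZ, ← Ad_lie, hu, map_smul]

lemma gr_le_filt {i k : ℤ} (h : i ≤ k) : gr n m k ≤ filt n m i :=
  le_iSup₂_of_le k h le_rfl

lemma Ad_mem_filt (g : G0 m) {i : ℤ} {u : SymAlg n m} (hu : u ∈ filt n m i) :
    Ad g u ∈ filt n m i := by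
  have : filt n m i ≤ (filt n m i).comap (Ad g) :=
    iSup₂_le fun k hk u hu => gr_le_filt hk (Ad_mem_gr g hu)
  exact this hu

lemma groupAct_isStronglyRegular (g : G0 m) {φ : C2 n m} (h : IsStronglyRegular φ) :
    IsStronglyRegular (groupAct g φ) := fun i j u w hu hw => by
  have := h i j (AdMinus g⁻¹ u) (AdMinus g⁻¹ w) (Ad_mem_filt _ hu) (Ad_mem_filt _ hw)
  exact ⟨Ad_mem_filt g this.1, Ad_mem_filt g this.2⟩

lemma modF_Ad (g : G0 m) (u : SymAlg n m) : modF (Ad g u) =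
    ((g.1 : ℝ) ^ (2 * (n : ℤ) - n)) • (g.2 : Matrix (Fin m) (Fin m) ℝ).mulVec (modF u) := by
  ext a
  simp only [modF, Ad, LinearMap.coe_mk, AddHom.coe_mk, Matrix.mul_assoc]
  rw [Matrix.diagonal_mul, Matrix.mul_apply]
  simp only [Matrix.transpose_apply, Pi.smul_apply, Matrix.mulVec, dotProduct, smul_eq_mul,
    Fin.val_last, mul_comm]

lemma AdMinus_mem_subF (g : G0 m) {u : gMinus n m} (hu : u ∈ subF n m) :
    AdMinus g u ∈ subF n m := by
  obtain ⟨h1, h2⟩ := hu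
  refine ⟨by simp [coe_AdMinus, Ad, h1], ?_⟩
  have : modF (Ad g (u : SymAlg n m)) = 0 := by
    rw [modF_Ad, show modF (u : SymAlg n m) = 0 from h2, Matrix.mulVec_zero, smul_zero]
  exact this

lemma groupAct_isDM (g : G0 m) {φ : C2 n m} (h : IsDM φ) : IsDM (groupAct g φ) := by
  obtain ⟨B, hB⟩ := h
  refine ⟨((g.1 : ℝ) ^ (2 : ℤ)) • B ∘ₗ ((AdMinus g⁻¹).restrict fun u => AdMinus_mem_subF g⁻¹),
    fun u w => ?_⟩
  have := hB ((AdMinus g⁻¹).restrict (fun u => AdMinus_mem_subF g⁻¹) u)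
    ((AdMinus g⁻¹).restrict (fun u => AdMinus_mem_subF g⁻¹) w)
  rw [groupAct_apply, modF_Ad]
  rw [LinearMap.coe_restrict_apply, LinearMap.coe_restrict_apply] at this
  rw [this, ← modF_Ad, map_sub, Ad_lie, Ad_lie, coe_AdMinus, coe_AdMinus, Ad_apply_inv,
    Ad_apply_inv, map_smul, map_smul, Ad_elX, smul_smul, smul_smul, LinearMap.smul_apply,
    LinearMap.smul_apply, smul_eq_mul, smul_eq_mul, mul_comm, LinearMap.comp_apply,
    LinearMap.comp_apply, mul_comm (B _)]

variable (n m) in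
/-- The space of harmonic, strongly regular 2-cochains of bi-grade `(s, t)` which satisfy the
Doubrov–Medvedev condition if `n ≥ 3`; it contains all C-class modules of that bi-grade. -/
noncomputable def cclassSpace (s t : ℝ) : Submodule ℝ (C2 n m) where
  carrier := {φ | φ ∈ harmonic n m ∧ (lieAct ⟨elZ₁ n m, elZ₁_mem⟩ φ = s • φ ∧
    lieAct ⟨elZ₂ n m, elZ₂_mem⟩ φ = t • φ) ∧ IsStronglyRegular φ ∧ (3 ≤ n → IsDM φ)}
  zero_mem' := by
    refine ⟨Submodule.zero_mem _, ⟨?_, ?_⟩, fun i j u w _ _ => Submodule.zero_mem _,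
      fun _ => ⟨0, fun u w => ?_⟩⟩
    · rw [smul_zero, ← lieActHom_apply, map_zero]
    · rw [smul_zero, ← lieActHom_apply, map_zero]
    · simp [C2_zero_apply]
  add_mem' := by
    rintro φ ψ ⟨h1, ⟨h2, h3⟩, h4, h5⟩ ⟨k1, ⟨k2, k3⟩, k4, k5⟩
    refine ⟨Submodule.add_mem _ h1 k1, ⟨?_, ?_⟩,
      fun i j u w hu hw => Submodule.add_mem _ (h4 i j u w hu hw) (k4 i j u w hu hw), fun h => ?_⟩
    · rw [smul_add, ← h2, ← k2, ← lieActHom_apply, map_add]; rfl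
    · rw [smul_add, ← h3, ← k3, ← lieActHom_apply, map_add]; rfl
    · obtain ⟨B, hB⟩ := h5 h
      obtain ⟨B', hB'⟩ := k5 h
      refine ⟨B + B', fun u w => ?_⟩
      have h6 : modF ((φ + ψ) u.1 w.1) = modF (φ u.1 w.1) + modF (ψ u.1 w.1) := rfl
      rw [h6, hB, hB']
      simp only [LinearMap.add_apply, add_smul, add_lie]
      simp only [modF, SymAlg.sub_v, SymAlg.add_v]
      ext a
      simp only [Pi.add_apply, Matrix.sub_apply, Matrix.add_apply]
      ring
  smul_mem' := by
    rintro c φ ⟨h1, ⟨h2, h3⟩, h4, h5⟩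
    refine ⟨Submodule.smul_mem _ c h1, ⟨?_, ?_⟩,
      fun i j u w hu hw => Submodule.smul_mem _ c (h4 i j u w hu hw), fun h => ?_⟩
    · rw [smul_comm, ← h2, ← lieActHom_apply, map_smul]; rfl
    · rw [smul_comm, ← h3, ← lieActHom_apply, map_smul]; rfl
    · obtain ⟨B, hB⟩ := h5 h
      refine ⟨c • B, fun u w => ?_⟩
      have h6 : modF ((c • φ) u.1 w.1) = c • modF (φ u.1 w.1) := rfl
      rw [h6, hB]
      simp only [LinearMap.smul_apply, smul_eq_mul, mul_smul, smul_lie c]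
      simp only [modF, SymAlg.sub_v, SymAlg.smul_v]
      ext a
      simp only [Pi.smul_apply, Matrix.sub_apply, Matrix.smul_apply, smul_eq_mul]
      ring

lemma isG0Submodule_cclassSpace (s t : ℝ) : IsG0Submodule (cclassSpace n m s t) := by
  rintro g φ ⟨h1, ⟨h2, h3⟩, h4, h5⟩
  refine ⟨groupAct_mem_harmonic g h1, ⟨?_, ?_⟩, groupAct_isStronglyRegular g h4,
    fun h => groupAct_isDM g (h5 h)⟩
  · rw [lieAct_groupAct g _ (Ad_elZ₁ g), h2, ← groupActHom_apply, map_smul]; rfl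
  · rw [lieAct_groupAct g _ (Ad_elZ₂ g), h3, ← groupActHom_apply, map_smul]; rfl

lemma IsIrreducibleCClassModule.le_cclassSpace {U : Submodule ℝ (C2 n m)}
    (h : IsIrreducibleCClassModule U) {s t : ℝ} (hst : HasBigrade U s t) :
    U ≤ cclassSpace n m s t := fun φ hφ =>
  ⟨h.harmonic hφ, hst φ hφ, h.stronglyRegular φ hφ, fun hn => h.dm hn φ hφ⟩

/-! ### The `G₀`-submodule generated by a cochain -/

/-- The `G₀`-submodule generated by `φ`. -/
noncomputable def genBy (φ : C2 n m) : Submodule ℝ (C2 n m) :=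
  Submodule.span ℝ (Set.range fun g : G0 m => groupAct g φ)

lemma mem_genBy (φ : C2 n m) : φ ∈ genBy φ :=
  Submodule.subset_span ⟨1, groupAct_one φ⟩

lemma genBy_le {φ : C2 n m} {U : Submodule ℝ (C2 n m)} (hU : IsG0Submodule U) (h : φ ∈ U) :
    genBy φ ≤ U := by
  rw [genBy, Submodule.span_le]
  rintro _ ⟨g, rfl⟩
  exact hU g φ h

lemma isG0Submodule_genBy (φ : C2 n m) : IsG0Submodule (genBy φ) := by
  intro g ψ hψ
  have : genBy φ ≤ (genBy φ).comap (groupActHom g) := by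
    rw [genBy, Submodule.span_le]
    rintro _ ⟨h, rfl⟩
    exact Submodule.subset_span ⟨g * h, groupAct_mul g h φ⟩
  exact this hψ

lemma IsIrreducibleCClassModule.eq_genBy {U : Submodule ℝ (C2 n m)}
    (h : IsIrreducibleCClassModule U) {φ : C2 n m} (hφ : φ ∈ U) (h0 : φ ≠ 0) : U = genBy φ := by
  refine ((h.irreducible _ (isG0Submodule_genBy φ) (genBy_le h.invariant hφ)).resolve_left
    fun h' => h0 ?_).symm
  have := mem_genBy φ
  rwa [h', Submodule.mem_bot] at this

/-- The submodule generated by `φ` is irreducible if all its lowest weight vectors are multiples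
of `φ`, because every nonzero submodule contains a lowest weight vector. -/
lemma isIrreducible_genBy {φ : C2 n m} (h0 : φ ≠ 0) {s t : ℝ}
    (hst : (s = 1 ∧ t = 1) ∨ (s = 2 ∧ t = 2)) (hφ : φ ∈ cclassSpace n m s t)
    (hlow : ∀ ψ, IsLowestWeightVector (genBy φ) ψ → ∃ c : ℝ, ψ = c • φ) :
    IsIrreducibleCClassModule (genBy φ) ∧ HasBigrade (genBy φ) s t := by
  have hle : genBy φ ≤ cclassSpace n m s t := genBy_le (isG0Submodule_cclassSpace s t) hφ
  have hbi : HasBigrade (genBy φ) s t := fun ψ hψ => (hle hψ).2.1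
  refine ⟨⟨?_, isG0Submodule_genBy φ, ?_, fun ψ hψ => (hle hψ).1, ?_, fun ψ hψ => (hle hψ).2.2.1,
    fun hn ψ hψ => (hle hψ).2.2.2 hn⟩, hbi⟩
  · exact (Submodule.ne_bot_iff _).mpr ⟨φ, mem_genBy φ, h0⟩
  · intro U' hU' hle'
    rw [or_iff_not_imp_left]
    intro hne
    obtain ⟨ψ, hψ, hψ0, hψ'⟩ := exists_isLowestWeightVector hU' hne
    obtain ⟨c, rfl⟩ := hlow ψ ⟨hle' hψ, hψ0, hψ'⟩
    have hc : c ≠ 0 := by rintro rfl; exact hψ0 (zero_smul _ _)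
    refine le_antisymm hle' (genBy_le hU' ?_)
    have := U'.smul_mem c⁻¹ hψ
    rwa [smul_smul, inv_mul_cancel₀ hc, one_smul] at this
  · rcases hst with ⟨rfl, rfl⟩ | ⟨rfl, rfl⟩
    · exact Or.inl hbi
    · exact Or.inr hbi

/-! ### Bi-graded components of cochains -/

lemma elZ₁_lie (u : SymAlg n m) : ⁅elZ₁ n m, u⁆.x = -u.x ∧ ⁅elZ₁ n m, u⁆.h = 0 ∧
    ⁅elZ₁ n m, u⁆.y = u.y ∧ ⁅elZ₁ n m, u⁆.gl = 0 ∧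
      ∀ i a, ⁅elZ₁ n m, u⁆.v i a = -(i : ℝ) * u.v i a := by
  refine ⟨by simp [elZ₁]; ring, by simp [elZ₁], by simp [elZ₁]; ring, by simp [elZ₁],
    fun i a => ?_⟩
  simp [elZ₁, SymAlg.actV, SymAlg.sl, rhoH_eq_diagonal, Matrix.diagonal_mul]
  ring

lemma elZ₂_lie (u : SymAlg n m) : ⁅elZ₂ n m, u⁆.x = 0 ∧ ⁅elZ₂ n m, u⁆.h = 0 ∧
    ⁅elZ₂ n m, u⁆.y = 0 ∧ ⁅elZ₂ n m, u⁆.gl = 0 ∧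
      ∀ i a, ⁅elZ₂ n m, u⁆.v i a = -u.v i a := by
  refine ⟨by simp [elZ₂], by simp [elZ₂], by simp [elZ₂], by simp [elZ₂], fun i a => ?_⟩
  simp [elZ₂, SymAlg.actV, SymAlg.sl]

lemma elZ₁_lie_elX : ⁅elZ₁ n m, elX n m⁆ = -elX n m := by
  rw [lie_elX _ rfl]
  simp only [elZ₁, zero_smul]
  module

lemma elZ₂_lie_elX : ⁅elZ₂ n m, elX n m⁆ = 0 := by
  rw [lie_elX _ rfl]
  simp [elZ₂]

lemma adMinus_elZ₁_vec (k : ℕ) (w : Fin m → ℝ) :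
    adMinus ⟨elZ₁ n m, elZ₁_mem⟩ (vec n k w) = (-(k : ℝ)) • vec n k w :=
  Subtype.ext (elZ₁_lie_vecG k w)

lemma adMinus_elZ₂_vec (k : ℕ) (w : Fin m → ℝ) :
    adMinus ⟨elZ₂ n m, elZ₂_mem⟩ (vec n k w) = -vec n k w :=
  Subtype.ext (elZ₂_lie_vecG k w)

lemma adMinus_elZ₁_negX : adMinus ⟨elZ₁ n m, elZ₁_mem⟩ (negX n m) = -negX n m :=
  Subtype.ext elZ₁_lie_elX

lemma adMinus_elZ₂_negX : adMinus ⟨elZ₂ n m, elZ₂_mem⟩ (negX n m) = 0 :=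
  Subtype.ext elZ₂_lie_elX

lemma C2_smul_left (φ : C2 n m) (c : ℝ) (u w : gMinus n m) : φ (c • u) w = c • φ u w := by
  have : φ (c • u) = c • φ u := φ.1.map_smul c u
  rw [this, LinearMap.smul_apply]

lemma C2_neg_left (φ : C2 n m) (u w : gMinus n m) : φ (-u) w = -φ u w := by
  have : φ (-u) = -φ u := φ.1.map_neg u
  rw [this, LinearMap.neg_apply]

lemma C2_zero_left (φ : C2 n m) (w : gMinus n m) : φ 0 w = 0 := by
  have : φ (0 : gMinus n m) = 0 := φ.1.map_zero
  rw [this, LinearMap.zero_apply]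

lemma lieAct_elZ₁_vec_vec (φ : C2 n m) (k l : ℕ) (v w : Fin m → ℝ) :
    lieAct ⟨elZ₁ n m, elZ₁_mem⟩ φ (vec n k v) (vec n l w) =
      ⁅elZ₁ n m, φ (vec n k v) (vec n l w)⁆ + ((k : ℝ) + l) • φ (vec n k v) (vec n l w) := by
  rw [lieAct_apply, adMinus_elZ₁_vec, adMinus_elZ₁_vec, C2_smul_left, map_smul]
  module

lemma lieAct_elZ₂_vec_vec (φ : C2 n m) (k l : ℕ) (v w : Fin m → ℝ) :
    lieAct ⟨elZ₂ n m, elZ₂_mem⟩ φ (vec n k v) (vec n l w) =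
      ⁅elZ₂ n m, φ (vec n k v) (vec n l w)⁆ + (2 : ℝ) • φ (vec n k v) (vec n l w) := by
  rw [lieAct_apply, adMinus_elZ₂_vec, adMinus_elZ₂_vec, C2_neg_left, map_neg]
  module

lemma lieAct_elZ₁_negX_vec (φ : C2 n m) (k : ℕ) (w : Fin m → ℝ) :
    lieAct ⟨elZ₁ n m, elZ₁_mem⟩ φ (negX n m) (vec n k w) =
      ⁅elZ₁ n m, φ (negX n m) (vec n k w)⁆ + (1 + (k : ℝ)) • φ (negX n m) (vec n k w) := by
  rw [lieAct_apply, adMinus_elZ₁_vec, adMinus_elZ₁_negX, map_smul, C2_neg_left]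
  module

lemma lieAct_elZ₂_negX_vec (φ : C2 n m) (k : ℕ) (w : Fin m → ℝ) :
    lieAct ⟨elZ₂ n m, elZ₂_mem⟩ φ (negX n m) (vec n k w) =
      ⁅elZ₂ n m, φ (negX n m) (vec n k w)⁆ + φ (negX n m) (vec n k w) := by
  rw [lieAct_apply, adMinus_elZ₂_vec, adMinus_elZ₂_negX, map_neg, C2_zero_left]
  module

/-- The bi-grade condition on the components of the values of a cochain. -/
lemma components_of_bigrade {u : SymAlg n m} {c d : ℝ} (h1 : ⁅elZ₁ n m, u⁆ = c • u)
    (h2 : ⁅elZ₂ n m, u⁆ = d • u) :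
    (d ≠ 0 ∨ c ≠ -1 → u.x = 0) ∧ (d ≠ 0 ∨ c ≠ 0 → u.h = 0) ∧ (d ≠ 0 ∨ c ≠ 1 → u.y = 0) ∧
      (d ≠ 0 ∨ c ≠ 0 → u.gl = 0) ∧
        ∀ (i : Fin (n + 1)), (d ≠ -1 ∨ c ≠ -(i : ℝ)) → ∀ a, u.v i a = 0 := by
  obtain ⟨a1, a2, a3, a4, a5⟩ := elZ₁_lie u
  obtain ⟨b1, b2, b3, b4, b5⟩ := elZ₂_lie u
  rw [h1] at a1 a2 a3 a4 a5
  rw [h2] at b1 b2 b3 b4 b5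
  simp only [SymAlg.smul_x, SymAlg.smul_h, SymAlg.smul_y, SymAlg.smul_gl, SymAlg.smul_v,
    Matrix.smul_apply, smul_eq_mul] at a1 a2 a3 a4 a5 b1 b2 b3 b4 b5
  refine ⟨?_, ?_, ?_, ?_, ?_⟩
  · rintro (h | h)
    · exact (mul_eq_zero.mp b1).resolve_left h
    · exact (mul_eq_zero.mp (show (c + 1) * u.x = 0 by linarith)).resolve_left
        fun h' => h (by linarith)
  · rintro (h | h)
    · exact (mul_eq_zero.mp b2).resolve_left h
    · exact (mul_eq_zero.mp a2).resolve_left h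
  · rintro (h | h)
    · exact (mul_eq_zero.mp b3).resolve_left h
    · exact (mul_eq_zero.mp (show (c - 1) * u.y = 0 by linarith)).resolve_left
        fun h' => h (by linarith)
  · rintro (h | h)
    · exact (smul_eq_zero.mp b4).resolve_left h
    · exact (smul_eq_zero.mp a4).resolve_left h
  · rintro i (h | h) a
    · exact (mul_eq_zero.mp (show (d + 1) * u.v i a = 0 by linarith [b5 i a])).resolve_left
        fun h' => h (by linarith)
    · exact (mul_eq_zero.mp (show (c + i) * u.v i a = 0 by linarith [a5 i a])).resolve_left
        fun h' => h (by linarith)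

lemma components_vec_vec {φ : C2 n m} {s t : ℝ} (h1 : lieAct ⟨elZ₁ n m, elZ₁_mem⟩ φ = s • φ)
    (h2 : lieAct ⟨elZ₂ n m, elZ₂_mem⟩ φ = t • φ) (k l : ℕ) (v w : Fin m → ℝ) :
    ⁅elZ₁ n m, φ (vec n k v) (vec n l w)⁆ = (s - k - l) • φ (vec n k v) (vec n l w) ∧
      ⁅elZ₂ n m, φ (vec n k v) (vec n l w)⁆ = (t - 2) • φ (vec n k v) (vec n l w) := by
  have e1 := lieAct_elZ₁_vec_vec φ k l v w
  have e2 := lieAct_elZ₂_vec_vec φ k l v w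
  rw [h1, smul_apply_apply] at e1
  rw [h2, smul_apply_apply] at e2
  rw [← sub_eq_iff_eq_add] at e1 e2
  constructor
  · rw [← e1]; module
  · rw [← e2]; module

lemma components_negX_vec {φ : C2 n m} {s t : ℝ} (h1 : lieAct ⟨elZ₁ n m, elZ₁_mem⟩ φ = s • φ)
    (h2 : lieAct ⟨elZ₂ n m, elZ₂_mem⟩ φ = t • φ) (k : ℕ) (w : Fin m → ℝ) :
    ⁅elZ₁ n m, φ (negX n m) (vec n k w)⁆ = (s - 1 - k) • φ (negX n m) (vec n k w) ∧
      ⁅elZ₂ n m, φ (negX n m) (vec n k w)⁆ = (t - 1) • φ (negX n m) (vec n k w) := by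
  have e1 := lieAct_elZ₁_negX_vec φ k w
  have e2 := lieAct_elZ₂_negX_vec φ k w
  rw [h1, smul_apply_apply] at e1
  rw [h2, smul_apply_apply] at e2
  rw [← sub_eq_iff_eq_add] at e1 e2
  constructor
  · rw [← e1]; module
  · rw [← e2]; module

/-! ### Sufficient conditions for coclosedness and strong regularity -/

/-- Coclosedness of a cochain which vanishes on `𝖷`, tested on the coboundaries
`(v, w) ↦ ψ(v) · w - ψ(w) · v`. -/
lemma coclosed_of_forall {φ : C2 n m} (hX : ∀ k w, φ (negX n m) (vec n k w) = 0)
    (h : ∀ k ≤ n, ∀ (v : Fin m → ℝ) (A : SymAlg n m), ∑ l : Fin (n + 1), ∑ b : Fin m,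
      (lenV n l)⁻¹ * ipG n m (φ (vec n k v) (vec n l (Pi.single b 1)))
        ⁅A, vecG n l (Pi.single b 1)⁆ = 0) (ψ : C1 n m) : ip2 n m φ (d1 n m ψ) = 0 := by
  have hX' : ∀ k w, φ (vec n k w) (negX n m) = 0 := fun k w => by rw [C2_skew, hX, neg_zero]
  have hXX : φ (negX n m) (negX n m) = 0 := twoCochain_alt φ _
  set G : Fin (n + 1) × Fin m → Fin (n + 1) × Fin m → ℝ := fun p q =>
    (lenV n p.1 * lenV n q.1)⁻¹ *
      ipG n m (φ (vec n p.1 (Pi.single p.2 1)) (vec n q.1 (Pi.single q.2 1)))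
        ⁅ψ (vec n p.1 (Pi.single p.2 1)), vecG n q.1 (Pi.single q.2 1)⁆ with hG
  have hsum : ∑ p, ∑ q, G p q = 0 := by
    refine Finset.sum_eq_zero fun p _ => ?_
    have := h p.1 (by omega) (Pi.single p.2 1) (ψ (vec n p.1 (Pi.single p.2 1)))
    rw [Fintype.sum_prod_type]
    simp only [hG, mul_inv, mul_assoc, ← Finset.mul_sum] at this ⊢
    rw [this, mul_zero]
  have hterm : ∀ p q, (lenV n p.1 * lenV n q.1)⁻¹ *
      ipG n m (φ (vec n p.1 (Pi.single p.2 1)) (vec n q.1 (Pi.single q.2 1)))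
        (d1 n m ψ (vec n p.1 (Pi.single p.2 1)) (vec n q.1 (Pi.single q.2 1))) =
      G p q + G q p := by
    intro p q
    simp only [hG]
    rw [C2_skew φ (vec n p.1 (Pi.single p.2 1)) (vec n q.1 (Pi.single q.2 1)), d1_vec_vec,
      map_sub, map_neg, LinearMap.neg_apply, mul_comm (lenV n q.1)]
    ring
  rw [ip2_apply, Fintype.sum_option]
  simp only [Fintype.sum_option, negBasis_none, negBasis_some, hX, hX', hXX, map_zero,
    LinearMap.zero_apply, mul_zero, Finset.sum_const_zero, zero_add, negLen, hterm]
  simp only [Finset.sum_add_distrib]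
  rw [Finset.sum_comm (f := fun p q => G q p), hsum]
  simp

/-- The components of an element of the filtration. -/
lemma filt_components {i : ℤ} {u : SymAlg n m} (hu : u ∈ filt n m i) :
    (-1 < i → u.x = 0) ∧ ∀ k : Fin (n + 1), -((k : ℕ) : ℤ) - 1 < i → u.v k = 0 := by
  let S : Submodule ℝ (SymAlg n m) :=
    { carrier := {u | (-1 < i → u.x = 0) ∧ ∀ k : Fin (n + 1), -((k : ℕ) : ℤ) - 1 < i → u.v k = 0}
      zero_mem' := ⟨fun _ => rfl, fun _ _ => rfl⟩
      add_mem' := by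
        rintro u w ⟨h1, h2⟩ ⟨k1, k2⟩
        refine ⟨fun h => by simp [h1 h, k1 h], fun k hk => ?_⟩
        have : (u + w).v k = u.v k + w.v k := rfl
        rw [this, h2 k hk, k2 k hk, add_zero]
      smul_mem' := by
        rintro c u ⟨h1, h2⟩
        refine ⟨fun h => by simp [h1 h], fun k hk => ?_⟩
        have : (c • u).v k = c • u.v k := rfl
        rw [this, h2 k hk, smul_zero] }
  have hle : filt n m i ≤ S := by
    refine iSup₂_le fun j hj u hu => ?_
    rw [gr, Module.End.mem_eigenspace_iff] at hu
    change ⁅elZ n m, u⁆ = _ at hu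
    rw [elZ, add_lie] at hu
    obtain ⟨a1, -, -, -, a5⟩ := elZ₁_lie u
    obtain ⟨b1, -, -, -, b5⟩ := elZ₂_lie u
    constructor
    · intro h
      have := congrArg SymAlg.x hu
      rw [SymAlg.add_x, a1, b1, SymAlg.smul_x] at this
      have h3 : (-1 : ℝ) < j := by exact_mod_cast lt_of_lt_of_le h hj
      exact (mul_eq_zero.mp (show ((j : ℝ) + 1) * u.x = 0 by linarith)).resolve_left
        (by linarith)
    · intro k hk
      ext a
      have := congrArg (fun z : SymAlg n m => z.v k a) hu
      simp only [SymAlg.add_v, Matrix.add_apply, a5, b5, SymAlg.smul_v, Matrix.smul_apply,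
        smul_eq_mul] at this
      have h3 : (-((k : ℕ) : ℝ) - 1 : ℝ) < j := by exact_mod_cast lt_of_lt_of_le hk hj
      exact (mul_eq_zero.mp (show ((j : ℝ) + k + 1) * u.v k a = 0 by linarith)).resolve_left
        (by linarith)
  exact hle hu

/-- Strong regularity of a cochain vanishing on `𝖷`, tested on homogeneous elements. -/
lemma isStronglyRegular_of_forall {φ : C2 n m} (hX : ∀ k w, φ (negX n m) (vec n k w) = 0)
    (h : ∀ k ≤ n, ∀ l ≤ n, ∀ v w, ∃ d : ℤ, φ (vec n k v) (vec n l w) ∈ gr n m d ∧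
      -(k : ℤ) - l - 1 ≤ d ∧ -max (k : ℤ) l - 2 ≤ d) : IsStronglyRegular φ := by
  intro i j u w hu hw
  have hX' : ∀ k w, φ (vec n k w) (negX n m) = 0 := fun k w => by rw [C2_skew, hX, neg_zero]
  have hXX : φ (negX n m) (negX n m) = 0 := twoCochain_alt φ _
  have hval : φ u w = ∑ k : Fin (n + 1), ∑ l : Fin (n + 1),
      φ (vec n k ((u : SymAlg n m).v k)) (vec n l ((w : SymAlg n m).v l)) := by
    conv_lhs => rw [gMinus_eq_sum u, gMinus_eq_sum w]
    have h1 : ∀ u u' : gMinus n m, φ (u + u') = φ u + φ u' := fun u u' => φ.1.map_add u u'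
    have h2 : ∀ (c : ℝ) (u : gMinus n m), φ (c • u) = c • φ u := fun c u => φ.1.map_smul c u
    have h3 : ∀ f : Fin (n + 1) → gMinus n m, φ (∑ k, f k) = ∑ k, φ (f k) :=
      fun f => map_sum φ.1 f _
    simp only [h1, h2, h3, map_add, map_smul, map_sum, LinearMap.add_apply, LinearMap.smul_apply,
      LinearMap.sum_apply, hX, hX', hXX, smul_zero, Finset.sum_const_zero, zero_add, add_zero]
    rw [Finset.sum_comm]
  rw [hval]
  refine Submodule.sum_mem _ fun k _ => Submodule.sum_mem _ fun l _ => ?_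
  rcases lt_or_ge (-((k : ℕ) : ℤ) - 1) i with hk | hk
  · rw [(filt_components hu).2 k hk, map_zero, C2_zero_left]
    exact Submodule.zero_mem _
  rcases lt_or_ge (-((l : ℕ) : ℤ) - 1) j with hl | hl
  · rw [(filt_components hw).2 l hl, map_zero, map_zero]
    exact Submodule.zero_mem _
  obtain ⟨d, hd, h1, h2⟩ := h k (by omega) l (by omega) ((u : SymAlg n m).v k)
    ((w : SymAlg n m).v l)
  exact ⟨gr_le_filt (by omega) hd, gr_le_filt (by omega) hd⟩

lemma mem_gr_of_lie {u : SymAlg n m} {c d : ℝ} (h1 : ⁅elZ₁ n m, u⁆ = c • u)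
    (h2 : ⁅elZ₂ n m, u⁆ = d • u) {k : ℤ} (hk : c + d = k) : u ∈ gr n m k := by
  rw [gr, Module.End.mem_eigenspace_iff]
  change ⁅elZ n m, u⁆ = _
  rw [elZ, add_lie, h1, h2, ← add_smul, hk]

/-! ### Bi-grade `(2, 2)` -/

/-- If `dim W ≥ 2`, a function `f` with `f(v) w = f(w) v` vanishes. -/
lemma eq_zero_of_smul_comm (hm : 2 ≤ m) {f : (Fin m → ℝ) → ℝ}
    (h : ∀ v w : Fin m → ℝ, f v • w = f w • v) (v : Fin m → ℝ) : f v = 0 := by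
  have hne : ∀ a : Fin m, ∃ b : Fin m, b ≠ a := fun a => by
    have : Nontrivial (Fin m) := Fin.nontrivial_iff_two_le.mpr hm
    exact exists_ne a
  by_cases hv : v = 0
  · have := congrFun (h v (Pi.single ⟨0, by omega⟩ 1)) ⟨0, by omega⟩
    simpa [hv] using this
  · obtain ⟨a, ha⟩ := Function.ne_iff.mp hv
    obtain ⟨b, hb⟩ := hne a
    have h1 := congrFun (h v (Pi.single b 1)) a
    have h2 := congrFun (h v (Pi.single b 1)) b
    simp only [Pi.smul_apply, smul_eq_mul, Pi.single_eq_same, Pi.single_eq_of_ne hb.symm, mul_zero,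
      mul_one] at h1 h2
    rw [h2, (mul_eq_zero.mp h1.symm).resolve_right ha, zero_mul]

lemma negX_vec_eq_zero_of_bigrade_two {φ : C2 n m}
    (h1 : lieAct ⟨elZ₁ n m, elZ₁_mem⟩ φ = (2 : ℝ) • φ)
    (h2 : lieAct ⟨elZ₂ n m, elZ₂_mem⟩ φ = (2 : ℝ) • φ) (k : ℕ) (w : Fin m → ℝ) :
    φ (negX n m) (vec n k w) = 0 := by
  obtain ⟨e1, e2⟩ := components_negX_vec h1 h2 k w
  obtain ⟨c1, c2, c3, c4, c5⟩ := components_of_bigrade e1 e2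
  ext i a
  · exact c1 (Or.inl (by norm_num))
  · exact c2 (Or.inl (by norm_num))
  · exact c3 (Or.inl (by norm_num))
  · rw [c4 (Or.inl (by norm_num))]; rfl
  · exact c5 i (Or.inl (by norm_num)) a

lemma components_of_bigrade_two {φ : C2 n m}
    (h1 : lieAct ⟨elZ₁ n m, elZ₁_mem⟩ φ = (2 : ℝ) • φ)
    (h2 : lieAct ⟨elZ₂ n m, elZ₂_mem⟩ φ = (2 : ℝ) • φ) (k l : ℕ) (v w : Fin m → ℝ) :
    (k + l ≠ 3 → (φ (vec n k v) (vec n l w)).x = 0) ∧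
    (k + l ≠ 2 → (φ (vec n k v) (vec n l w)).h = 0) ∧
    (k + l ≠ 1 → (φ (vec n k v) (vec n l w)).y = 0) ∧
    (k + l ≠ 2 → (φ (vec n k v) (vec n l w)).gl = 0) ∧
    (φ (vec n k v) (vec n l w)).v = 0 := by
  obtain ⟨e1, e2⟩ := components_vec_vec h1 h2 k l v w
  obtain ⟨c1, c2, c3, c4, c5⟩ := components_of_bigrade e1 e2
  refine ⟨fun h => c1 (Or.inr fun h' => h ?_), fun h => c2 (Or.inr fun h' => h ?_),
    fun h => c3 (Or.inr fun h' => h ?_), fun h => c4 (Or.inr fun h' => h ?_), ?_⟩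
  · have : (k : ℝ) + l = 3 := by linarith
    exact_mod_cast this
  · have : (k : ℝ) + l = 2 := by linarith
    exact_mod_cast this
  · have : (k : ℝ) + l = 1 := by linarith
    exact_mod_cast this
  · have : (k : ℝ) + l = 2 := by linarith
    exact_mod_cast this
  · ext i a
    exact c5 i (Or.inl (by norm_num)) a

/-- The `𝖸`-component of `φ(E_0 ⊗ v, E_1 ⊗ w)`. -/
noncomputable def yPart (φ : C2 n m) (v w : Fin m → ℝ) : ℝ := (φ (vec n 0 v) (vec n 1 w)).y

/-- A closed cochain of bi-grade `(2, 2)` vanishes if `n ≥ 3`, and it is determined by its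
component `yPart` if `n = 2`. The `𝖷`-equivariance on `V × V` and the Bianchi identity express all
components by `yPart`; for `n ≥ 3` the Bianchi identity on `E_1, E_1, E_n` adds a further
relation. -/
lemma eq_zero_of_bigrade_two (hn : 2 ≤ n) (hm : 2 ≤ m) {φ : C2 n m} (hd : d2 n m φ = 0)
    (h1 : lieAct ⟨elZ₁ n m, elZ₁_mem⟩ φ = (2 : ℝ) • φ)
    (h2 : lieAct ⟨elZ₂ n m, elZ₂_mem⟩ φ = (2 : ℝ) • φ)
    (hy : n = 2 → ∀ v w, yPart φ v w = 0) : φ = 0 := by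
  have hX := negX_vec_eq_zero_of_bigrade_two h1 h2
  have hc := components_of_bigrade_two h1 h2
  have hcoc : ∀ (k l : ℕ) (v w : Fin m → ℝ), ⁅elX n m, φ (vec n k v) (vec n l w)⁆ =
      φ (vec n (k + 1) v) (vec n l w) + φ (vec n k v) (vec n (l + 1) w) := fun k l v w => by
    have := cocycle_negX_vec_vec hd k l v w
    rwa [hX, hX, zero_lie, zero_lie, add_zero, sub_zero] at this
  have hbi := cocycle_vec_vec_vec hd
  have hlie : ∀ (u : SymAlg n m), u.x = 0 → u.y = 0 → ∀ (k : ℕ) (w : Fin m → ℝ),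
      ⁅u, vecG n k w⁆ = vecG n k ((u.h * (2 * k - n)) • w + u.gl.mulVec w) := by
    intro u hux huy k w
    rw [lie_vecG, hux, huy, map_add, map_smul]
    module
  have hlieX : ∀ (u : SymAlg n m), u.h = 0 → u.y = 0 → u.gl = 0 → ∀ (k : ℕ) (w : Fin m → ℝ),
      ⁅u, vecG n k w⁆ = vecG n (k + 1) (u.x • w) := by
    intro u huh huy hug k w
    rw [lie_vecG, huh, huy, hug, map_smul, Matrix.zero_mulVec, map_zero]
    module
  -- The components that are not forced to vanish by the bi-grade.
  set Y : (Fin m → ℝ) → (Fin m → ℝ) → ℝ := yPart φ with hY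
  set H : (Fin m → ℝ) → (Fin m → ℝ) → ℝ := fun v w => (φ (vec n 0 v) (vec n 2 w)).h with hH
  set A : (Fin m → ℝ) → (Fin m → ℝ) → Matrix (Fin m) (Fin m) ℝ :=
    fun v w => (φ (vec n 0 v) (vec n 2 w)).gl with hA
  set K : (Fin m → ℝ) → (Fin m → ℝ) → ℝ := fun v w => (φ (vec n 1 v) (vec n 1 w)).h with hK
  set C : (Fin m → ℝ) → (Fin m → ℝ) → Matrix (Fin m) (Fin m) ℝ :=
    fun v w => (φ (vec n 1 v) (vec n 1 w)).gl with hC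
  set P : (Fin m → ℝ) → (Fin m → ℝ) → ℝ := fun v w => (φ (vec n 1 v) (vec n 2 w)).x with hP
  set Q : (Fin m → ℝ) → (Fin m → ℝ) → ℝ := fun v w => (φ (vec n 0 v) (vec n 3 w)).x with hQ
  have hKa : ∀ v w, K w v = -K v w := fun v w => by
    simp only [hK, C2_skew φ (vec n 1 v), SymAlg.neg_h]
  have hCa : ∀ v w, C w v = -C v w := fun v w => by
    simp only [hC, C2_skew φ (vec n 1 v), SymAlg.neg_gl]
  have eYs : ∀ v w, Y v w = Y w v := by
    intro v w
    have := congrArg SymAlg.y (hcoc 0 0 v w)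
    rw [SymAlg.lie_y, SymAlg.add_y, C2_skew φ (vec n 0 w) (vec n (0 + 1) v), SymAlg.neg_y] at this
    simp only [elX, zero_mul, sub_self, mul_zero, zero_add] at this
    simp only [hY, yPart]
    linarith
  have eYKH : ∀ v w, Y v w = K v w + H v w := by
    intro v w
    have := congrArg SymAlg.h (hcoc 0 1 v w)
    rw [SymAlg.lie_h, SymAlg.add_h] at this
    simp only [elX, zero_mul, sub_zero, one_mul, zero_add] at this
    exact this
  have eCA : ∀ v w, C v w = -A v w := by
    intro v w
    have := congrArg SymAlg.gl (hcoc 0 1 v w)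
    rw [SymAlg.lie_gl, SymAlg.add_gl] at this
    simp only [elX, zero_mul, mul_zero, sub_zero] at this
    exact eq_neg_of_add_eq_zero_left this.symm
  have eKP : ∀ v w, -2 * K v w = P v w - P w v := by
    intro v w
    have := congrArg SymAlg.x (hcoc 1 1 v w)
    rw [SymAlg.lie_x, SymAlg.add_x, C2_skew φ (vec n 1 w) (vec n (1 + 1) v), SymAlg.neg_x] at this
    simp only [elX, zero_mul, zero_sub, one_mul] at this
    simp only [hK, hP]
    linarith
  have eHPQ : ∀ v w, -2 * H v w = P v w + Q v w := by
    intro v w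
    have := congrArg SymAlg.x (hcoc 0 2 v w)
    rw [SymAlg.lie_x, SymAlg.add_x] at this
    simp only [elX, zero_mul, zero_sub, one_mul] at this
    simp only [hH, hP, hQ]
    linarith
  have eBi : ∀ u v w : Fin m → ℝ, (-(n : ℝ) * H v w) • u + (A v w).mulVec u =
      (-(n : ℝ) * H u w) • v + (A u w).mulVec v := by
    intro u v w
    have := hbi 0 0 2 u v w
    have h00 : φ (vec n 0 u) (vec n 0 v) = 0 := by
      obtain ⟨c1, c2, c3, c4, c5⟩ := hc 0 0 u v
      exact SymAlg.ext (c1 (by norm_num)) (c2 (by norm_num)) (c3 (by norm_num))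
        (c4 (by norm_num)) c5
    have hd1 := hc 0 2 v w
    have hd2 := hc 0 2 u w
    rw [h00, zero_lie, zero_add, C2_skew φ (vec n 0 u), neg_lie,
      hlie _ (hd1.1 (by norm_num)) (hd1.2.2.1 (by norm_num)),
      hlie _ (hd2.1 (by norm_num)) (hd2.2.2.1 (by norm_num)), add_neg_eq_zero] at this
    have := vecG_inj (n := n) (by omega) this
    have e : ∀ x : ℝ, x * (2 * ((0 : ℕ) : ℝ) - n) = -(n : ℝ) * x := fun x => by push_cast; ring
    rwa [e, e] at this
  -- It suffices to see that all these components vanish.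
  suffices hall : (∀ v w, Y v w = 0) ∧ (∀ v w, H v w = 0) ∧ (∀ v w, A v w = 0) ∧
      (∀ v w, Q v w = 0) by
    obtain ⟨zY, zH, zA, zQ⟩ := hall
    have zK : ∀ v w, K v w = 0 := fun v w => by linarith [eYKH v w, zY v w, zH v w]
    have zC : ∀ v w, C v w = 0 := fun v w => by rw [eCA, zA, neg_zero]
    have zP : ∀ v w, P v w = 0 := fun v w => by linarith [eHPQ v w, zQ v w, zH v w]
    have hle : ∀ k l v w, k ≤ l → φ (vec n k v) (vec n l w) = 0 := by
      intro k l v w hkl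
      obtain ⟨c1, c2, c3, c4, c5⟩ := hc k l v w
      refine SymAlg.ext ?_ ?_ ?_ ?_ c5
      · by_cases h : k + l = 3
        · rcases (by omega : (k = 0 ∧ l = 3) ∨ (k = 1 ∧ l = 2)) with ⟨rfl, rfl⟩ | ⟨rfl, rfl⟩
          exacts [zQ v w, zP v w]
        · exact c1 h
      · by_cases h : k + l = 2
        · rcases (by omega : (k = 0 ∧ l = 2) ∨ (k = 1 ∧ l = 1)) with ⟨rfl, rfl⟩ | ⟨rfl, rfl⟩
          exacts [zH v w, zK v w]
        · exact c2 h
      · by_cases h : k + l = 1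
        · obtain ⟨rfl, rfl⟩ : k = 0 ∧ l = 1 := by omega
          exact zY v w
        · exact c3 h
      · by_cases h : k + l = 2
        · rcases (by omega : (k = 0 ∧ l = 2) ∨ (k = 1 ∧ l = 1)) with ⟨rfl, rfl⟩ | ⟨rfl, rfl⟩
          exacts [zA v w, zC v w]
        · exact c4 h
    refine C2_ext (fun k _ w => hX k w) fun k _ l _ v w => ?_
    rcases le_total k l with h | h
    · exact hle k l v w h
    · rw [C2_skew, hle l k w v h, neg_zero]; rfl
  rcases eq_or_lt_of_le hn with hn2 | hn3
  · have zY := hy hn2.symm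
    have zQ : ∀ v w, Q v w = 0 := fun v w => by
      simp only [hQ]; rw [vec_eq_zero (n := n) (k := 3) (by omega), map_zero]; rfl
    have zH : ∀ v w, H v w = 0 := fun v w => by
      have := eYKH v w; have := eYKH w v; have := eKP v w; have := eHPQ v w; have := eHPQ w v
      have := zY v w; have := zY w v; have := zQ v w; have := zQ w v; have := hKa v w
      linarith
    refine ⟨zY, zH, fun v w => ?_, zQ⟩
    have sA : ∀ u v w : Fin m → ℝ, (A v w).mulVec u = (A u w).mulVec v := fun u v w => by
      have := eBi u v w
      rwa [zH, zH, mul_zero, zero_smul, zero_smul, zero_add, zero_add] at this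
    have aA : ∀ v w, A w v = -A v w := fun v w => by
      rw [← neg_eq_iff_eq_neg.mpr (eCA w v), hCa, eCA, neg_neg]
    have key : ∀ u, (A v w).mulVec u = 0 := by
      intro u
      have e : (A v w).mulVec u = -(A v w).mulVec u := by
        calc (A v w).mulVec u = (A u w).mulVec v := sA u v w
          _ = -(A w u).mulVec v := by rw [aA w u, Matrix.neg_mulVec]
          _ = -(A v u).mulVec w := by rw [sA v w u]
          _ = (A u v).mulVec w := by rw [aA u v, Matrix.neg_mulVec, neg_neg]
          _ = (A w v).mulVec u := by rw [sA w u v]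
          _ = -(A v w).mulVec u := by rw [aA v w, Matrix.neg_mulVec]
      exact self_eq_neg.mp e
    exact Matrix.ext_of_mulVec_single fun a => by rw [key, Matrix.zero_mulVec]
  · have eCK : ∀ u v w : Fin m → ℝ, (C u v).mulVec w = (-(n : ℝ) * K u v) • w := by
      intro u v w
      have := hbi 1 1 n u v w
      have h0 : ∀ u w : Fin m → ℝ, φ (vec n 1 u) (vec n n w) = 0 := fun u w => by
        obtain ⟨c1, c2, c3, c4, c5⟩ := hc 1 n u w
        exact SymAlg.ext (c1 (by omega)) (c2 (by omega)) (c3 (by omega)) (c4 (by omega)) c5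
      have hd1 := hc 1 1 u v
      rw [C2_skew φ (vec n 1 u) (vec n n w), h0, h0, neg_zero, zero_lie, zero_lie, add_zero,
        add_zero, hlie _ (hd1.1 (by norm_num)) (hd1.2.2.1 (by norm_num))] at this
      have := vecG_inj (n := n) le_rfl (this.trans (map_zero _).symm)
      have h3 := eq_neg_of_add_eq_zero_right this
      simp only [hC, hK]
      rw [h3, ← neg_smul]
      congr 1
      ring
    have zKH : ∀ v w, K v w - H v w = 0 := by
      intro v w
      refine eq_zero_of_smul_comm hm (f := fun v => K v w - H v w) (fun u v => ?_) v
      have := eBi u v w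
      have hA' : ∀ v w, A v w = -C v w := fun v w => by rw [eCA, neg_neg]
      rw [hA', hA', Matrix.neg_mulVec, Matrix.neg_mulVec, eCK, eCK] at this
      have hn0 : (n : ℝ) ≠ 0 := by exact_mod_cast (by omega : n ≠ 0)
      refine smul_right_injective _ hn0 ?_
      simp only [smul_smul]
      rw [← sub_eq_zero] at this ⊢
      rw [← neg_eq_zero, ← this]
      module
    have zK : ∀ v w, K v w = 0 := fun v w => by
      linarith [eYKH v w, eYKH w v, eYs v w, hKa v w, zKH v w, zKH w v]
    have zH : ∀ v w, H v w = 0 := fun v w => by linarith [zKH v w, zK v w]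
    have zC : ∀ v w, C v w = 0 := fun v w => Matrix.ext_of_mulVec_single fun a => by
      rw [eCK, zK, mul_zero, zero_smul, Matrix.zero_mulVec]
    refine ⟨fun v w => by linarith [eYKH v w, zK v w, zH v w], zH, fun v w => ?_, fun v w => ?_⟩
    · rw [← neg_eq_zero, ← eCA, zC]
    · refine eq_zero_of_smul_comm hm (f := fun v => Q v w) (fun u v => ?_) v
      have := hbi 0 0 3 u v w
      have h00 : φ (vec n 0 u) (vec n 0 v) = 0 := by
        obtain ⟨c1, c2, c3, c4, c5⟩ := hc 0 0 u v
        exact SymAlg.ext (c1 (by norm_num)) (c2 (by norm_num)) (c3 (by norm_num))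
          (c4 (by norm_num)) c5
      obtain ⟨-, d2, d3, d4, -⟩ := hc 0 3 v w
      obtain ⟨-, b2, b3, b4, -⟩ := hc 0 3 u w
      rw [h00, zero_lie, zero_add, C2_skew φ (vec n 0 u), neg_lie,
        hlieX _ (d2 (by norm_num)) (d3 (by norm_num)) (d4 (by norm_num)),
        hlieX _ (b2 (by norm_num)) (b3 (by norm_num)) (b4 (by norm_num)), add_neg_eq_zero] at this
      exact (vecG_inj (n := n) (by omega) this).symm

lemma single_lower {a b : Fin m} (h : b < a) (c d : Fin m) (hcd : c ≤ d) :
    Matrix.single a b (1 : ℝ) c d = 0 := by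
  rw [Matrix.single_apply, if_neg]
  rintro ⟨rfl, rfl⟩
  exact absurd h (not_lt.mpr hcd)

lemma single_mulVec_single (a b c : Fin m) : (Matrix.single a b (1 : ℝ)).mulVec
    (Pi.single c 1 : Fin m → ℝ) = if c = b then Pi.single a 1 else 0 := by
  ext d
  split_ifs with h
  · rw [h]; simp [Matrix.single_apply, Pi.single_apply, eq_comm]
  · simp [Ne.symm h]

/-- A symmetric bilinear form on `W` which is annihilated by all strictly lower triangular matrices
is a multiple of `(w^1)²`. -/
lemma bilin_lowest (hm : 0 < m) {Y : (Fin m → ℝ) →ₗ[ℝ] (Fin m → ℝ) →ₗ[ℝ] ℝ}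
    (hs : ∀ v w, Y v w = Y w v)
    (hN : ∀ N : Matrix (Fin m) (Fin m) ℝ, (∀ a b, a ≤ b → N a b = 0) →
      ∀ v w, Y (N.mulVec v) w + Y v (N.mulVec w) = 0) (v w : Fin m → ℝ) :
    Y v w = Y (Pi.single ⟨0, hm⟩ 1) (Pi.single ⟨0, hm⟩ 1) * (v ⟨0, hm⟩ * w ⟨0, hm⟩) := by
  set z : Fin m := ⟨0, hm⟩
  have hz : ∀ a, a ≠ z → z < a := fun a ha => lt_of_le_of_ne (Nat.zero_le _) ha.symm
  have h0 : ∀ a, a ≠ z → ∀ c, Y (Pi.single a 1) (Pi.single c 1) = 0 := by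
    intro a ha c
    have := hN _ (single_lower (hz a ha)) (Pi.single z 1) (Pi.single c 1)
    rw [single_mulVec_single, single_mulVec_single, if_pos rfl] at this
    split_ifs at this with hc
    · rw [hc] at this ⊢
      linarith [hs (Pi.single a 1) (Pi.single z 1)]
    · simpa using this
  have key : Y = (Y (Pi.single z 1) (Pi.single z 1)) •
      (LinearMap.mul ℝ ℝ).compl₁₂ (LinearMap.proj z) (LinearMap.proj z) := by
    refine LinearMap.pi_ext' fun a => LinearMap.ext_ring (LinearMap.pi_ext' fun c =>
      LinearMap.ext_ring ?_)
    change Y (Pi.single a 1) (Pi.single c 1) = _ * ((Pi.single a 1 : Fin m → ℝ) z *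
      (Pi.single c 1 : Fin m → ℝ) z)
    by_cases ha : a = z
    · by_cases hc : c = z
      · rw [ha, hc]; simp
      · rw [hs, h0 c hc, Pi.single_eq_of_ne (Ne.symm hc)]; simp
    · rw [h0 a ha, Pi.single_eq_of_ne (Ne.symm ha)]; simp
  exact congrArg (fun F => F v w) key

/-! ### Evaluation of the explicit cochains -/

/-- The Kronecker delta with real values. -/
def kd (i j : ℕ) : ℝ := if i = j then 1 else 0

lemma kd_self (i : ℕ) : kd i i = 1 := if_pos rfl

lemma kd_of_ne {i j : ℕ} (h : i ≠ j) : kd i j = 0 := if_neg h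

lemma sum_range_mul_kd {n l : ℕ} (hl : l ≤ n) (f : ℕ → ℝ) :
    ∑ i ∈ Finset.range (n + 1), f i * kd l i = f l := by
  simp only [kd, mul_ite, mul_one, mul_zero, Finset.sum_ite_eq, Finset.mem_range]
  rw [if_pos (by omega)]

lemma sum_Icc_eq_sum_fin {M : Type*} [AddCommMonoid M] (f : ℕ → M) :
    ∑ a ∈ Finset.Icc 1 m, f a = ∑ a : Fin m, f (a + 1) := by
  rw [Fin.sum_univ_eq_sum_range (fun a => f (a + 1)) m, Finset.range_eq_Ico,
    Finset.sum_Ico_add' f 0 m 1]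
  rfl

lemma dualV_vec {k : ℕ} (hk : k ≤ n) (a : Fin m) (i : ℕ) (v : Fin m → ℝ) :
    dualV n m k (a + 1) (vec n i v) = kd i k * v a := by
  change (∑ j : Fin (n + 1), ∑ b : Fin m,
    if (j : ℕ) = k ∧ (b : ℕ) + 1 = a + 1 then (vecG n i v).v j b else 0) = _
  rw [Finset.sum_eq_single ⟨k, by omega⟩, Finset.sum_eq_single a]
  · simp [vecG_v, kd, eq_comm]
  · intro b _ hb
    rw [if_neg]
    rintro ⟨-, h⟩
    exact hb (Fin.ext (by omega))
  · simp
  · intro j _ hj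
    refine Finset.sum_eq_zero fun b _ => if_neg ?_
    rintro ⟨h, -⟩
    exact hj (Fin.ext h)
  · simp

lemma dualV_one_vec (hm : 0 < m) {k : ℕ} (hk : k ≤ n) (i : ℕ) (v : Fin m → ℝ) :
    dualV n m k 1 (vec n i v) = kd i k * v ⟨0, hm⟩ := dualV_vec hk ⟨0, hm⟩ i v

lemma dualV_negX (k a : ℕ) : dualV n m k a (negX n m) = 0 := by
  change (∑ j : Fin (n + 1), ∑ b : Fin m,
    if (j : ℕ) = k ∧ (b : ℕ) + 1 = a then (elX n m).v j b else 0) = _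
  simp [elX]

lemma wedge_negX (k a l b : ℕ) (A : SymAlg n m) (w : gMinus n m) :
    wedge (dualV n m k a) (dualV n m l b) A (negX n m) w = 0 := by
  rw [wedge_apply, dualV_negX, dualV_negX, zero_mul, zero_mul, sub_zero, zero_smul]

/-! ### The lowest weight vector of `𝔹₄` -/

/-- The rank one endomorphism `v ↦ v^1 w` of `W`, as an element of `𝔤`. -/
def rankOne (n : ℕ) (hm : 0 < m) (w : Fin m → ℝ) : SymAlg n m :=
  ofGl n m (Matrix.vecMulVec w (Pi.single ⟨0, hm⟩ 1))

lemma sum_smul_elE (hm : 0 < m) (c : ℝ) (w : Fin m → ℝ) :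
    ∑ a : Fin m, (c * w a) • elE n m (a + 1) 1 = c • rankOne n hm w := by
  have h1 : ∀ a : Fin m, elE n m (a + 1) 1 = rankOne n hm (Pi.single a 1) := by
    intro a
    rw [elE, rankOne]
    congr 1
    ext i j
    simp only [Matrix.of_apply, Matrix.vecMulVec_apply, Pi.single_apply, Fin.ext_iff]
    split_ifs <;> simp_all
  have h2 : ∀ (c : ℝ) (w : Fin m → ℝ), rankOne n hm (c • w) = c • rankOne n hm w := fun c w => by
    ext1 <;> simp [rankOne, ofGl, Matrix.smul_vecMulVec]
  have h3 : ∀ s : Finset (Fin m), ∑ a ∈ s, rankOne n hm (Pi.single a (w a)) =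
      rankOne n hm (∑ a ∈ s, Pi.single a (w a)) := by
    intro s
    induction s using Finset.induction_on with
    | empty => simp [rankOne, ofGl]; rfl
    | insert a s ha ih =>
      rw [Finset.sum_insert ha, Finset.sum_insert ha, ih]
      ext1 <;> simp [rankOne, ofGl, Matrix.add_vecMulVec]
  have h4 : ∀ a : Fin m, Pi.single a (w a) = w a • (Pi.single a 1 : Fin m → ℝ) := fun a => by
    rw [← Pi.single_smul, smul_eq_mul, mul_one]
  conv_rhs => rw [← Finset.univ_sum_single w, ← h3, Finset.smul_sum]
  refine Finset.sum_congr rfl fun a _ => ?_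
  rw [h1, h4, h2, smul_smul]

lemma PhiB4_apply (hm : 0 < m) (hn : 2 ≤ n) (i j : ℕ) (v w : Fin m → ℝ) :
    PhiB4 n m (vec n i v) (vec n j w) =
      ((kd i 2 * kd j 1 - kd i 1 * kd j 2) * (v ⟨0, hm⟩ * w ⟨0, hm⟩)) • elX n m
      - (1 / 2 * (kd i 2 * kd j 0 - kd i 0 * kd j 2) * (v ⟨0, hm⟩ * w ⟨0, hm⟩)) • elH n m
      - (1 / 2 * (kd i 1 * kd j 0 - kd i 0 * kd j 1) * (v ⟨0, hm⟩ * w ⟨0, hm⟩)) • elY n m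
      + (kd i 2 * kd j 0 - kd i 1 * kd j 1 + kd i 0 * kd j 2) •
        (v ⟨0, hm⟩ • rankOne n hm w - w ⟨0, hm⟩ • rankOne n hm v) := by
  have hsum : ∀ {p q : ℕ}, p ≤ n → q ≤ n → ∑ a : Fin m,
      wedge (dualV n m p 1) (dualV n m q (a + 1)) (elE n m (a + 1) 1) (vec n i v) (vec n j w) =
      (kd i p * kd j q * v ⟨0, hm⟩) • rankOne n hm w -
        (kd i q * kd j p * w ⟨0, hm⟩) • rankOne n hm v := by
    intro p q hp hq
    rw [← sum_smul_elE, ← sum_smul_elE, ← Finset.sum_sub_distrib]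
    refine Finset.sum_congr rfl fun a _ => ?_
    rw [wedge_apply, dualV_one_vec hm hp, dualV_one_vec hm hp, dualV_vec hq, dualV_vec hq,
      ← sub_smul]
    congr 1
    ring
  have h0 : (0 : ℕ) ≤ n := Nat.zero_le n
  have h1 : 1 ≤ n := by omega
  simp only [PhiB4, add_apply_apply, C2_sub_apply, smul_apply_apply, C2_sum_apply,
    sum_Icc_eq_sum_fin, Finset.sum_add_distrib, Finset.sum_sub_distrib, hsum hn h0, hsum h1 h1,
    hsum h0 hn]
  simp only [wedge_apply, dualV_one_vec hm hn, dualV_one_vec hm h1, dualV_one_vec hm h0]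
  module

lemma PhiB4_negX (w : gMinus n m) : PhiB4 n m (negX n m) w = 0 := by
  simp only [PhiB4, add_apply_apply, C2_sub_apply, smul_apply_apply, C2_sum_apply, wedge_negX,
    smul_zero, sub_zero, add_zero, Finset.sum_const_zero]

lemma rankOne_lie_vecG (hm : 0 < m) (u : Fin m → ℝ) (k : ℕ) (w : Fin m → ℝ) :
    ⁅rankOne n hm u, vecG n k w⁆ = w ⟨0, hm⟩ • vecG n k u := by
  rw [rankOne, ofGl_lie_vecG, ← map_smul]
  congr 1
  ext a
  simp [Matrix.mulVec, dotProduct, Matrix.vecMulVec_apply, Pi.single_apply, mul_comm]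

lemma elH_lie_vecG (k : ℕ) (w : Fin m → ℝ) :
    ⁅elH n m, vecG n k w⁆ = (2 * (k : ℝ) - n) • vecG n k w := by
  simp [lie_vecG, elH]

lemma elY_lie_vecG (k : ℕ) (w : Fin m → ℝ) :
    ⁅elY n m, vecG n k w⁆ = ((k : ℝ) * (n + 1 - k)) • vecG n (k - 1) w := by
  simp [lie_vecG, elY]

lemma elX_lie_elH : ⁅elX n m, elH n m⁆ = (-2 : ℝ) • elX n m := by
  ext1 <;> simp [elX, elH, SymAlg.actV]

lemma elX_lie_elY : ⁅elX n m, elY n m⁆ = elH n m := by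
  ext1 <;> simp [elX, elH, elY, SymAlg.actV]

lemma elX_lie_ofGl (N : Matrix (Fin m) (Fin m) ℝ) : ⁅elX n m, ofGl n m N⁆ = 0 := by
  ext1 <;> simp [elX, ofGl, SymAlg.actV]

lemma ofGl_lie_elX (N : Matrix (Fin m) (Fin m) ℝ) : ⁅ofGl n m N, elX n m⁆ = 0 := by
  rw [← lie_skew, elX_lie_ofGl, neg_zero]

lemma ofGl_lie_elH (N : Matrix (Fin m) (Fin m) ℝ) : ⁅ofGl n m N, elH n m⁆ = 0 := by
  ext1 <;> simp [elH, ofGl, SymAlg.actV]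

lemma ofGl_lie_elY (N : Matrix (Fin m) (Fin m) ℝ) : ⁅ofGl n m N, elY n m⁆ = 0 := by
  ext1 <;> simp [elY, ofGl, SymAlg.actV]

lemma elZ₁_lie_elH : ⁅elZ₁ n m, elH n m⁆ = 0 := by
  ext1 <;> simp [elH, elZ₁, SymAlg.actV]

lemma elZ₁_lie_elY : ⁅elZ₁ n m, elY n m⁆ = elY n m := by
  ext1 <;> simp [elY, elZ₁, SymAlg.actV]
  norm_num

lemma elZ₁_lie_ofGl (N : Matrix (Fin m) (Fin m) ℝ) : ⁅elZ₁ n m, ofGl n m N⁆ = 0 := by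
  ext1 <;> simp [ofGl, elZ₁, SymAlg.actV]

lemma PhiB4_v (hm : 0 < m) (hn : 2 ≤ n) (i j : ℕ) (v w : Fin m → ℝ) :
    (PhiB4 n m (vec n i v) (vec n j w)).v = 0 := by
  rw [PhiB4_apply hm hn]
  simp [elX, elH, elY, rankOne, ofGl]

lemma d2_PhiB4 (hm : 0 < m) : d2 2 m (PhiB4 2 m) = 0 := by
  refine d2_eq_zero (fun k w => PhiB4_negX _) ?_ ?_
  · intro k hk l hl v w
    simp only [PhiB4_apply hm le_rfl, lie_add, lie_sub, lie_smul, lie_self, elX_lie_elH,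
      elX_lie_elY, rankOne, elX_lie_ofGl]
    interval_cases k <;> interval_cases l <;> simp [kd] <;> module
  · intro i hi j hj k hk u v w
    simp only [PhiB4_apply hm le_rfl, add_lie, sub_lie, smul_lie, elX_lie_vecG, elH_lie_vecG,
      elY_lie_vecG, rankOne_lie_vecG]
    interval_cases i <;> interval_cases j <;> interval_cases k <;> simp [kd, vecG_eq_zero] <;>
      module

lemma PhiB4_bigrade (hm : 0 < m) :
    lieAct ⟨elZ₁ 2 m, elZ₁_mem⟩ (PhiB4 2 m) = (2 : ℝ) • PhiB4 2 m ∧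
      lieAct ⟨elZ₂ 2 m, elZ₂_mem⟩ (PhiB4 2 m) = (2 : ℝ) • PhiB4 2 m := by
  constructor
  · refine C2_ext (fun k hk w => ?_) fun k hk l hl v w => ?_
    · rw [lieAct_elZ₁_negX_vec, smul_apply_apply, PhiB4_negX]
      simp
    · rw [lieAct_elZ₁_vec_vec, smul_apply_apply]
      simp only [PhiB4_apply hm le_rfl, lie_add, lie_sub, lie_smul, elZ₁_lie_elX, elZ₁_lie_elH,
        elZ₁_lie_elY, rankOne, elZ₁_lie_ofGl]
      interval_cases k <;> interval_cases l <;> simp [kd] <;> module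
  · refine C2_ext (fun k hk w => ?_) fun k hk l hl v w => ?_
    · rw [lieAct_elZ₂_negX_vec, smul_apply_apply, PhiB4_negX]
      simp
    · rw [lieAct_elZ₂_vec_vec, smul_apply_apply]
      have : ⁅elZ₂ 2 m, PhiB4 2 m (vec 2 k v) (vec 2 l w)⁆ = 0 := by
        obtain ⟨h1, h2, h3, h4, h5⟩ := elZ₂_lie (PhiB4 2 m (vec 2 k v) (vec 2 l w))
        refine SymAlg.ext h1 h2 h3 h4 ?_
        ext i a
        rw [h5, PhiB4_v hm le_rfl]
        simp
      rw [this, zero_add]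

lemma PhiB4_mem (hm : 0 < m) : PhiB4 2 m ∈ cclassSpace 2 m 2 2 := by
  obtain ⟨h1, h2⟩ := PhiB4_bigrade hm
  refine ⟨mem_harmonic.mpr ⟨d2_PhiB4 hm, coclosed_of_forall (fun _ _ => PhiB4_negX _) ?_⟩,
    ⟨h1, h2⟩, isStronglyRegular_of_forall (fun _ _ => PhiB4_negX _) ?_, fun h => by omega⟩
  · intro k _ v A
    refine Finset.sum_eq_zero fun l _ => Finset.sum_eq_zero fun b _ => ?_
    rw [ipG_apply, PhiB4_v hm le_rfl]
    simp
  · intro k hk l hl v w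
    obtain ⟨e1, e2⟩ := components_vec_vec h1 h2 k l v w
    exact ⟨2 - k - l, mem_gr_of_lie e1 e2 (by push_cast; ring), by omega, by omega⟩

/-- If the first row of `N` is `(c, 0, …, 0)`, then `N` multiplies the cochain by `-2c`. -/
lemma glAct_PhiB4 (hm : 0 < m) {N : Matrix (Fin m) (Fin m) ℝ} {c : ℝ}
    (hN : N ⟨0, hm⟩ = Pi.single ⟨0, hm⟩ c) : glAct N (PhiB4 2 m) = (-2 * c) • PhiB4 2 m := by
  have hz : ∀ v, N.mulVec v ⟨0, hm⟩ = c * v ⟨0, hm⟩ := fun v => by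
    rw [Matrix.mulVec, hN, single_dotProduct]
  have hR : ∀ w, ⁅ofGl 2 m N, rankOne 2 hm w⁆ = rankOne 2 hm (N.mulVec w) - c • rankOne 2 hm w := by
    intro w
    have e1 : Matrix.vecMul (Pi.single ⟨0, hm⟩ 1) N = c • (Pi.single ⟨0, hm⟩ 1 : Fin m → ℝ) := by
      rw [Matrix.single_one_vecMul, Matrix.row, hN, ← Pi.single_smul, smul_eq_mul, mul_one]
    rw [rankOne, ofGl_lie_ofGl, Matrix.mul_vecMulVec, Matrix.vecMulVec_mul, e1]
    ext1 <;> simp [rankOne, ofGl]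
  refine C2_ext (fun k _ w => ?_) fun k _ l _ v w => ?_
  · rw [glAct_apply, glMinus_negX, C2_zero_left, PhiB4_negX, PhiB4_negX, smul_apply_apply,
      PhiB4_negX]
    simp
  · rw [glAct_apply, glMinus_vec, glMinus_vec, smul_apply_apply]
    simp only [PhiB4_apply hm le_rfl, lie_add, lie_sub, lie_smul, ofGl_lie_elX, ofGl_lie_elH,
      ofGl_lie_elY, hR, hz]
    module

lemma yPart_PhiB4 (hm : 0 < m) (v w : Fin m → ℝ) :
    yPart (PhiB4 2 m) v w = 1 / 2 * (v ⟨0, hm⟩ * w ⟨0, hm⟩) := by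
  rw [yPart, PhiB4_apply hm le_rfl]
  simp [kd, elX, elH, elY, rankOne, ofGl]

/-! ### Bi-grade `(1, 1)`: normalization by coboundaries -/

lemma modF_vecG (k : ℕ) (w : Fin m → ℝ) : modF (vecG n k w) = kd n k • w := by
  ext a
  change (vecG n k w).v (Fin.last n) a = _
  rw [vecG_v, Fin.val_last, Pi.smul_apply, smul_eq_mul, kd]
  split_ifs <;> simp

/-- `modF` as a linear map. -/
def modFHom (n m : ℕ) : SymAlg n m →ₗ[ℝ] (Fin m → ℝ) where
  toFun := modF
  map_add' _ _ := rfl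
  map_smul' _ _ := rfl

lemma modFHom_apply (u : SymAlg n m) : modFHom n m u = modF u := rfl

/-- A closed cochain which vanishes on `𝖷`, has values of bi-grade `(1, 1)` and vanishes on
`E_i ⊗ W, E_j ⊗ W` for `i, j ≥ 2`, `i + j = n + 1`, is determined by its value
`E_n ⊗ τ(v, w)` at `E_1 ⊗ v, E_n ⊗ w`, and `τ` is symmetric: all values follow by downward induction
from `𝖷`-equivariance, as `𝖷` is injective on `E_k ⊗ W` for `k < n`. -/
lemma normalized_cocycle (hn : 2 ≤ n) {φ : C2 n m} (hd : d2 n m φ = 0)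
    (hX : ∀ k w, φ (negX n m) (vec n k w) = 0)
    (hR : ∀ k l v w, ∃ t, φ (vec n k v) (vec n l w) = vecG n (k + l - 1) t)
    (h00 : ∀ v w, φ (vec n 0 v) (vec n 0 w) = 0)
    (h2 : ∀ i j, 2 ≤ i → 2 ≤ j → i + j = n + 1 → ∀ v w, φ (vec n i v) (vec n j w) = 0)
    {τ : (Fin m → ℝ) → (Fin m → ℝ) → (Fin m → ℝ)}
    (hτ : ∀ v w, φ (vec n 1 v) (vec n n w) = vecG n n (τ v w)) :
    (∀ v w, τ v w = τ w v) ∧ ((∀ v w, τ v w = 0) → φ = 0) := by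
  have hE : ∀ (k l : ℕ) (v w : Fin m → ℝ), ⁅elX n m, φ (vec n k v) (vec n l w)⁆ =
      φ (vec n (k + 1) v) (vec n l w) + φ (vec n k v) (vec n (l + 1) w) := fun k l v w => by
    have := cocycle_negX_vec_vec hd k l v w
    rwa [hX, hX, zero_lie, zero_lie, add_zero, sub_zero] at this
  -- A value is determined by its image under `𝖷`.
  have hinj : ∀ (k l j : ℕ) (v w t : Fin m → ℝ), k + l - 1 = j → j < n →
      ⁅elX n m, φ (vec n k v) (vec n l w)⁆ = vecG n (j + 1) t →
        φ (vec n k v) (vec n l w) = vecG n j t := by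
    intro k l j v w t hj hjn h
    obtain ⟨t', ht'⟩ := hR k l v w
    rw [ht', hj] at h ⊢
    rw [elX_lie_vecG] at h
    rw [vecG_inj (by omega) h]
  have hA : ∀ (s i j : ℕ), 2 ≤ i → 2 ≤ j → i + j + s = n + 1 →
      ∀ v w, φ (vec n i v) (vec n j w) = 0 := by
    intro s
    induction s with
    | zero => exact fun i j hi hj h => h2 i j hi hj (by omega)
    | succ s ih =>
      intro i j hi hj h v w
      rw [hinj i j (i + j - 1) v w 0 rfl (by omega) ?_, map_zero]
      rw [hE, ih (i + 1) j (by omega) hj (by omega), ih i (j + 1) hi (by omega) (by omega),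
        map_zero, add_zero]
  have hA' : ∀ i j, 2 ≤ i → 2 ≤ j → ∀ v w, φ (vec n i v) (vec n j w) = 0 := by
    intro i j hi hj v w
    rcases le_or_gt (i + j) (n + 1) with h | h
    · exact hA (n + 1 - (i + j)) i j hi hj (by omega) v w
    · obtain ⟨t, ht⟩ := hR i j v w
      rw [ht, vecG_eq_zero (by omega)]
  have hB : ∀ (s j : ℕ), 2 ≤ j → j + s = n → ∀ v w,
      φ (vec n 1 v) (vec n j w) = vecG n j (τ v w) := by
    intro s
    induction s with
    | zero => rintro j hj rfl; exact hτ
    | succ s ih =>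
      intro j hj h v w
      refine hinj 1 j j v w _ (by omega) (by omega) ?_
      rw [hE, hA' (1 + 1) j le_rfl hj, ih (j + 1) (by omega) (by omega), zero_add]
  have hC : ∀ v w, φ (vec n 1 v) (vec n 1 w) = vecG n 1 (τ v w - τ w v) := by
    intro v w
    refine hinj 1 1 1 v w _ (by omega) (by omega) ?_
    rw [hE, C2_skew φ (vec n 1 w) (vec n (1 + 1) v), hB (n - 2) (1 + 1) le_rfl (by omega),
      hB (n - 2) (1 + 1) le_rfl (by omega), map_sub]
    abel
  have hD : ∀ (s j : ℕ), 2 ≤ j → j + s = n + 1 → ∀ v w,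
      φ (vec n 0 v) (vec n j w) = vecG n (j - 1) ((s : ℝ) • τ v w) := by
    intro s
    induction s with
    | zero =>
      intro j hj h v w
      rw [vec_eq_zero (show n < j by omega), map_zero, Nat.cast_zero, zero_smul, map_zero]
    | succ s ih =>
      intro j hj h v w
      refine hinj 0 j (j - 1) v w _ (by omega) (by omega) ?_
      rw [hE, hB (n - j) j hj (by omega), ih (j + 1) (by omega) (by omega),
        show j + 1 - 1 = j by omega, show j - 1 + 1 = j by omega, ← map_add]
      congr 1
      push_cast
      module
  have hF : ∀ v w, φ (vec n 0 v) (vec n 1 w) = vecG n 0 ((n : ℝ) • τ v w - τ w v) := by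
    intro v w
    refine hinj 0 1 0 v w _ (by omega) (by omega) ?_
    rw [hE, hC, hD (n - 1) (1 + 1) le_rfl (by omega), ← map_add]
    congr 1
    rw [Nat.cast_sub (by omega : 1 ≤ n)]
    push_cast
    module
  constructor
  · intro v w
    have := hE 0 0 v w
    rw [h00, lie_zero, C2_skew φ (vec n 0 w) (vec n (0 + 1) v), hF, hF, ← map_neg, ← map_add] at this
    have h3 := vecG_inj (n := n) (Nat.zero_le n) ((map_zero _).trans this)
    have h4 : ((n : ℝ) + 1) • (τ v w - τ w v) = 0 := by rw [h3]; module
    have h5 : (n : ℝ) + 1 ≠ 0 := by positivity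
    exact sub_eq_zero.mp ((smul_eq_zero.mp h4).resolve_left h5)
  · intro h0
    have hle : ∀ i j v w, i ≤ j → j ≤ n → φ (vec n i v) (vec n j w) = 0 := by
      intro i j v w hij hj
      rcases (by omega : 2 ≤ i ∨ (i = 1 ∧ 2 ≤ j) ∨ (i = 1 ∧ j = 1) ∨ (i = 0 ∧ 2 ≤ j) ∨
        (i = 0 ∧ j = 1) ∨ (i = 0 ∧ j = 0)) with h | ⟨rfl, h⟩ | ⟨rfl, rfl⟩ | ⟨rfl, h⟩ |
          ⟨rfl, rfl⟩ | ⟨rfl, rfl⟩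
      · exact hA' i j h (by omega) v w
      · rw [hB (n - j) j h (by omega), h0, map_zero]
      · rw [hC, h0, h0, sub_zero, map_zero]
      · rw [hD (n + 1 - j) j h (by omega), h0, smul_zero, map_zero]
      · rw [hF, h0, h0, smul_zero, sub_zero, map_zero]
      · exact h00 v w
    refine C2_ext (fun k _ w => hX k w) fun i hi j hj v w => ?_
    rcases le_total i j with h | h
    · exact hle i j v w h hj
    · rw [C2_skew, hle j i w v h hi, neg_zero]; rfl

/-- The coefficient of `E_k` in the `V`-component of an element of `𝔤₋`. -/
noncomputable def row (n k : ℕ) : gMinus n m →ₗ[ℝ] (Fin m → ℝ) where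
  toFun u := if h : k < n + 1 then (u : SymAlg n m).v ⟨k, h⟩ else 0
  map_add' u w := by split_ifs <;> simp; rfl
  map_smul' c u := by split_ifs <;> simp; rfl

lemma row_negX (k : ℕ) : row n k (negX n m) = 0 := by
  change (if h : k < n + 1 then (elX n m).v ⟨k, h⟩ else 0) = _
  split_ifs <;> rfl

lemma row_vec {k : ℕ} (hk : k ≤ n) (l : ℕ) (w : Fin m → ℝ) :
    row n k (vec n l w) = kd k l • w := by
  change (if h : k < n + 1 then (vecG n l w).v ⟨k, h⟩ else 0) = _
  rw [dif_pos (by omega), vecG_v_row, kd]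
  split_ifs <;> simp

/-- `v ↦ φ(𝖷, E_0 ⊗ v)`. -/
noncomputable def negXZero (φ : C2 n m) : (Fin m → ℝ) →ₗ[ℝ] SymAlg n m :=
  φ.1 (negX n m) ∘ₗ vec n 0

lemma negXZero_apply (φ : C2 n m) (v : Fin m → ℝ) :
    negXZero φ v = φ (negX n m) (vec n 0 v) := rfl

/-- The coefficient of `𝖸` on `E_0 ⊗ W` in the normalizing 1-cochain `gauge`. It is forced by the
`𝖧`-component of `φ` at `𝖷, E_0 ⊗ v` and the `𝖷`-component at `𝖷, E_1 ⊗ v`. -/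
noncomputable def gaugeCoeff (φ : C2 n m) (a : (Fin m → ℝ) →ₗ[ℝ] ℝ) : (Fin m → ℝ) →ₗ[ℝ] ℝ where
  toFun v := (φ (negX n m) (vec n 0 v)).h - 1 / 2 * ((φ (negX n m) (vec n 1 v)).x + a v)
  map_add' v w := by simp only [map_add, SymAlg.add_h, SymAlg.add_x]; ring
  map_smul' c v := by
    simp only [map_smul, SymAlg.smul_h, SymAlg.smul_x, smul_eq_mul, RingHom.id_apply]; ring

lemma gaugeCoeff_apply (φ : C2 n m) (a : (Fin m → ℝ) →ₗ[ℝ] ℝ) (v : Fin m → ℝ) :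
    gaugeCoeff φ a v =
      (φ (negX n m) (vec n 0 v)).h - 1 / 2 * ((φ (negX n m) (vec n 1 v)).x + a v) := rfl

/-- The 1-cochain `ψ` with `ψ(E_2 ⊗ v) = a(v) 𝖷` for which `φ - ∂ψ` vanishes on `𝖷`, when `φ` has
bi-grade `(1, 1)`. -/
noncomputable def gauge (φ : C2 n m) (a : (Fin m → ℝ) →ₗ[ℝ] ℝ) : C1 n m :=
  (a ∘ₗ row n 2).smulRight (elX n m) + (gaugeCoeff φ a ∘ₗ row n 1).smulRight (elH n m)
    - negXZero φ ∘ₗ row n 1 + (gaugeCoeff φ a ∘ₗ row n 0).smulRight (elY n m)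

lemma gauge_apply (φ : C2 n m) (a : (Fin m → ℝ) →ₗ[ℝ] ℝ) (u : gMinus n m) :
    gauge φ a u = a (row n 2 u) • elX n m + gaugeCoeff φ a (row n 1 u) • elH n m
      - negXZero φ (row n 1 u) + gaugeCoeff φ a (row n 0 u) • elY n m := rfl

lemma gauge_negX (φ : C2 n m) (a : (Fin m → ℝ) →ₗ[ℝ] ℝ) : gauge φ a (negX n m) = 0 := by
  simp [gauge_apply, row_negX]

lemma gauge_vec (hn : 2 ≤ n) (φ : C2 n m) (a : (Fin m → ℝ) →ₗ[ℝ] ℝ) (k : ℕ) (w : Fin m → ℝ) :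
    gauge φ a (vec n k w) = (kd 2 k * a w) • elX n m + (kd 1 k * gaugeCoeff φ a w) • elH n m
      - kd 1 k • negXZero φ w + (kd 0 k * gaugeCoeff φ a w) • elY n m := by
  simp only [gauge_apply, row_vec hn, row_vec (show 1 ≤ n by omega), row_vec (Nat.zero_le n),
    map_smul, smul_eq_mul]

lemma gauge_add (φ φ' : C2 n m) (a a' : (Fin m → ℝ) →ₗ[ℝ] ℝ) :
    gauge (φ + φ') (a + a') = gauge φ a + gauge φ' a' := by
  ext1 u
  simp only [gauge_apply, LinearMap.add_apply, negXZero_apply, gaugeCoeff_apply, add_apply_apply,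
    SymAlg.add_h, SymAlg.add_x]
  module

lemma gauge_smul (c : ℝ) (φ : C2 n m) (a : (Fin m → ℝ) →ₗ[ℝ] ℝ) :
    gauge (c • φ) (c • a) = c • gauge φ a := by
  ext1 u
  simp only [gauge_apply, LinearMap.smul_apply, negXZero_apply, gaugeCoeff_apply, smul_apply_apply,
    SymAlg.smul_h, SymAlg.smul_x, smul_eq_mul]
  module

/-- The `E_n`-part of the value of `φ - ∂ψ` at `E_1 ⊗ v, E_n ⊗ w`, where `ψ = gauge φ a`. It
represents the cohomology class of a cocycle `φ` of bi-grade `(1, 1)`. -/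
noncomputable def classForm (φ : C2 n m) (a : (Fin m → ℝ) →ₗ[ℝ] ℝ) :
    (Fin m → ℝ) →ₗ[ℝ] (Fin m → ℝ) →ₗ[ℝ] (Fin m → ℝ) :=
  ((φ - d1 n m (gauge φ a)).1.compl₁₂ (vec n 1) (vec n n)).compr₂ (modFHom n m)

lemma classForm_apply (φ : C2 n m) (a : (Fin m → ℝ) →ₗ[ℝ] ℝ) (v w : Fin m → ℝ) :
    classForm φ a v w = modF ((φ - d1 n m (gauge φ a)) (vec n 1 v) (vec n n w)) := rfl

lemma classForm_add (φ φ' : C2 n m) (a a' : (Fin m → ℝ) →ₗ[ℝ] ℝ) (v w : Fin m → ℝ) :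
    classForm (φ + φ') (a + a') v w = classForm φ a v w + classForm φ' a' v w := by
  have : φ + φ' - d1 n m (gauge φ a + gauge φ' a') =
      (φ - d1 n m (gauge φ a)) + (φ' - d1 n m (gauge φ' a')) := by
    refine C2_ext_apply fun u w => ?_
    rw [map_add, C2_sub_apply, add_apply_apply, add_apply_apply, add_apply_apply, C2_sub_apply,
      C2_sub_apply]
    abel
  rw [classForm_apply, gauge_add, this]
  rfl

lemma classForm_smul (c : ℝ) (φ : C2 n m) (a : (Fin m → ℝ) →ₗ[ℝ] ℝ) (v w : Fin m → ℝ) :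
    classForm (c • φ) (c • a) v w = c • classForm φ a v w := by
  have : c • φ - d1 n m (c • gauge φ a) = c • (φ - d1 n m (gauge φ a)) := by
    refine C2_ext_apply fun u w => ?_
    rw [map_smul, C2_sub_apply, smul_apply_apply, smul_apply_apply, smul_apply_apply,
      C2_sub_apply, smul_sub]
  rw [classForm_apply, gauge_smul, this]
  rfl

/-- The Doubrov–Medvedev condition with `B(E_2 ⊗ v) = a(v)` on the components to which it applies;
it is void for `n = 2`. -/
def DMRel (φ : C2 n m) (a : (Fin m → ℝ) →ₗ[ℝ] ℝ) : Prop :=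
  ∀ i j, 2 ≤ i → 2 ≤ j → i + j = n + 1 → ∀ v w,
    modF (φ (vec n i v) (vec n j w)) = (kd i 2 * a v) • w - (kd j 2 * a w) • v

lemma DMRel.add {φ φ' : C2 n m} {a a' : (Fin m → ℝ) →ₗ[ℝ] ℝ} (h : DMRel φ a) (h' : DMRel φ' a') :
    DMRel (φ + φ') (a + a') := fun i j hi hj hij v w => by
  rw [add_apply_apply, ← modFHom_apply, map_add, modFHom_apply, modFHom_apply,
    h i j hi hj hij, h' i j hi hj hij, LinearMap.add_apply, LinearMap.add_apply]
  module

lemma DMRel.smul {φ : C2 n m} {a : (Fin m → ℝ) →ₗ[ℝ] ℝ} (h : DMRel φ a) (c : ℝ) :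
    DMRel (c • φ) (c • a) := fun i j hi hj hij v w => by
  rw [smul_apply_apply, ← modFHom_apply, map_smul, modFHom_apply,
    h i j hi hj hij, LinearMap.smul_apply, LinearMap.smul_apply, smul_eq_mul, smul_eq_mul]
  module

lemma vec_mem_subF {k : ℕ} (hk : k ≠ n) (w : Fin m → ℝ) : vec n k w ∈ subF n m :=
  ⟨rfl, by
    change modF (vecG n k w) = 0
    rw [modF_vecG, kd_of_ne hk.symm, zero_smul]⟩

lemma IsDM.exists_dmRel (hn : 3 ≤ n) {φ : C2 n m} (h : IsDM φ) : ∃ a, DMRel φ a := by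
  obtain ⟨B, hB⟩ := h
  refine ⟨B ∘ₗ (vec n 2).codRestrict (subF n m) (vec_mem_subF (by omega)), ?_⟩
  intro i j hi hj hij v w
  have := hB ⟨vec n i v, vec_mem_subF (by omega) v⟩ ⟨vec n j w, vec_mem_subF (by omega) w⟩
  rw [this, smul_lie, smul_lie, coe_vec, coe_vec, elX_lie_vecG, elX_lie_vecG, ← modFHom_apply,
    map_sub, map_smul, map_smul, modFHom_apply, modFHom_apply, modF_vecG, modF_vecG]
  congr 1
  · by_cases h2 : i = 2
    · subst h2
      rw [kd_self, show j + 1 = n by omega, kd_self, one_smul, one_mul]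
      rfl
    · rw [kd_of_ne h2, kd_of_ne (show n ≠ j + 1 by omega)]
      simp
  · by_cases h2 : j = 2
    · subst h2
      rw [kd_self, show i + 1 = n by omega, kd_self, one_smul, one_mul]
      rfl
    · rw [kd_of_ne h2, kd_of_ne (show n ≠ i + 1 by omega)]
      simp

lemma components_of_bigrade_one {φ : C2 n m}
    (h1 : lieAct ⟨elZ₁ n m, elZ₁_mem⟩ φ = (1 : ℝ) • φ)
    (h2 : lieAct ⟨elZ₂ n m, elZ₂_mem⟩ φ = (1 : ℝ) • φ) (k l : ℕ) (v w : Fin m → ℝ) :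
    (∃ t, φ (vec n k v) (vec n l w) = vecG n (k + l - 1) t) ∧
      (k + l = 0 → φ (vec n k v) (vec n l w) = 0) := by
  obtain ⟨e1, e2⟩ := components_vec_vec h1 h2 k l v w
  obtain ⟨c1, c2, c3, c4, c5⟩ := components_of_bigrade e1 e2
  have hv : ∀ i : Fin (n + 1), (i : ℕ) + 1 ≠ k + l → (φ (vec n k v) (vec n l w)).v i = 0 := by
    intro i hi
    ext a
    refine c5 i (Or.inr fun h => hi ?_) a
    have : (i : ℝ) + 1 = k + l := by linarith
    exact_mod_cast this
  have hz : (∀ i, (φ (vec n k v) (vec n l w)).v i = 0) → φ (vec n k v) (vec n l w) = 0 :=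
    fun h => SymAlg.ext (c1 (Or.inl (by norm_num))) (c2 (Or.inl (by norm_num)))
      (c3 (Or.inl (by norm_num))) (c4 (Or.inl (by norm_num))) (funext h)
  refine ⟨?_, fun h => hz fun i => hv i (by omega)⟩
  by_cases h : 1 ≤ k + l ∧ k + l - 1 < n + 1
  · refine ⟨(φ (vec n k v) (vec n l w)).v ⟨k + l - 1, h.2⟩, SymAlg.ext
      (c1 (Or.inl (by norm_num))) (c2 (Or.inl (by norm_num)))
      (c3 (Or.inl (by norm_num))) (c4 (Or.inl (by norm_num))) (funext fun i => ?_)⟩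
    rw [vecG_v_row]
    split_ifs with hi
    · congr 1
      exact Fin.ext hi
    · exact hv i (by omega)
  · exact ⟨0, by rw [map_zero]; exact hz fun i => hv i (by omega)⟩

/-- The cochain `φ - ∂ψ`, `ψ = gauge φ a`, satisfies the hypotheses of `normalized_cocycle`. -/
lemma classForm_spec (hn : 2 ≤ n) {φ : C2 n m} (hφ : φ ∈ cclassSpace n m 1 1)
    {a : (Fin m → ℝ) →ₗ[ℝ] ℝ} (ha : DMRel φ a) :
    (∀ v w, classForm φ a v w = classForm φ a w v) ∧
      ((∀ v w, classForm φ a v w = 0) → φ = 0) := by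
  obtain ⟨hh, ⟨h1, h2⟩, -, -⟩ := hφ
  obtain ⟨hd, hco⟩ := mem_harmonic.mp hh
  have hcomp := components_of_bigrade_one h1 h2
  set ψ := gauge φ a with hψ
  have hv0 : ∀ k w, (φ (negX n m) (vec n k w)).v = 0 := fun k w => by
    obtain ⟨e1, e2⟩ := components_negX_vec h1 h2 k w
    obtain ⟨-, -, -, -, c5⟩ := components_of_bigrade e1 e2
    ext i b
    exact c5 i (Or.inl (by norm_num)) b
  have hy0 : ∀ k w, (φ (negX n m) (vec n k w)).y = 0 := fun k w => by
    obtain ⟨e1, e2⟩ := components_negX_vec h1 h2 k w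
    obtain ⟨-, -, c3, -, -⟩ := components_of_bigrade e1 e2
    refine c3 (Or.inr fun h => ?_)
    have : (0 : ℝ) ≤ k := Nat.cast_nonneg k
    linarith
  have hx0 : ∀ k w, k ≠ 1 → (φ (negX n m) (vec n k w)).x = 0 := fun k w hk => by
    obtain ⟨e1, e2⟩ := components_negX_vec h1 h2 k w
    obtain ⟨c1, -, -, -, -⟩ := components_of_bigrade e1 e2
    refine c1 (Or.inr fun h => hk ?_)
    have : (k : ℝ) = 1 := by linarith
    exact_mod_cast this
  have hgl0 : ∀ k w, k ≠ 0 → (φ (negX n m) (vec n k w)).h = 0 ∧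
      (φ (negX n m) (vec n k w)).gl = 0 := fun k w hk => by
    obtain ⟨e1, e2⟩ := components_negX_vec h1 h2 k w
    obtain ⟨-, c2, -, c4, -⟩ := components_of_bigrade e1 e2
    refine ⟨c2 (Or.inr fun h => hk ?_), c4 (Or.inr fun h => hk ?_)⟩
    all_goals
      have : (k : ℝ) = 0 := by linarith
      exact_mod_cast this
  have hf0lie : ∀ (v : Fin m → ℝ) (l : ℕ) (w : Fin m → ℝ), ∃ t, ⁅negXZero φ v, vecG n l w⁆ = vecG n l t := fun v l w => by
    rw [lie_vecG, negXZero_apply, hx0 0 v (by norm_num), hy0]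
    exact ⟨_, by rw [zero_smul, zero_mul, zero_smul, add_zero, zero_add, ← map_smul, ← map_add]⟩
  -- Brackets with the values of `ψ`.
  have hψlie : ∀ (k l : ℕ) (v w : Fin m → ℝ), ∃ t, ⁅ψ (vec n k v), vecG n l w⁆ = vecG n (k + l - 1) t := by
    intro k l v w
    rw [hψ, gauge_vec hn]
    rcases (by omega : k = 0 ∨ k = 1 ∨ k = 2 ∨ 3 ≤ k) with rfl | rfl | rfl | hk
    · simp only [kd, add_lie, sub_lie, smul_lie, elY_lie_vecG]
      refine ⟨(gaugeCoeff φ a v * ((l : ℝ) * (n + 1 - l))) • w, ?_⟩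
      simp [mul_smul]
    · obtain ⟨t, ht⟩ := hf0lie v l w
      simp only [kd, add_lie, sub_lie, smul_lie, elH_lie_vecG, ht]
      refine ⟨(gaugeCoeff φ a v * (2 * (l : ℝ) - n)) • w - t, ?_⟩
      simp [mul_smul]
    · simp only [kd, add_lie, sub_lie, smul_lie, elX_lie_vecG]
      refine ⟨a v • w, ?_⟩
      simp [show 2 + l - 1 = l + 1 by omega]
    · rw [kd_of_ne (show 2 ≠ k by omega), kd_of_ne (show 1 ≠ k by omega),
        kd_of_ne (show 0 ≠ k by omega)]
      exact ⟨0, by simp⟩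
  set χ := φ - d1 n m ψ with hχ
  have hχd : d2 n m χ = 0 := by
    have : χ = φ + (-1 : ℝ) • d1 n m ψ := C2_ext_apply fun u w => by
      rw [hχ, C2_sub_apply, add_apply_apply, smul_apply_apply, neg_one_smul, sub_eq_add_neg]
    rw [this, map_add, map_smul, hd, d2_d1, smul_zero, add_zero]
  have hχX : ∀ k w, χ (negX n m) (vec n k w) = 0 := by
    intro k w
    rw [hχ, C2_sub_apply, d1_negX_vec _ (gauge_negX φ a), gauge_vec hn, gauge_vec hn]
    rcases (by omega : k = 0 ∨ k = 1 ∨ 2 ≤ k) with rfl | rfl | hk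
    · simp [kd, elX_lie_elY, negXZero_apply]
    · have e1 : ⁅elX n m, negXZero φ w⁆ = (-2 * (φ (negX n m) (vec n 0 w)).h) • elX n m := by
        rw [negXZero_apply, ← lie_skew, lie_elX _ (hv0 0 w), hy0]
        module
      have e2 : φ (negX n m) (vec n 1 w) = (φ (negX n m) (vec n 1 w)).x • elX n m := by
        obtain ⟨g1, g2⟩ := hgl0 1 w (by norm_num)
        refine SymAlg.ext ?_ ?_ ?_ ?_ ?_
        · simp [elX]
        · simp [elX, g1]
        · simp [elX, hy0]
        · simp [elX, g2]
        · simp [elX, hv0]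
      rw [e2]
      simp only [kd, lie_add, lie_sub, lie_smul, elX_lie_elH, e1, gaugeCoeff_apply]
      simp
      module
    · rw [kd_of_ne (show 1 ≠ k by omega), kd_of_ne (show 0 ≠ k by omega),
        kd_of_ne (show 2 ≠ k + 1 by omega), kd_of_ne (show 1 ≠ k + 1 by omega),
        kd_of_ne (show 0 ≠ k + 1 by omega)]
      have e2 : φ (negX n m) (vec n k w) = 0 := by
        obtain ⟨g1, g2⟩ := hgl0 k w (by omega)
        exact SymAlg.ext (hx0 k w (by omega)) g1 (hy0 k w) g2 (hv0 k w)
      simp [e2]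
  have hχR : ∀ k l v w, ∃ t, χ (vec n k v) (vec n l w) = vecG n (k + l - 1) t := by
    intro k l v w
    obtain ⟨t1, ht1⟩ := (hcomp k l v w).1
    obtain ⟨t2, ht2⟩ := hψlie k l v w
    obtain ⟨t3, ht3⟩ := hψlie l k w v
    refine ⟨t1 - (t2 - t3), ?_⟩
    rw [hχ, C2_sub_apply, d1_vec_vec, ht1, ht2, ht3, add_comm l k, map_sub, map_sub]
  have hχ0 : ∀ v w, χ (vec n 0 v) (vec n 0 w) = 0 := by
    intro v w
    rw [hχ, C2_sub_apply, d1_vec_vec, (hcomp 0 0 v w).2 rfl, hψ, gauge_vec hn, gauge_vec hn]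
    simp [kd, elY_lie_vecG]
  have hχ2 : ∀ i j, 2 ≤ i → 2 ≤ j → i + j = n + 1 →
      ∀ v w, χ (vec n i v) (vec n j w) = 0 := by
    intro i j hi hj hij v w
    obtain ⟨t, ht⟩ := hχR i j v w
    have e1 : modF (χ (vec n i v) (vec n j w)) = t := by
      rw [ht, modF_vecG, show i + j - 1 = n by omega, kd_self, one_smul]
    have e2 : ∀ i j, 2 ≤ i → i + j = n + 1 → ∀ v w : Fin m → ℝ,
        modF ⁅ψ (vec n i v), vecG n j w⁆ = (kd i 2 * a v) • w := by
      intro i j hi hij v w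
      rw [hψ, gauge_vec hn, kd_of_ne (show 1 ≠ i by omega), kd_of_ne (show 0 ≠ i by omega)]
      simp only [zero_mul, zero_smul, add_zero, sub_zero, smul_lie, elX_lie_vecG]
      rw [← modFHom_apply, map_smul, modFHom_apply, modF_vecG, smul_smul]
      congr 1
      by_cases h : i = 2
      · rw [h, show j + 1 = n by omega, kd_self, kd_self, mul_one]
      · rw [kd_of_ne h, kd_of_ne (Ne.symm h)]; ring
    rw [hχ, C2_sub_apply, d1_vec_vec, ← modFHom_apply, map_sub, map_sub, modFHom_apply,
      modFHom_apply, modFHom_apply, ha i j hi hj hij, e2 i j hi hij,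
      e2 j i hj (by omega), sub_self] at e1
    rw [ht, ← e1, map_zero]
  have hχτ : ∀ v w, χ (vec n 1 v) (vec n n w) = vecG n n (classForm φ a v w) := by
    intro v w
    obtain ⟨t, ht⟩ := hχR 1 n v w
    rw [classForm_apply, ← hψ, ← hχ, ht, modF_vecG, show 1 + n - 1 = n by omega, kd_self, one_smul]
  obtain ⟨hs, hz⟩ := normalized_cocycle hn hχd hχX hχR hχ0 hχ2 hχτ
  refine ⟨hs, fun h => ?_⟩
  have h3 : φ = d1 n m ψ := C2_ext_apply fun u w => by
    have := C2_sub_apply φ (d1 n m ψ) u w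
    rw [← hχ, hz h, C2_zero_apply] at this
    exact (sub_eq_zero.mp this.symm)
  rw [h3] at hco ⊢
  exact exact_eq_zero hco

/-! ### Bi-grade `(1, 1)`: class forms of lowest weight vectors -/

lemma modF_ofGl_lie (N : Matrix (Fin m) (Fin m) ℝ) (u : SymAlg n m) :
    modF ⁅ofGl n m N, u⁆ = N.mulVec (modF u) := by
  ext a
  change (⁅ofGl n m N, u⁆ : SymAlg n m).v (Fin.last n) a = _
  simp [ofGl, SymAlg.actV, SymAlg.sl, modF, Matrix.mulVec, dotProduct, Matrix.mul_apply, mul_comm]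

lemma glAct_eq_zero_apply {N : Matrix (Fin m) (Fin m) ℝ} {φ : C2 n m} (h : glAct N φ = 0)
    (u w : gMinus n m) :
    ⁅ofGl n m N, φ u w⁆ = φ (glMinus N u) w + φ u (glMinus N w) := by
  have := glAct_apply N φ u w
  rw [h, C2_zero_apply] at this
  rw [← sub_eq_zero, ← sub_sub]
  exact this.symm

lemma gauge_equivariant (hn : 2 ≤ n) {N : Matrix (Fin m) (Fin m) ℝ} {φ : C2 n m}
    (h : glAct N φ = 0) {a : (Fin m → ℝ) →ₗ[ℝ] ℝ} (ha : ∀ v, a (N.mulVec v) = 0) (k : ℕ)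
    (w : Fin m → ℝ) :
    ⁅ofGl n m N, gauge φ a (vec n k w)⁆ = gauge φ a (vec n k (N.mulVec w)) := by
  have hφ : ∀ k w, φ (negX n m) (vec n k (N.mulVec w)) =
      ⁅ofGl n m N, φ (negX n m) (vec n k w)⁆ := fun k w => by
    rw [glAct_eq_zero_apply h, glMinus_negX, C2_zero_left, zero_add, glMinus_vec]
  have h1 : gaugeCoeff φ a (N.mulVec w) = 0 := by
    rw [gaugeCoeff_apply, hφ, hφ, ha]
    simp [ofGl]
  rw [gauge_vec hn, gauge_vec hn, h1, ha, negXZero_apply, negXZero_apply, hφ]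
  simp only [lie_add, lie_sub, lie_smul, ofGl_lie_elX, ofGl_lie_elH, ofGl_lie_elY]
  simp

lemma classForm_equivariant (hn : 2 ≤ n) {N : Matrix (Fin m) (Fin m) ℝ} {φ : C2 n m}
    (h : glAct N φ = 0) {a : (Fin m → ℝ) →ₗ[ℝ] ℝ} (ha : ∀ v, a (N.mulVec v) = 0)
    (v w : Fin m → ℝ) :
    N.mulVec (classForm φ a v w) = classForm φ a (N.mulVec v) w + classForm φ a v (N.mulVec w) := by
  simp only [classForm_apply, C2_sub_apply, d1_vec_vec, ← modF_ofGl_lie, lie_sub,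
    leibniz_lie (ofGl n m N), glAct_eq_zero_apply h, gauge_equivariant hn h ha, ofGl_lie_vecG,
    glMinus_vec]
  simp only [← modFHom_apply, ← map_add]
  congr 1
  abel

/-- The linear form in the Doubrov–Medvedev condition is determined by `φ`, and hence it is
annihilated by all elements of `𝔤𝔩(W)` which annihilate `φ`. -/
lemma DMRel.lower_eq_zero (hn : 3 ≤ n) (hm : 2 ≤ m) {N : Matrix (Fin m) (Fin m) ℝ} {φ : C2 n m}
    (h : glAct N φ = 0) {a : (Fin m → ℝ) →ₗ[ℝ] ℝ} (ha : DMRel φ a) (v : Fin m → ℝ) :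
    a (N.mulVec v) = 0 := by
  have key : ∀ v w, a (N.mulVec v) • w = kd (n - 1) 2 • a (N.mulVec w) • v := by
    intro v w
    have hd := ha 2 (n - 1) le_rfl (by omega) (by omega)
    have h1 := congrArg modF (glAct_eq_zero_apply h (vec n 2 v) (vec n (n - 1) w))
    rw [modF_ofGl_lie, ← modFHom_apply (_ + _), map_add, modFHom_apply, modFHom_apply, glMinus_vec,
      glMinus_vec, hd, hd, hd, kd_self, Matrix.mulVec_sub, Matrix.mulVec_smul,
      Matrix.mulVec_smul] at h1
    rw [← sub_eq_zero] at h1 ⊢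
    rw [← neg_eq_zero, ← h1]
    module
  by_cases h3 : n - 1 = 2
  · refine eq_zero_of_smul_comm hm (f := fun v => a (N.mulVec v)) (fun u v => ?_) v
    have := key u v
    rwa [h3, kd_self, one_smul] at this
  · have := congrFun (key v (Pi.single ⟨0, by omega⟩ 1)) ⟨0, by omega⟩
    rw [kd_of_ne h3, zero_smul] at this
    simpa using this

lemma classForm_zero_left (hn : 2 ≤ n) (a : (Fin m → ℝ) →ₗ[ℝ] ℝ) (v w : Fin m → ℝ) :
    classForm (0 : C2 n m) a v w = (n / 2 * a v) • w + (kd 2 n * a w) • v := by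
  have h0 : ∀ v, gaugeCoeff (0 : C2 n m) a v = -(1 / 2) * a v := fun v => by
    rw [gaugeCoeff_apply, C2_zero_apply, C2_zero_apply]
    simp
  rw [classForm_apply, C2_sub_apply, C2_zero_apply, d1_vec_vec, gauge_vec hn, gauge_vec hn, h0, h0,
    negXZero_apply, negXZero_apply, C2_zero_apply, C2_zero_apply, kd_of_ne (show 2 ≠ 1 by norm_num),
    kd_self, kd_of_ne (show 0 ≠ 1 by norm_num), kd_of_ne (show 1 ≠ n by omega),
    kd_of_ne (show 0 ≠ n by omega)]
  simp only [zero_mul, zero_smul, smul_zero, one_mul, add_zero, zero_add, sub_zero, zero_sub,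
    smul_lie, elH_lie_vecG, elX_lie_vecG, ← modFHom_apply, map_neg, map_sub, map_smul]
  simp only [modFHom_apply, modF_vecG, kd_self]
  by_cases h : n = 2
  · subst h
    rw [kd_self]
    push_cast
    module
  · rw [kd_of_ne (show 2 ≠ n by omega)]
    module

/-- A symmetric `W`-valued form on `W` which is annihilated by all strictly lower triangular
matrices lies in the span of `w^1 ⊙ id` and `(w^1)² ⊗ w_m`. -/
lemma form_lowest (hm : 2 ≤ m) {κ : (Fin m → ℝ) →ₗ[ℝ] (Fin m → ℝ) →ₗ[ℝ] (Fin m → ℝ)}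
    (hs : ∀ v w, κ v w = κ w v)
    (hN : ∀ N : Matrix (Fin m) (Fin m) ℝ, (∀ a b, a ≤ b → N a b = 0) →
      ∀ v w, N.mulVec (κ v w) = κ (N.mulVec v) w + κ v (N.mulVec w)) :
    ∃ t s : ℝ, ∀ v w, κ v w = t • (v ⟨0, by omega⟩ • w + w ⟨0, by omega⟩ • v) +
      (s * (v ⟨0, by omega⟩ * w ⟨0, by omega⟩)) • Pi.single ⟨m - 1, by omega⟩ 1 := by
  set z : Fin m := ⟨0, by omega⟩ with hz'
  set l : Fin m := ⟨m - 1, by omega⟩ with hl'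
  have hz : ∀ a, a ≠ z → z < a := fun a ha => lt_of_le_of_ne (Nat.zero_le _) ha.symm
  have hl : ∀ a, a ≠ l → a < l := fun a ha =>
    lt_of_le_of_ne (Nat.le_sub_one_of_lt a.2) ha
  have hzl : l ≠ z := by
    rw [Ne, Fin.ext_iff]
    simp only [hz', hl']
    omega
  have hE : ∀ (a b : Fin m) (u : Fin m → ℝ),
      (Matrix.single a b (1 : ℝ)).mulVec u = u b • Pi.single a 1 := fun a b u => by
    ext c
    simp [Matrix.mulVec, dotProduct, Matrix.single_apply, Pi.single_apply, eq_comm, ite_and]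
  have key : ∀ a b, b < a → ∀ v w, (κ v w b) • (Pi.single a 1 : Fin m → ℝ) =
      v b • κ (Pi.single a 1) w + w b • κ v (Pi.single a 1) := by
    intro a b hab v w
    have := hN _ (single_lower hab) v w
    rwa [hE, hE, hE, map_smul, map_smul, LinearMap.smul_apply] at this
  set t := 1 / 2 * κ (Pi.single z 1) (Pi.single z 1) z with ht
  set s := κ (Pi.single z 1) (Pi.single z 1) l with hs'
  -- The invariance under `e_a^1`, `a > 1`, gives all values from the one at `w_1, w_1`; the
  -- invariance under `e_m^b`, `1 < b < m`, restricts the latter to the span of `w_1` and `w_m`.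
  have h1 : ∀ a, a ≠ z → κ (Pi.single a 1) (Pi.single z 1) = t • Pi.single a 1 := by
    intro a ha
    have := key a z (hz a ha) (Pi.single z 1) (Pi.single z 1)
    rw [Pi.single_eq_same, one_smul, hs (Pi.single z 1) (Pi.single a 1)] at this
    rw [ht, mul_smul, this]
    module
  have h2 : ∀ a c, a ≠ z → c ≠ z → κ (Pi.single a 1) (Pi.single c 1) = 0 := by
    intro a c ha hc
    have := key a z (hz a ha) (Pi.single z 1) (Pi.single c 1)
    rw [hs (Pi.single z 1) (Pi.single c 1), h1 c hc, Pi.single_eq_same, one_smul, Pi.smul_apply,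
      Pi.single_eq_of_ne (Ne.symm hc), smul_zero, zero_smul, zero_smul, add_zero] at this
    exact this.symm
  have h3 : κ (Pi.single z 1) (Pi.single z 1) = (2 * t) • Pi.single z 1 + s • Pi.single l 1 := by
    ext b
    by_cases hbz : b = z
    · subst hbz
      simp [ht, Pi.single_eq_of_ne (Ne.symm hzl)]
    · by_cases hbl : b = l
      · subst hbl
        simp [hs', Pi.single_eq_of_ne hzl]
      · have := congrFun (key l b (hl b hbl) (Pi.single z 1) (Pi.single z 1)) l
        simpa [Pi.single_eq_of_ne hbz, Pi.single_eq_of_ne hbl] using this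
  refine ⟨t, s, fun v w => ?_⟩
  have hlin : κ = t • ((LinearMap.lsmul ℝ (Fin m → ℝ)).compl₁₂ (LinearMap.proj z)
      LinearMap.id + ((LinearMap.lsmul ℝ (Fin m → ℝ)).compl₁₂ (LinearMap.proj z)
      LinearMap.id).flip) + ((LinearMap.mul ℝ ℝ).compl₁₂ (LinearMap.proj z)
        (LinearMap.proj z)).compr₂ (LinearMap.toSpanSingleton ℝ _ (s • Pi.single l 1)) := by
    refine LinearMap.pi_ext' fun a => LinearMap.ext_ring (LinearMap.pi_ext' fun c =>
      LinearMap.ext_ring ?_)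
    change κ (Pi.single a 1) (Pi.single c 1) = t • ((Pi.single a 1 : Fin m → ℝ) z •
      (Pi.single c 1 : Fin m → ℝ) + (Pi.single c 1 : Fin m → ℝ) z • (Pi.single a 1 : Fin m → ℝ)) +
      ((Pi.single a 1 : Fin m → ℝ) z * (Pi.single c 1 : Fin m → ℝ) z) • s •
        (Pi.single l 1 : Fin m → ℝ)
    by_cases ha : a = z
    · by_cases hc : c = z
      · rw [ha, hc, h3, Pi.single_eq_same]
        module
      · rw [hs, ha, h1 c hc, Pi.single_eq_same, Pi.single_eq_of_ne (Ne.symm hc)]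
        module
    · by_cases hc : c = z
      · rw [hc, h1 a ha, Pi.single_eq_same, Pi.single_eq_of_ne (Ne.symm ha)]
        module
      · rw [h2 a c ha hc, Pi.single_eq_of_ne (Ne.symm ha), Pi.single_eq_of_ne (Ne.symm hc)]
        module
  refine (congrArg (fun F => F v w) hlin).trans ?_
  change t • (v z • w + w z • v) + (v z * w z) • s • Pi.single l 1 = _
  module

/-- The class form of a lowest weight vector, for a choice of `a` which is annihilated by the
lowering operators. -/
lemma exists_classForm_lowest (hn : 2 ≤ n) (hm : 2 ≤ m) {φ : C2 n m}
    (hφ : φ ∈ cclassSpace n m 1 1)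
    (hlow : ∀ N : Matrix (Fin m) (Fin m) ℝ, (∀ a b, a ≤ b → N a b = 0) → glAct N φ = 0) :
    ∃ a, DMRel φ a ∧ ∃ t s : ℝ, ∀ v w, classForm φ a v w =
      t • (v ⟨0, by omega⟩ • w + w ⟨0, by omega⟩ • v) +
        (s * (v ⟨0, by omega⟩ * w ⟨0, by omega⟩)) • Pi.single ⟨m - 1, by omega⟩ 1 := by
  have key : ∀ a, DMRel φ a → (∀ N : Matrix (Fin m) (Fin m) ℝ, (∀ a b, a ≤ b → N a b = 0) →
      ∀ v, a (N.mulVec v) = 0) → _ := fun a ha haN =>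
    form_lowest hm (classForm_spec hn hφ ha).1 fun N hN v w =>
      classForm_equivariant hn (hlow N hN) (haN N hN) v w
  by_cases h2 : n = 2
  · have ha : DMRel φ 0 := fun i j hi hj hij => by omega
    exact ⟨0, ha, key 0 ha fun _ _ _ => rfl⟩
  · obtain ⟨a, ha⟩ := (hφ.2.2.2 (by omega)).exists_dmRel (by omega)
    exact ⟨a, ha, key a ha fun N hN => ha.lower_eq_zero (by omega) hm (hlow N hN)⟩

/-! ### Cochains of bi-grade `(1, 1)` which vanish on `𝖷` -/

/-- The cochain `φ` vanishes on `𝖷` and maps `E_k ⊗ v, E_l ⊗ w` to `E_{k+l-1} ⊗ T k l v w`; moreover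
it is `𝖷`-equivariant, and for `k, l ≥ 2` the values of `T` are those prescribed by the
Doubrov–Medvedev condition with `B(E_2 ⊗ v) = a(v)`. -/
structure IsNormalForm (φ : C2 n m)
    (T : ℕ → ℕ → (Fin m → ℝ) → (Fin m → ℝ) → (Fin m → ℝ)) (a : (Fin m → ℝ) →ₗ[ℝ] ℝ) : Prop where
  negX_apply : ∀ w, φ (negX n m) w = 0
  vec_apply : ∀ k l v w, φ (vec n k v) (vec n l w) = vecG n (k + l - 1) (T k l v w)
  step : ∀ k l v w, T k l v w = T (k + 1) l v w + T k (l + 1) v w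
  zero_zero : ∀ v w, T 0 0 v w = 0
  dm : ∀ k l, 2 ≤ k → 2 ≤ l → ∀ v w, T k l v w = (kd k 2 * a v) • w - (kd l 2 * a w) • v

/-- The squared length `k! / (n - k)!` of `E_k ⊗ w_b`. -/
noncomputable def lenN (n k : ℕ) : ℝ := (k.factorial : ℝ) / ((n - k).factorial : ℝ)

lemma lenN_pos (n k : ℕ) : 0 < lenN n k := by unfold lenN; positivity

lemma lenN_succ {k : ℕ} (hk : k < n) : lenN n (k + 1) = ((k : ℝ) + 1) * (n - k) * lenN n k := by
  obtain ⟨d, rfl⟩ := Nat.exists_eq_add_of_lt hk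
  rw [lenN, lenN, show k + d + 1 - (k + 1) = d by omega, show k + d + 1 - k = d + 1 by omega,
    Nat.factorial_succ, Nat.factorial_succ]
  have : (d.factorial : ℝ) ≠ 0 := by positivity
  push_cast
  have h2 : (d : ℝ) + 1 ≠ 0 := by positivity
  field_simp
  ring

lemma ipG_vecG_self {k : ℕ} (hk : k ≤ n) (t w : Fin m → ℝ) :
    ipG n m (vecG n k t) (vecG n k w) = lenN n k * (t ⬝ᵥ w) := by
  have : ∑ i : Fin (n + 1), ∑ b, lenV n i * ((vecG n k t).v i b * (vecG n k w).v i b) =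
      lenN n k * (t ⬝ᵥ w) := by
    rw [Finset.sum_eq_single ⟨k, by omega⟩]
    · simp [vecG_v, dotProduct, Finset.mul_sum, lenV, lenN]
    · intro i _ hi
      have : (i : ℕ) ≠ k := fun h => hi (Fin.ext h)
      simp [vecG_v, this]
    · simp
  rw [ipG_apply, this]
  simp [vecG]

lemma ipG_vecG_of_ne {k l : ℕ} (h : k ≠ l) (t w : Fin m → ℝ) :
    ipG n m (vecG n k t) (vecG n l w) = 0 := by
  have : ∑ i : Fin (n + 1), ∑ b, lenV n i * ((vecG n k t).v i b * (vecG n l w).v i b) = 0 := by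
    refine Finset.sum_eq_zero fun i _ => Finset.sum_eq_zero fun b _ => ?_
    by_cases h1 : (i : ℕ) = k
    · simp [vecG_v, h1, h]
    · simp [vecG_v, h1]
  rw [ipG_apply, this]
  simp [vecG]

namespace IsNormalForm

variable {φ : C2 n m} {T : ℕ → ℕ → (Fin m → ℝ) → (Fin m → ℝ) → (Fin m → ℝ)}
  {a : (Fin m → ℝ) →ₗ[ℝ] ℝ}

lemma closed (h : IsNormalForm φ T a) : d2 n m φ = 0 := by
  refine d2_eq_zero (fun k w => h.negX_apply _) ?_ ?_
  · intro k _ l _ v w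
    rw [h.vec_apply, h.vec_apply, h.vec_apply, elX_lie_vecG]
    rcases Nat.eq_zero_or_pos (k + l) with h0 | h0
    · obtain ⟨rfl, rfl⟩ : k = 0 ∧ l = 0 := by omega
      rw [h.zero_zero, map_zero, show 0 + 1 + 0 - 1 = 0 + (0 + 1) - 1 by rfl, ← map_add,
        ← h.step, h.zero_zero, map_zero]
    · rw [show k + 1 + l - 1 = k + l - 1 + 1 by omega, show k + (l + 1) - 1 = k + l - 1 + 1 by omega,
        ← map_add, ← h.step]
  · intro i _ j _ k _ u v w
    simp only [h.vec_apply, vecG_lie_vecG, add_zero]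

/-- Coclosedness amounts to the vanishing of four sums: it is tested on cochains with values in
`𝖷`, `𝖧`, `𝔤𝔩(W)` and `𝖸`. -/
lemma coclosed (h : IsNormalForm φ T a)
    (hX : ∀ v, ∑ l ∈ Finset.range (n + 1), ((l : ℝ) + 1) * (n - l) *
      ∑ b, T 2 l v (Pi.single b 1) b = 0)
    (hH : ∀ v, ∑ l ∈ Finset.range (n + 1), (2 * (l : ℝ) - n) * ∑ b, T 1 l v (Pi.single b 1) b = 0)
    (hgl : ∀ v w, ∑ l ∈ Finset.range (n + 1), T 1 l v w = 0)
    (hY : ∀ v, ∑ l ∈ Finset.range (n + 1), ∑ b, T 0 l v (Pi.single b 1) b = 0) (ψ : C1 n m) :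
    ip2 n m φ (d1 n m ψ) = 0 := by
  refine coclosed_of_forall (fun k w => h.negX_apply _) (fun k hk v A => ?_) ψ
  have hlen : ∀ l : Fin (n + 1), lenV n l = lenN n l := fun l => rfl
  have hred : ∀ g : ℕ → ℝ, (∀ l ≤ n, ∑ b, (lenN n l)⁻¹ * ipG n m (φ (vec n k v)
      (vec n l (Pi.single b 1))) ⁅A, vecG n l (Pi.single b 1)⁆ = g l) →
      ∑ l ∈ Finset.range (n + 1), g l = 0 → ∑ l : Fin (n + 1), ∑ b : Fin m,
      (lenV n l)⁻¹ * ipG n m (φ (vec n k v) (vec n l (Pi.single b 1)))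
        ⁅A, vecG n l (Pi.single b 1)⁆ = 0 := by
    intro g hg h0
    rw [← h0, ← Fin.sum_univ_eq_sum_range]
    exact Finset.sum_congr rfl fun l _ => (hg l (by omega))
  have hdot : ∀ (t : Fin m → ℝ) (b : Fin m), t ⬝ᵥ Pi.single b 1 = t b := fun t b => by simp
  rcases (by omega : k = 0 ∨ k = 1 ∨ k = 2 ∨ 3 ≤ k) with rfl | rfl | rfl | hk
  · refine hred (fun l => A.y * ∑ b, T 0 l v (Pi.single b 1) b) (fun l hl => ?_)
      (by rw [← Finset.mul_sum, hY, mul_zero])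
    rw [Finset.mul_sum]
    refine Finset.sum_congr rfl fun b _ => ?_
    rw [h.vec_apply, lie_vecG]
    rcases Nat.eq_zero_or_pos l with rfl | h0
    · rw [h.zero_zero]; simp
    · obtain ⟨l, rfl⟩ := Nat.exists_eq_add_of_lt h0
      have e1 := lenN_succ (show l < n by omega)
      have e2 := (lenN_pos n l).ne'
      have e3 := (lenN_pos n (l + 1)).ne'
      simp only [map_add, map_smul, smul_eq_mul, show 0 + l + 1 = l + 1 by omega,
        show 0 + (l + 1) - 1 = l by omega, show l + 1 - 1 = l by omega]
      rw [ipG_vecG_of_ne (show l ≠ l + 1 + 1 by omega), ipG_vecG_of_ne (show l ≠ l + 1 by omega),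
        ipG_vecG_of_ne (show l ≠ l + 1 by omega), ipG_vecG_self (show l ≤ n by omega), hdot]
      push_cast
      field_simp
      rw [e1]
      ring
  · refine hred (fun l => A.h * ((2 * (l : ℝ) - n) * ∑ b, T 1 l v (Pi.single b 1) b) +
      ∑ b, T 1 l v (Pi.single b 1) ⬝ᵥ A.gl.mulVec (Pi.single b 1)) (fun l hl => ?_) ?_
    · rw [Finset.mul_sum, Finset.mul_sum, ← Finset.sum_add_distrib]
      refine Finset.sum_congr rfl fun b _ => ?_
      have e3 := (lenN_pos n l).ne'
      rw [h.vec_apply, lie_vecG, show 1 + l - 1 = l by omega]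
      simp only [map_add, map_smul, smul_eq_mul]
      rw [ipG_vecG_of_ne (show l ≠ l + 1 by omega), ipG_vecG_self hl, ipG_vecG_self hl, hdot]
      rcases Nat.eq_zero_or_pos l with rfl | h0
      · field_simp
        push_cast
        ring
      · rw [ipG_vecG_of_ne (show l ≠ l - 1 by omega)]
        field_simp
        ring
    · rw [Finset.sum_add_distrib, ← Finset.mul_sum, hH, Finset.sum_comm]
      simp only [← sum_dotProduct, hgl, zero_dotProduct]
      simp
  · refine hred (fun l => A.x * (((l : ℝ) + 1) * (n - l) * ∑ b, T 2 l v (Pi.single b 1) b))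
      (fun l hl => ?_) (by rw [← Finset.mul_sum, hX, mul_zero])
    rw [Finset.mul_sum, Finset.mul_sum]
    refine Finset.sum_congr rfl fun b _ => ?_
    rw [h.vec_apply, lie_vecG, show 2 + l - 1 = l + 1 by omega]
    rcases hl.eq_or_lt with rfl | hl
    · rw [vecG_eq_zero (show l < l + 1 by omega)]; simp
    · have e1 := lenN_succ hl
      have e3 := (lenN_pos n l).ne'
      simp only [map_add, map_smul, smul_eq_mul]
      rw [ipG_vecG_of_ne (show l + 1 ≠ l by omega), ipG_vecG_of_ne (show l + 1 ≠ l by omega),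
        ipG_vecG_of_ne (show l + 1 ≠ l - 1 by omega), ipG_vecG_self hl, hdot, e1]
      field_simp
      ring
  · refine hred (fun _ => 0) (fun l hl => Finset.sum_eq_zero fun b _ => ?_) (by simp)
    rw [h.vec_apply, lie_vecG]
    simp only [map_add, map_smul, smul_eq_mul]
    rw [ipG_vecG_of_ne (by omega), ipG_vecG_of_ne (by omega), ipG_vecG_of_ne (by omega),
      ipG_vecG_of_ne (by omega)]
    simp

lemma bigrade (h : IsNormalForm φ T a) :
    lieAct ⟨elZ₁ n m, elZ₁_mem⟩ φ = (1 : ℝ) • φ ∧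
      lieAct ⟨elZ₂ n m, elZ₂_mem⟩ φ = (1 : ℝ) • φ := by
  constructor
  · refine C2_ext (fun k hk w => ?_) fun k hk l hl v w => ?_
    · rw [lieAct_elZ₁_negX_vec, smul_apply_apply, h.negX_apply]
      simp
    · rw [lieAct_elZ₁_vec_vec, smul_apply_apply, h.vec_apply, elZ₁_lie_vecG]
      rcases Nat.eq_zero_or_pos (k + l) with h0 | h0
      · obtain ⟨rfl, rfl⟩ : k = 0 ∧ l = 0 := by omega
        rw [h.zero_zero]
        simp
      · rw [Nat.cast_sub h0]
        push_cast
        module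
  · refine C2_ext (fun k hk w => ?_) fun k hk l hl v w => ?_
    · rw [lieAct_elZ₂_negX_vec, smul_apply_apply, h.negX_apply]
      simp
    · rw [lieAct_elZ₂_vec_vec, smul_apply_apply, h.vec_apply, elZ₂_lie_vecG]
      module

lemma isStronglyRegular (h : IsNormalForm φ T a) : IsStronglyRegular φ := by
  refine isStronglyRegular_of_forall (fun k w => h.negX_apply _) fun k _ l _ v w => ?_
  obtain ⟨e1, e2⟩ := components_vec_vec h.bigrade.1 h.bigrade.2 k l v w
  by_cases h3 : 3 ≤ k ∧ 3 ≤ l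
  · refine ⟨0, ?_, by omega, by omega⟩
    rw [h.vec_apply, h.dm k l (by omega) (by omega), kd_of_ne (by omega), kd_of_ne (by omega)]
    simp
  · exact ⟨-(k + l), mem_gr_of_lie e1 e2 (by push_cast; ring), by omega, by omega⟩

lemma dmRel (h : IsNormalForm φ T a) : DMRel φ a := fun i j hi hj hij v w => by
  rw [h.vec_apply, modF_vecG, show i + j - 1 = n by omega, kd_self, one_smul, h.dm i j hi hj]

lemma isDM (hn : 2 ≤ n) (h : IsNormalForm φ T a) : IsDM φ := by
  refine ⟨a ∘ₗ row n 2 ∘ₗ (subF n m).subtype, fun u w => ?_⟩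
  have hrow : ∀ u : subF n m, (u : gMinus n m) =
      ∑ k : Fin (n + 1), vec n k ((u : SymAlg n m).v k) := fun u => by
    conv_lhs => rw [gMinus_eq_sum u.1]
    rw [u.2.1, zero_smul, zero_add]
  have hval : ∀ k l v w, k < n → l < n → modF (φ (vec n k v) (vec n l w)) =
      modF ((kd 2 k * a v) • ⁅elX n m, vecG n l w⁆ - (kd 2 l * a w) • ⁅elX n m, vecG n k v⁆) := by
    intro k l v w hk hl
    rw [elX_lie_vecG, elX_lie_vecG, h.vec_apply, ← modFHom_apply (_ - _), map_sub, map_smul,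
      map_smul, modFHom_apply, modFHom_apply, modF_vecG, modF_vecG, modF_vecG]
    by_cases hkl : n = k + l - 1
    · rw [← hkl, kd_self, h.dm k l (by omega) (by omega), one_smul]
      congr 1
      · by_cases h2 : k = 2
        · rw [h2, show l + 1 = n by omega, kd_self, kd_self, one_smul]
        · rw [kd_of_ne h2, kd_of_ne (Ne.symm h2)]
          simp
      · by_cases h2 : l = 2
        · rw [h2, show k + 1 = n by omega, kd_self, kd_self, one_smul]
        · rw [kd_of_ne h2, kd_of_ne (Ne.symm h2)]
          simp
    · rw [kd_of_ne hkl]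
      have e1 : kd 2 k * kd n (l + 1) = 0 := by
        by_cases h2 : k = 2
        · rw [kd_of_ne (show n ≠ l + 1 by omega), mul_zero]
        · rw [kd_of_ne (Ne.symm h2), zero_mul]
      have e2 : kd 2 l * kd n (k + 1) = 0 := by
        by_cases h2 : l = 2
        · rw [kd_of_ne (show n ≠ k + 1 by omega), mul_zero]
        · rw [kd_of_ne (Ne.symm h2), zero_mul]
      rw [smul_smul, smul_smul, mul_right_comm, e1, mul_right_comm, e2]
      simp
  set ψ : C1 n m := (a ∘ₗ row n 2).smulRight (elX n m) with hψ
  have hψ' : ∀ u, ψ u = a (row n 2 u) • elX n m := fun u => rfl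
  set χ := φ - d1 n m ψ with hχ
  have hχ0 : modF (χ u w) = 0 := by
    have hsum : ∀ f : Fin (n + 1) → gMinus n m, χ (∑ k, f k) = ∑ k, χ (f k) :=
      fun f => map_sum χ.1 f _
    rw [hrow u, hrow w, hsum, LinearMap.sum_apply, ← modFHom_apply, map_sum]
    refine Finset.sum_eq_zero fun k _ => ?_
    rw [map_sum, map_sum]
    refine Finset.sum_eq_zero fun l _ => ?_
    by_cases hk : k = Fin.last n
    · rw [hk, u.2.2, map_zero, C2_zero_left, map_zero]
    by_cases hl : l = Fin.last n
    · rw [hl, w.2.2, map_zero, map_zero, map_zero]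
    have hk' : (k : ℕ) < n := Fin.val_lt_last hk
    have hl' : (l : ℕ) < n := Fin.val_lt_last hl
    rw [hχ, C2_sub_apply, map_sub, modFHom_apply, hval k l _ _ hk' hl', d1_vec_vec, hψ', hψ',
      row_vec hn, row_vec hn, map_smul, map_smul, smul_lie, smul_lie, smul_eq_mul, smul_eq_mul,
      modFHom_apply, sub_self]
  have huw : ⁅(u : gMinus n m), (w : gMinus n m)⁆ = 0 := by
    rw [hrow u, hrow w, sum_lie]
    refine Finset.sum_eq_zero fun k _ => ?_
    rw [lie_sum]
    exact Finset.sum_eq_zero fun l _ => vec_lie_vec _ _ _ _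
  rw [hχ, C2_sub_apply, d1_apply, huw, map_zero, sub_zero, ← modFHom_apply, map_sub,
    sub_eq_zero, modFHom_apply, modFHom_apply, ← lie_skew, ← lie_skew (w.1 : SymAlg n m)] at hχ0
  rw [hχ0]
  congr 1
  rw [hψ', hψ']
  change _ = ⁅a (row n 2 u.1) • elX n m, (w.1 : SymAlg n m)⁆ -
      ⁅a (row n 2 w.1) • elX n m, (u.1 : SymAlg n m)⁆
  abel

lemma mem_cclassSpace (hn : 2 ≤ n) (h : IsNormalForm φ T a)
    (hco : ∀ ψ, ip2 n m φ (d1 n m ψ) = 0) : φ ∈ cclassSpace n m 1 1 :=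
  ⟨mem_harmonic.mpr ⟨h.closed, hco⟩, h.bigrade, h.isStronglyRegular, fun _ => h.isDM hn⟩

lemma negXZero_eq_zero (h : IsNormalForm φ T a) (v : Fin m → ℝ) : negXZero φ v = 0 :=
  h.negX_apply _

/-- The gauge of `φ` does not depend on `φ`, which vanishes on `𝖷`. -/
lemma classForm_apply (hn : 2 ≤ n) (h : IsNormalForm φ T a) (b : (Fin m → ℝ) →ₗ[ℝ] ℝ)
    (v w : Fin m → ℝ) :
    classForm φ b v w = T 1 n v w + ((n / 2 * b v) • w + (kd 2 n * b w) • v) := by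
  have h0 : ∀ v, gaugeCoeff φ b v = gaugeCoeff (0 : C2 n m) b v := fun v => by
    rw [gaugeCoeff_apply, gaugeCoeff_apply, h.negX_apply, h.negX_apply, C2_zero_apply,
      C2_zero_apply]
  have hg : gauge φ b = gauge (0 : C2 n m) b := LinearMap.ext fun u => by
    rw [gauge_apply, gauge_apply, h0, h0, h.negXZero_eq_zero, negXZero_apply, C2_zero_apply]
  rw [← classForm_zero_left hn, CClass.classForm_apply, CClass.classForm_apply, hg, C2_sub_apply,
    C2_sub_apply, h.vec_apply, C2_zero_apply, ← modFHom_apply, map_sub, ← modFHom_apply (_ - _),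
    map_sub, map_zero, modFHom_apply, modF_vecG, show 1 + n - 1 = n by omega, kd_self, one_smul]
  abel

end IsNormalForm

/-! ### The lowest weight vectors of `𝔸₂^tr` and `𝔸₂^tf` -/

/-- The map `w ↦ E_{k+l-1} ⊗ w`, which is zero for `k = l = 0`. -/
noncomputable def predVec (n k l : ℕ) : (Fin m → ℝ) →ₗ[ℝ] SymAlg n m :=
  if k + l = 0 then 0 else vecG n (k + l - 1)

lemma elV_eq {k l i j : ℕ} (b : Fin m) :
    (kd k i * kd l j) • elV n m ((i : ℤ) + j - 1) (b + 1) =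
      (kd k i * kd l j) • predVec n k l (Pi.single b 1) := by
  by_cases hk : k = i
  swap
  · simp [kd_of_ne hk]
  by_cases hl : l = j
  swap
  · simp [kd_of_ne hl]
  subst hk hl
  congr 1
  rw [predVec]
  ext1
  all_goals split_ifs with h
  all_goals first | rfl | skip
  · ext r c
    simp only [elV, Matrix.of_apply, LinearMap.zero_apply, SymAlg.zero_v, Matrix.zero_apply]
    rw [if_neg]
    omega
  · ext r c
    rw [vecG_v]
    simp only [elV, Matrix.of_apply, Pi.single_apply, Fin.ext_iff]
    by_cases h1 : ((r : ℕ) : ℤ) = k + l - 1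
    · have h2 : (r : ℕ) = k + l - 1 := by omega
      by_cases h3 : (c : ℕ) = b
      · rw [if_pos ⟨h1, by omega⟩, if_pos h2, if_pos h3]
      · simp [h3]
    · have h2 : (r : ℕ) ≠ k + l - 1 := by omega
      simp [h1, h2]

lemma phiTr_apply (hm : 0 < m) {i j : ℕ} (hi : i ≤ n) (hj : j ≤ n) (k l : ℕ) (v w : Fin m → ℝ) :
    phiTr n m i j (vec n k v) (vec n l w) = (kd k i * kd l j * v ⟨0, hm⟩) • predVec n k l w
      - (kd l i * kd k j * w ⟨0, hm⟩) • predVec n k l v := by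
  have hsum : ∀ w : Fin m → ℝ, predVec n k l w = ∑ b, w b • predVec n k l (Pi.single b 1) := by
    intro w
    conv_lhs => rw [← Finset.univ_sum_single w, map_sum]
    refine Finset.sum_congr rfl fun b _ => ?_
    rw [← map_smul, ← Pi.single_smul, smul_eq_mul, mul_one]
  have hsymm : predVec (m := m) n k l = predVec n l k := by rw [predVec, predVec, add_comm]
  rw [phiTr, sum_Icc_eq_sum_fin, C2_sum_apply, hsum w, hsum v, Finset.smul_sum, Finset.smul_sum,
    ← Finset.sum_sub_distrib]
  refine Finset.sum_congr rfl fun b _ => ?_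
  rw [wedge_apply, dualV_one_vec hm hi, dualV_one_vec hm hi, dualV_vec hj, dualV_vec hj, sub_smul]
  have e1 := congrArg (fun x => (v ⟨0, hm⟩ * w b) • x) (elV_eq (n := n) (k := k) (l := l)
    (i := i) (j := j) b)
  have e2 := congrArg (fun x => (w ⟨0, hm⟩ * v b) • x) (elV_eq (n := n) (k := l) (l := k)
    (i := i) (j := j) b)
  rw [← hsymm] at e2
  simp only [smul_smul] at e1 e2 ⊢
  congr 1
  · rw [show kd k i * v ⟨0, hm⟩ * (kd l j * w b) = v ⟨0, hm⟩ * w b * (kd k i * kd l j) by ring, e1]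
    congr 1
    ring
  · rw [show kd k j * v b * (kd l i * w ⟨0, hm⟩) = w ⟨0, hm⟩ * v b * (kd l i * kd k j) by ring, e2]
    congr 1
    ring

lemma phiTf_apply (hm : 0 < m) {i j : ℕ} (hi : i ≤ n) (hj : j ≤ n) (k l : ℕ) (v w : Fin m → ℝ) :
    phiTf n m i j (vec n k v) (vec n l w) = ((kd k i * kd l j - kd l i * kd k j) *
      (v ⟨0, hm⟩ * w ⟨0, hm⟩)) • predVec n k l (Pi.single ⟨m - 1, by omega⟩ 1) := by
  have hsymm : predVec (m := m) n k l = predVec n l k := by rw [predVec, predVec, add_comm]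
  have e1 := congrArg (fun x => (v ⟨0, hm⟩ * w ⟨0, hm⟩) • x) (elV_eq (n := n) (k := k) (l := l)
    (i := i) (j := j) ⟨m - 1, Nat.sub_one_lt_of_lt hm⟩)
  have e2 := congrArg (fun x => (v ⟨0, hm⟩ * w ⟨0, hm⟩) • x) (elV_eq (n := n) (k := l) (l := k)
    (i := i) (j := j) ⟨m - 1, Nat.sub_one_lt_of_lt hm⟩)
  simp only [Nat.sub_add_cancel hm] at e1 e2
  rw [← hsymm] at e2
  rw [phiTf, wedge_apply, dualV_one_vec hm hi, dualV_one_vec hm hi, dualV_one_vec hm hj,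
    dualV_one_vec hm hj]
  simp only [smul_smul] at e1 e2
  rw [show kd k i * v ⟨0, hm⟩ * (kd l j * w ⟨0, hm⟩) - kd k j * v ⟨0, hm⟩ * (kd l i * w ⟨0, hm⟩) =
    v ⟨0, hm⟩ * w ⟨0, hm⟩ * (kd k i * kd l j) - v ⟨0, hm⟩ * w ⟨0, hm⟩ * (kd l i * kd k j) by ring,
    sub_smul, e1, e2, ← sub_smul]
  congr 1
  ring

/-- The coefficient of `w^1(v) E_{k+l-1} ⊗ w` in the value of `PhiA2tr n m α β` at
`E_k ⊗ v, E_l ⊗ w`. -/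
noncomputable def trCoeff (n : ℕ) (α β : ℝ) (k l : ℕ) : ℝ :=
  α * (kd k 2 + ((n : ℝ) / 2 - l) * kd k 1 - 1 / 2 * (l : ℝ) * (n + 1 - l) * kd k 0)
    + β * (((n : ℝ) + 1 - k) * kd l 0 - ((n : ℝ) + 1 - l) * kd k 0 + kd l 1 - kd k 1)

/-- `(w^1(v) w^1(w)) E_{k+l-1} ⊗ w_m` has the coefficient `tfCoeff n k l - tfCoeff n l k` in the
value of `PhiA2tf n m` at `E_k ⊗ v, E_l ⊗ w`. -/
noncomputable def tfCoeff (n : ℕ) (k l : ℕ) : ℝ := ((n : ℝ) + 1 - l) * kd k 0 + kd k 1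

lemma kd_succ_succ (k l : ℕ) : kd (k + 1) (l + 1) = kd k l := by
  unfold kd
  congr 1
  simp

lemma kd_succ_zero (k : ℕ) : kd (k + 1) 0 = 0 := kd_of_ne (by omega)

lemma trCoeff_step (α β : ℝ) (k l : ℕ) :
    trCoeff n α β k l = trCoeff n α β (k + 1) l + trCoeff n α β k (l + 1) := by
  simp only [trCoeff, kd_succ_zero, show kd (k + 1) 1 = kd k 0 from kd_succ_succ k 0,
    show kd (k + 1) 2 = kd k 1 from kd_succ_succ k 1, show kd (l + 1) 1 = kd l 0 from kd_succ_succ l 0]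
  push_cast
  ring

lemma trCoeff_zero_zero (α β : ℝ) : trCoeff n α β 0 0 = 0 := by
  simp [trCoeff, kd]

lemma tfCoeff_step (k l : ℕ) :
    tfCoeff n k l = tfCoeff n (k + 1) l + tfCoeff n k (l + 1) := by
  simp only [tfCoeff, kd_succ_zero, show kd (k + 1) 1 = kd k 0 from kd_succ_succ k 0]
  push_cast
  ring

/-- The form `T` of `IsNormalForm` for `PhiA2tr n m α β`. -/
noncomputable def trForm (n : ℕ) (hm : 0 < m) (α β : ℝ) (k l : ℕ) (v w : Fin m → ℝ) : Fin m → ℝ :=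
  (trCoeff n α β k l * v ⟨0, hm⟩) • w - (trCoeff n α β l k * w ⟨0, hm⟩) • v

/-- The form `T` of `IsNormalForm` for `PhiA2tf n m`. -/
noncomputable def tfForm (n : ℕ) (hm : 0 < m) (k l : ℕ) (v w : Fin m → ℝ) : Fin m → ℝ :=
  ((tfCoeff n k l - tfCoeff n l k) * (v ⟨0, hm⟩ * w ⟨0, hm⟩)) •
    Pi.single ⟨m - 1, Nat.sub_one_lt_of_lt hm⟩ 1

lemma predVec_eq_vecG {k l : ℕ} {t : Fin m → ℝ} (h : k + l = 0 → t = 0) :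
    predVec n k l t = vecG n (k + l - 1) t := by
  rw [predVec]
  split_ifs with h0
  · rw [h h0, map_zero, map_zero]
  · rfl

/-- The values of a cochain at `E_k ⊗ v, E_l ⊗ w` need to be checked only for `k, l ≤ n`: otherwise
both sides vanish, where `E_{k+l-1} = 0` except for `{k, l} = {0, n + 1}`. -/
lemma vec_apply_of_le {φ : C2 n m} {T : ℕ → ℕ → (Fin m → ℝ) → (Fin m → ℝ) → (Fin m → ℝ)}
    (h0 : ∀ v w, T 0 (n + 1) v w = 0 ∧ T (n + 1) 0 v w = 0)
    (h : ∀ k ≤ n, ∀ l ≤ n, ∀ v w, φ (vec n k v) (vec n l w) = vecG n (k + l - 1) (T k l v w))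
    (k l : ℕ) (v w : Fin m → ℝ) : φ (vec n k v) (vec n l w) = vecG n (k + l - 1) (T k l v w) := by
  have hz : (n < k ∨ n < l) → vecG n (k + l - 1) (T k l v w) = 0 := by
    intro hkl
    by_cases h1 : n < k + l - 1
    · exact vecG_eq_zero h1 _
    · rcases (by omega : (k = n + 1 ∧ l = 0) ∨ (k = 0 ∧ l = n + 1)) with ⟨rfl, rfl⟩ | ⟨rfl, rfl⟩
      · rw [(h0 v w).2, map_zero]
      · rw [(h0 v w).1, map_zero]
  by_cases hk : n < k
  · rw [vec_eq_zero hk, C2_zero_left, hz (Or.inl hk)]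
  by_cases hl : n < l
  · rw [vec_eq_zero hl, map_zero, hz (Or.inr hl)]
  exact h k (by omega) l (by omega) v w

lemma phiTr_negX (i j : ℕ) (w : gMinus n m) : phiTr n m i j (negX n m) w = 0 := by
  simp only [phiTr, C2_sum_apply, wedge_negX, Finset.sum_const_zero]

lemma isNormalForm_PhiA2tr (hn : 2 ≤ n) (hm : 0 < m) (α β : ℝ) :
    IsNormalForm (PhiA2tr n m α β) (trForm n hm α β) (α • LinearMap.proj ⟨0, hm⟩) where
  negX_apply w := by
    simp only [PhiA2tr, add_apply_apply, C2_sub_apply, smul_apply_apply, C2_sum_apply, phiTr_negX,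
      smul_zero, sub_zero, add_zero, Finset.sum_const_zero]
  vec_apply := by
    refine vec_apply_of_le (fun v w => ?_) fun k hk l hl v w => ?_
    · have e1 : trCoeff n α β 0 (n + 1) = 0 := by
        simp [trCoeff, kd, show n ≠ 0 by omega]
      have e2 : trCoeff n α β (n + 1) 0 = 0 := by
        simp [trCoeff, kd, show n ≠ 0 by omega, show n ≠ 1 by omega]
      simp [trForm, e1, e2]
    · have h1 : 1 ≤ n := by omega
      have h0 : 0 ≤ n := by omega
      have key : PhiA2tr n m α β (vec n k v) (vec n l w) =
          (trCoeff n α β k l * v ⟨0, hm⟩) • predVec n k l w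
            - (trCoeff n α β l k * w ⟨0, hm⟩) • predVec n k l v := by
        have e1 : ∀ k l, l ≤ n → ∑ i ∈ Finset.range (n + 1), (kd k 2 + ((n : ℝ) / 2 - i) * kd k 1
            - 1 / 2 * (i : ℝ) * (n + 1 - i) * kd k 0) * kd l i =
            kd k 2 + ((n : ℝ) / 2 - l) * kd k 1 - 1 / 2 * (l : ℝ) * (n + 1 - l) * kd k 0 :=
          fun k l hl => sum_range_mul_kd hl fun i : ℕ => kd k 2 + ((n : ℝ) / 2 - i) * kd k 1
            - 1 / 2 * (i : ℝ) * (n + 1 - i) * kd k 0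
        have e2 : ∀ k l, l ≤ n → ∑ i ∈ Finset.range (n + 1), (((n : ℝ) + 1 - i) * kd k 0 + kd k 1) *
            kd l i = ((n : ℝ) + 1 - l) * kd k 0 + kd k 1 :=
          fun k l hl => sum_range_mul_kd hl fun i : ℕ => ((n : ℝ) + 1 - i) * kd k 0 + kd k 1
        simp only [PhiA2tr, add_apply_apply, smul_apply_apply, C2_sum_apply, C2_sub_apply]
        have e3 : ∀ i ∈ Finset.range (n + 1), phiTr n m 2 i (vec n k v) (vec n l w)
            + ((n : ℝ) / 2 - i) • phiTr n m 1 i (vec n k v) (vec n l w)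
            - (1 / 2 * (i : ℝ) * (n + 1 - i)) • phiTr n m 0 i (vec n k v) (vec n l w) =
            ((kd k 2 + ((n : ℝ) / 2 - i) * kd k 1 - 1 / 2 * (i : ℝ) * (n + 1 - i) * kd k 0) * kd l i)
              • v ⟨0, hm⟩ • predVec n k l w
            - ((kd l 2 + ((n : ℝ) / 2 - i) * kd l 1 - 1 / 2 * (i : ℝ) * (n + 1 - i) * kd l 0) *
              kd k i) • w ⟨0, hm⟩ • predVec n k l v := fun i hi => by
          have hi' : i ≤ n := by have := Finset.mem_range.mp hi; omega
          rw [phiTr_apply hm hn hi', phiTr_apply hm h1 hi', phiTr_apply hm h0 hi']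
          module
        have e4 : ∀ i ∈ Finset.range (n + 1), ((n : ℝ) + 1 - i) •
              (phiTr n m i 0 (vec n k v) (vec n l w) - phiTr n m 0 i (vec n k v) (vec n l w))
            + phiTr n m i 1 (vec n k v) (vec n l w) - phiTr n m 1 i (vec n k v) (vec n l w) =
            (((((n : ℝ) + 1 - i) * kd l 0 + kd l 1) * kd k i) • v ⟨0, hm⟩ • predVec n k l w
            - ((((n : ℝ) + 1 - i) * kd k 0 + kd k 1) * kd l i) • v ⟨0, hm⟩ • predVec n k l w)
            - (((((n : ℝ) + 1 - i) * kd k 0 + kd k 1) * kd l i) • w ⟨0, hm⟩ • predVec n k l v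
            - ((((n : ℝ) + 1 - i) * kd l 0 + kd l 1) * kd k i) • w ⟨0, hm⟩ • predVec n k l v) :=
          fun i hi => by
          have hi' : i ≤ n := by have := Finset.mem_range.mp hi; omega
          rw [phiTr_apply hm hi' h0, phiTr_apply hm h0 hi', phiTr_apply hm hi' h1,
            phiTr_apply hm h1 hi']
          module
        rw [Finset.sum_congr rfl e3, Finset.sum_congr rfl e4]
        simp only [Finset.sum_sub_distrib, ← Finset.sum_smul, e1 k l hl, e1 l k hk, e2 k l hl,
          e2 l k hk, trCoeff]
        module
      rw [key, ← map_smul, ← map_smul, ← map_sub, predVec_eq_vecG]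
      · rfl
      · intro h
        obtain ⟨rfl, rfl⟩ : k = 0 ∧ l = 0 := by omega
        rw [trCoeff_zero_zero]
        simp
  step k l v w := by
    rw [trForm, trForm, trForm, trCoeff_step α β k l, trCoeff_step α β l k]
    module
  zero_zero v w := by
    rw [trForm, trCoeff_zero_zero]
    simp
  dm k l hk hl v w := by
    simp only [trForm, trCoeff, kd_of_ne (show k ≠ 1 by omega), kd_of_ne (show k ≠ 0 by omega),
      kd_of_ne (show l ≠ 1 by omega), kd_of_ne (show l ≠ 0 by omega), LinearMap.smul_apply,
      LinearMap.proj_apply, smul_eq_mul]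
    module

lemma isNormalForm_PhiA2tf (hn : 2 ≤ n) (hm : 0 < m) :
    IsNormalForm (PhiA2tf n m) (tfForm n hm) 0 where
  negX_apply w := by
    simp only [PhiA2tf, add_apply_apply, smul_apply_apply, C2_sum_apply, phiTf, wedge_negX,
      smul_zero, add_zero, Finset.sum_const_zero]
  vec_apply := by
    refine vec_apply_of_le (fun v w => ?_) fun k hk l hl v w => ?_
    · have e1 : tfCoeff n 0 (n + 1) = 0 := by
        simp [tfCoeff, kd]
      have e2 : tfCoeff n (n + 1) 0 = 0 := by
        simp [tfCoeff, kd, show n ≠ 0 by omega]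
      simp [tfForm, e1, e2]
    · have h1 : 1 ≤ n := by omega
      have h0 : 0 ≤ n := by omega
      have key : PhiA2tf n m (vec n k v) (vec n l w) =
          ((tfCoeff n k l - tfCoeff n l k) * (v ⟨0, hm⟩ * w ⟨0, hm⟩)) •
            predVec n k l (Pi.single ⟨m - 1, Nat.sub_one_lt_of_lt hm⟩ 1) := by
        have e2 : ∀ k l, l ≤ n → ∑ i ∈ Finset.range (n + 1), (((n : ℝ) + 1 - i) * kd k 0 + kd k 1) *
            kd l i = ((n : ℝ) + 1 - l) * kd k 0 + kd k 1 :=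
          fun k l hl => sum_range_mul_kd hl fun i : ℕ => ((n : ℝ) + 1 - i) * kd k 0 + kd k 1
        simp only [PhiA2tf, add_apply_apply, smul_apply_apply, C2_sum_apply]
        have e3 : ∀ i ∈ Finset.range (n + 1), ((n : ℝ) + 1 - i) •
              phiTf n m 0 i (vec n k v) (vec n l w) + phiTf n m 1 i (vec n k v) (vec n l w) =
            ((((n : ℝ) + 1 - i) * kd k 0 + kd k 1) * kd l i - (((n : ℝ) + 1 - i) * kd l 0 + kd l 1) *
              kd k i) • (v ⟨0, hm⟩ * w ⟨0, hm⟩) •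
                predVec n k l (Pi.single ⟨m - 1, Nat.sub_one_lt_of_lt hm⟩ 1) := fun i hi => by
          have hi' : i ≤ n := by have := Finset.mem_range.mp hi; omega
          rw [phiTf_apply hm h0 hi', phiTf_apply hm h1 hi']
          module
        rw [Finset.sum_congr rfl e3, ← Finset.sum_smul, Finset.sum_sub_distrib, e2 k l hl,
          e2 l k hk, tfCoeff, tfCoeff]
        module
      rw [key, ← map_smul, predVec_eq_vecG]
      · rfl
      · intro h
        obtain ⟨rfl, rfl⟩ : k = 0 ∧ l = 0 := by omega
        simp
  step k l v w := by
    rw [tfForm, tfForm, tfForm, tfCoeff_step k l, tfCoeff_step l k]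
    module
  zero_zero v w := by simp [tfForm]
  dm k l hk hl v w := by
    simp only [tfForm, tfCoeff, kd_of_ne (show k ≠ 1 by omega), kd_of_ne (show k ≠ 0 by omega),
      kd_of_ne (show l ≠ 1 by omega), kd_of_ne (show l ≠ 0 by omega)]
    simp

/-- The sum of a quadratic polynomial with correction terms at `0`, `1` and `2`. -/
lemma sum_range_quad (hn : 2 ≤ n) (a b c : ℝ) (f₀ f₁ f₂ : ℕ → ℝ) :
    ∑ l ∈ Finset.range (n + 1), (a + b * l + c * (l : ℝ) ^ 2 + f₀ l * kd l 0 + f₁ l * kd l 1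
      + f₂ l * kd l 2) = (n + 1) * a + b * (n * (n + 1) / 2) + c * (n * (n + 1) * (2 * n + 1) / 6)
        + f₀ 0 + f₁ 1 + f₂ 2 := by
  have hk : ∀ i j, kd i j = kd j i := fun i j => by simp only [kd, eq_comm]
  have h1 : ∀ n : ℕ, ∑ l ∈ Finset.range (n + 1), (a + b * l + c * (l : ℝ) ^ 2) =
      (n + 1) * a + b * (n * (n + 1) / 2) + c * (n * (n + 1) * (2 * n + 1) / 6) := by
    intro n
    induction n with
    | zero => simp
    | succ n ih =>
      rw [Finset.sum_range_succ, ih]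
      push_cast
      ring
  rw [Finset.sum_add_distrib, Finset.sum_add_distrib, Finset.sum_add_distrib, h1]
  simp only [fun l => hk l 0, fun l => hk l 1, fun l => hk l 2]
  rw [sum_range_mul_kd (Nat.zero_le n), sum_range_mul_kd (show 1 ≤ n by omega), sum_range_mul_kd hn]

lemma trace_trForm (hm : 0 < m) (α β : ℝ) (k l : ℕ) (v : Fin m → ℝ) :
    ∑ b, trForm n hm α β k l v (Pi.single b 1) b =
      (m * trCoeff n α β k l - trCoeff n α β l k) * v ⟨0, hm⟩ := by
  simp only [trForm, Pi.sub_apply, Pi.smul_apply, smul_eq_mul, Pi.single_eq_same, mul_one,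
    Finset.sum_sub_distrib, Finset.sum_const, Finset.card_univ, Fintype.card_fin, nsmul_eq_mul]
  rw [Finset.sum_eq_single ⟨0, hm⟩ (fun b _ hb => by
    rw [Pi.single_eq_of_ne (Ne.symm hb), mul_zero, zero_mul]) (by simp), Pi.single_eq_same]
  ring

lemma trace_tfForm (hm : 2 ≤ m) (k l : ℕ) (v : Fin m → ℝ) :
    ∑ b, tfForm n (show 0 < m by omega) k l v (Pi.single b 1) b = 0 := by
  refine Finset.sum_eq_zero fun b _ => ?_
  rw [tfForm, Pi.smul_apply, smul_eq_mul]
  by_cases hb : b = ⟨0, by omega⟩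
  · have hb' : b ≠ ⟨m - 1, by omega⟩ := by
      rw [hb, Ne, Fin.ext_iff]
      simp only
      omega
    rw [Pi.single_eq_of_ne hb', mul_zero]
  · rw [Pi.single_eq_of_ne (Ne.symm hb)]
    ring

/-- The conditions of `IsNormalForm.coclosed` for `𝖷`, `𝖧` and `𝖸` are all multiples of the relation
between `α` and `β`, and the one for `𝔤𝔩(W)` holds for all `α, β`. -/
lemma PhiA2tr_mem (hn : 2 ≤ n) (hm : 0 < m) {α β : ℝ}
    (h : α * (m * n * (n + 1) + 6) = -6 * ((n : ℝ) - 1) * (m + 1) * β) :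
    PhiA2tr n m α β ∈ cclassSpace n m 1 1 := by
  have hN := isNormalForm_PhiA2tr hn hm α β
  refine hN.mem_cclassSpace hn (hN.coclosed (fun v => ?_) (fun v => ?_) (fun v w => ?_)
    fun v => ?_)
  · simp only [trace_trForm, ← mul_assoc, ← Finset.sum_mul]
    refine mul_eq_zero_of_left ?_ _
    rw [Finset.sum_congr rfl fun (l : ℕ) _ => show ((l : ℝ) + 1) * (n - l) *
        (m * trCoeff n α β 2 l - trCoeff n α β l 2) =
        m * α * n + m * α * (n - 1) * l + -(m * α) * (l : ℝ) ^ 2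
        + (fun l : ℕ => ((l : ℝ) + 1) * (n - l) * (m * β * (n - 1) + (α + β) * (n - 1))) l * kd l 0
        + (fun l : ℕ => ((l : ℝ) + 1) * (n - l) * (m * β - α * (n / 2 - 2) + β)) l * kd l 1
        + (fun l : ℕ => ((l : ℝ) + 1) * (n - l) * (-α)) l * kd l 2 by
      simp only [trCoeff, kd_self, kd_of_ne (show 2 ≠ 1 by norm_num),
        kd_of_ne (show 2 ≠ 0 by norm_num)]
      push_cast
      ring, sum_range_quad hn]
    push_cast
    linear_combination ((n : ℝ) + 2) / 6 * h
  · simp only [trace_trForm, ← mul_assoc, ← Finset.sum_mul]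
    refine mul_eq_zero_of_left ?_ _
    rw [Finset.sum_congr rfl fun (l : ℕ) _ => show (2 * (l : ℝ) - n) *
        (m * trCoeff n α β 1 l - trCoeff n α β l 1) =
        (-n * (m * α * n / 2 - m * β - β)) + (2 * (m * α * n / 2 - m * β - β) + n * m * α) * l
          + (-2 * m * α) * (l : ℝ) ^ 2
        + (fun l : ℕ => (2 * (l : ℝ) - n) * (m * β * n + α * n / 2 + β * n)) l * kd l 0
        + (fun l : ℕ => (2 * (l : ℝ) - n) * (m * β - α * (n / 2 - 1) + β)) l * kd l 1
        + (fun l : ℕ => (2 * (l : ℝ) - n) * (-α)) l * kd l 2 by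
      simp only [trCoeff, kd_self, kd_of_ne (show 1 ≠ 2 by norm_num),
        kd_of_ne (show 1 ≠ 0 by norm_num)]
      push_cast
      ring, sum_range_quad hn]
    push_cast
    linear_combination -((n : ℝ) + 2) / 6 * h
  · have e1 : ∑ l ∈ Finset.range (n + 1), trCoeff n α β 1 l = 0 := by
      rw [Finset.sum_congr rfl fun (l : ℕ) _ => show trCoeff n α β 1 l =
          (α * n / 2 - β) + (-α) * l + 0 * (l : ℝ) ^ 2
          + (fun l : ℕ => β * n) l * kd l 0 + (fun l : ℕ => β) l * kd l 1
          + (fun l : ℕ => 0) l * kd l 2 by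
        simp only [trCoeff, kd_self, kd_of_ne (show 1 ≠ 2 by norm_num),
          kd_of_ne (show 1 ≠ 0 by norm_num)]
        push_cast
        ring, sum_range_quad hn]
      ring
    have e2 : ∑ l ∈ Finset.range (n + 1), trCoeff n α β l 1 = 0 := by
      rw [Finset.sum_congr rfl fun (l : ℕ) _ => show trCoeff n α β l 1 =
          β + 0 * l + 0 * (l : ℝ) ^ 2
          + (fun l : ℕ => -(α * n / 2) - β * n) l * kd l 0
          + (fun l : ℕ => α * (n / 2 - 1) - β) l * kd l 1
          + (fun l : ℕ => α) l * kd l 2 by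
        simp only [trCoeff, kd_self, kd_of_ne (show 1 ≠ 0 by norm_num)]
        push_cast
        ring, sum_range_quad hn]
      ring
    simp only [trForm, Finset.sum_sub_distrib, ← Finset.sum_smul, ← Finset.sum_mul, e1, e2]
    simp
  · simp only [trace_trForm, ← Finset.sum_mul]
    refine mul_eq_zero_of_left ?_ _
    rw [Finset.sum_congr rfl fun (l : ℕ) _ => show
        (m * trCoeff n α β 0 l - trCoeff n α β l 0) =
        (-m * β * (n + 1) - β * (n + 1)) + (-m * α * (n + 1) / 2 + m * β + β) * l
          + (m * α / 2) * (l : ℝ) ^ 2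
        + (fun l : ℕ => m * β * (n + 1) + β * (n + 1)) l * kd l 0
        + (fun l : ℕ => m * β - α * n / 2 + β) l * kd l 1
        + (fun l : ℕ => (-α)) l * kd l 2 by
      simp only [trCoeff, kd_self, kd_of_ne (show 0 ≠ 2 by norm_num),
        kd_of_ne (show 0 ≠ 1 by norm_num)]
      push_cast
      ring, sum_range_quad hn]
    linear_combination -((n : ℝ) + 2) / 12 * h

lemma PhiA2tf_mem (hn : 2 ≤ n) (hm : 2 ≤ m) : PhiA2tf n m ∈ cclassSpace n m 1 1 := by
  have hN := isNormalForm_PhiA2tf hn (show 0 < m by omega)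
  refine hN.mem_cclassSpace hn (hN.coclosed (fun v => ?_) (fun v => ?_) (fun v w => ?_)
    fun v => ?_)
  · simp only [trace_tfForm hm, mul_zero, Finset.sum_const_zero]
  · simp only [trace_tfForm hm, mul_zero, Finset.sum_const_zero]
  · have e1 : ∑ l ∈ Finset.range (n + 1), (tfCoeff n 1 l - tfCoeff n l 1) = 0 := by
      rw [Finset.sum_congr rfl fun (l : ℕ) _ => show tfCoeff n 1 l - tfCoeff n l 1 =
          1 + 0 * l + 0 * (l : ℝ) ^ 2
          + (fun l : ℕ => -(n : ℝ)) l * kd l 0 + (fun l : ℕ => -1) l * kd l 1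
          + (fun l : ℕ => 0) l * kd l 2 by
        simp only [tfCoeff, kd_self, kd_of_ne (show 1 ≠ 0 by norm_num)]
        push_cast
        ring, sum_range_quad hn]
      ring
    simp only [tfForm, ← Finset.sum_smul, ← Finset.sum_mul, e1]
    simp
  · simp only [trace_tfForm hm, Finset.sum_const_zero]

/-! ### Weights of the explicit cochains -/

lemma IsNormalForm.glAct_eq_smul {φ : C2 n m}
    {T : ℕ → ℕ → (Fin m → ℝ) → (Fin m → ℝ) → (Fin m → ℝ)} {a : (Fin m → ℝ) →ₗ[ℝ] ℝ}
    (h : IsNormalForm φ T a) {N : Matrix (Fin m) (Fin m) ℝ} {c : ℝ}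
    (hT : ∀ k l v w, N.mulVec (T k l v w) - T k l (N.mulVec v) w - T k l v (N.mulVec w) =
      c • T k l v w) : glAct N φ = c • φ := by
  refine C2_ext (fun k _ w => ?_) fun k _ l _ v w => ?_
  · rw [glAct_apply, glMinus_negX, C2_zero_left, h.negX_apply, h.negX_apply, smul_apply_apply,
      h.negX_apply]
    simp
  · rw [glAct_apply, glMinus_vec, glMinus_vec, smul_apply_apply, h.vec_apply, h.vec_apply,
      h.vec_apply, ofGl_lie_vecG, ← map_sub, ← map_sub, hT, map_smul]

lemma glAct_PhiA2tr (hn : 2 ≤ n) (hm : 0 < m) (α β : ℝ) {N : Matrix (Fin m) (Fin m) ℝ} {c : ℝ}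
    (hN : N ⟨0, hm⟩ = Pi.single ⟨0, hm⟩ c) :
    glAct N (PhiA2tr n m α β) = (-c) • PhiA2tr n m α β := by
  have hz : ∀ v, N.mulVec v ⟨0, hm⟩ = c * v ⟨0, hm⟩ := fun v => by
    rw [Matrix.mulVec, hN, single_dotProduct]
  refine (isNormalForm_PhiA2tr hn hm α β).glAct_eq_smul fun k l v w => ?_
  simp only [trForm, Matrix.mulVec_sub, Matrix.mulVec_smul, hz]
  module

lemma glAct_PhiA2tf (hn : 2 ≤ n) (hm : 0 < m) {N : Matrix (Fin m) (Fin m) ℝ} {c c' : ℝ}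
    (hN : N ⟨0, hm⟩ = Pi.single ⟨0, hm⟩ c)
    (hN' : N.mulVec (Pi.single ⟨m - 1, Nat.sub_one_lt_of_lt hm⟩ 1) =
      c' • Pi.single ⟨m - 1, Nat.sub_one_lt_of_lt hm⟩ 1) :
    glAct N (PhiA2tf n m) = (c' - 2 * c) • PhiA2tf n m := by
  have hz : ∀ v, N.mulVec v ⟨0, hm⟩ = c * v ⟨0, hm⟩ := fun v => by
    rw [Matrix.mulVec, hN, single_dotProduct]
  refine (isNormalForm_PhiA2tf hn hm).glAct_eq_smul fun k l v w => ?_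
  simp only [tfForm, Matrix.mulVec_smul, hz, hN']
  module

lemma lower_row_zero (hm : 0 < m) {N : Matrix (Fin m) (Fin m) ℝ} (hN : ∀ a b, a ≤ b → N a b = 0) :
    N ⟨0, hm⟩ = Pi.single ⟨0, hm⟩ 0 := by
  ext b
  rw [hN _ _ (Nat.zero_le _), Pi.single_zero, Pi.zero_apply]

lemma lower_mulVec_last (hm : 0 < m) {N : Matrix (Fin m) (Fin m) ℝ}
    (hN : ∀ a b, a ≤ b → N a b = 0) :
    N.mulVec (Pi.single ⟨m - 1, Nat.sub_one_lt_of_lt hm⟩ 1) =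
      (0 : ℝ) • Pi.single ⟨m - 1, Nat.sub_one_lt_of_lt hm⟩ 1 := by
  ext a
  rw [Matrix.mulVec_single_one, Matrix.col_apply, hN _ _ (Nat.le_sub_one_of_lt a.2)]
  simp

lemma diagonal_row_zero (hm : 0 < m) (d : Fin m → ℝ) :
    Matrix.diagonal d ⟨0, hm⟩ = Pi.single ⟨0, hm⟩ (d ⟨0, hm⟩) := by
  ext b
  rw [Matrix.diagonal_apply, Pi.single_apply]
  simp only [eq_comm]

lemma diagonal_mulVec_last (hm : 0 < m) (d : Fin m → ℝ) :
    (Matrix.diagonal d).mulVec (Pi.single ⟨m - 1, Nat.sub_one_lt_of_lt hm⟩ 1) =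
      d ⟨m - 1, Nat.sub_one_lt_of_lt hm⟩ • Pi.single ⟨m - 1, Nat.sub_one_lt_of_lt hm⟩ 1 := by
  rw [Matrix.diagonal_mulVec_single, ← Pi.single_smul, smul_eq_mul]

lemma sum_eps_one (hm : 0 < m) (d : Fin m → ℝ) : ∑ a, eps m 1 a * d a = d ⟨0, hm⟩ := by
  rw [Finset.sum_eq_single ⟨0, hm⟩]
  · simp [eps]
  · intro b _ hb
    have : (b : ℕ) ≠ 0 := fun h => hb (Fin.ext h)
    simp [eps, this]
  · simp

lemma sum_eps_last (hm : 0 < m) (d : Fin m → ℝ) :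
    ∑ a, eps m m a * d a = d ⟨m - 1, Nat.sub_one_lt_of_lt hm⟩ := by
  rw [Finset.sum_eq_single ⟨m - 1, Nat.sub_one_lt_of_lt hm⟩]
  · simp [eps, Nat.sub_add_cancel hm]
  · intro b _ hb
    have : (b : ℕ) + 1 ≠ m := fun h => hb (Fin.ext (by simp only; omega))
    simp [eps, this]
  · simp

lemma hasWeight_PhiB4 (hm : 0 < m) : HasWeight (PhiB4 2 m) ((-2 : ℝ) • eps m 1) := fun d _ => by
  rw [lieAct_ofGl, glAct_PhiB4 hm (diagonal_row_zero hm d)]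
  simp only [Pi.smul_apply, smul_eq_mul, mul_assoc, ← Finset.mul_sum, sum_eps_one hm]

lemma hasWeight_PhiA2tr (hn : 2 ≤ n) (hm : 0 < m) (α β : ℝ) :
    HasWeight (PhiA2tr n m α β) (-eps m 1) := fun d _ => by
  rw [lieAct_ofGl, glAct_PhiA2tr hn hm α β (diagonal_row_zero hm d)]
  simp only [Pi.neg_apply, neg_mul, Finset.sum_neg_distrib, sum_eps_one hm]

lemma hasWeight_PhiA2tf (hn : 2 ≤ n) (hm : 0 < m) :
    HasWeight (PhiA2tf n m) (eps m m - (2 : ℝ) • eps m 1) := fun d _ => by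
  rw [lieAct_ofGl, glAct_PhiA2tf hn hm (diagonal_row_zero hm d) (diagonal_mulVec_last hm d)]
  simp only [Pi.sub_apply, Pi.smul_apply, smul_eq_mul, sub_mul, mul_assoc, ← Finset.mul_sum,
    Finset.sum_sub_distrib, sum_eps_one hm, sum_eps_last hm]

/-! ### Two invariants which separate `𝔸₂^tr` and `𝔸₂^tf` -/

/-- The cochains `φ` for which `w ↦ φ(E_k ⊗ v, E_l ⊗ w) mod F` is trace-free for all `k, l, v`. -/
noncomputable def traceFree (n m : ℕ) : Submodule ℝ (C2 n m) where
  carrier := {φ | ∀ k l v, LinearMap.trace ℝ (Fin m → ℝ)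
    (modFHom n m ∘ₗ φ.1 (vec n k v) ∘ₗ vec n l) = 0}
  zero_mem' k l v := by
    convert map_zero (LinearMap.trace ℝ (Fin m → ℝ))
    ext1 w
    rfl
  add_mem' {φ ψ} hφ hψ k l v := by
    have : modFHom n m ∘ₗ (φ + ψ).1 (vec n k v) ∘ₗ vec n l =
      modFHom n m ∘ₗ φ.1 (vec n k v) ∘ₗ vec n l + modFHom n m ∘ₗ ψ.1 (vec n k v) ∘ₗ vec n l := rfl
    rw [this, map_add, hφ k l v, hψ k l v, add_zero]
  smul_mem' c φ hφ k l v := by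
    have : modFHom n m ∘ₗ (c • φ).1 (vec n k v) ∘ₗ vec n l =
      c • (modFHom n m ∘ₗ φ.1 (vec n k v) ∘ₗ vec n l) := rfl
    rw [this, map_smul, hφ k l v, smul_zero]

lemma modF_groupAct (g : G0 m) (φ : C2 n m) (k l : ℕ) : ∃ c : ℝ, ∀ v w,
    modF (groupAct g φ (vec n k v) (vec n l w)) =
      c • (g.2 : Matrix (Fin m) (Fin m) ℝ).mulVec (modF (φ (vec n k
        ((g.2⁻¹ : GL (Fin m) ℝ).1.mulVec v)) (vec n l ((g.2⁻¹ : GL (Fin m) ℝ).1.mulVec w)))) := by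
  refine ⟨(g.1 : ℝ) ^ (2 * (n : ℤ) - n) * (((g⁻¹).1 : ℝ) ^ (2 * (k : ℤ) - n) *
    ((g⁻¹).1 : ℝ) ^ (2 * (l : ℤ) - n)), fun v w => ?_⟩
  rw [groupAct_apply, AdMinus_vec, AdMinus_vec, modF_Ad, map_smul, C2_smul_left, map_smul,
    map_smul, ← modFHom_apply, map_smul, map_smul, modFHom_apply, Matrix.mulVec_smul,
    Matrix.mulVec_smul, smul_smul, smul_smul, mul_assoc]
  rfl

lemma isG0Submodule_traceFree : IsG0Submodule (traceFree n m) := by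
  intro g φ hφ k l v
  obtain ⟨c, hc⟩ := modF_groupAct g φ k l
  have h1 : modFHom n m ∘ₗ (groupAct g φ).1 (vec n k v) ∘ₗ vec n l =
      c • ((g.2 : Matrix (Fin m) (Fin m) ℝ).mulVecLin ∘ₗ
        ((modFHom n m ∘ₗ φ.1 (vec n k ((g.2⁻¹ : GL (Fin m) ℝ).1.mulVec v)) ∘ₗ vec n l) ∘ₗ
          (g.2⁻¹ : GL (Fin m) ℝ).1.mulVecLin)) := LinearMap.ext (hc v)
  have h2 : (g.2⁻¹ : GL (Fin m) ℝ).1.mulVecLin ∘ₗ (g.2 : Matrix (Fin m) (Fin m) ℝ).mulVecLin =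
      LinearMap.id := by
    rw [← Matrix.mulVecLin_mul, ← Units.val_mul, inv_mul_cancel, Units.val_one,
      Matrix.mulVecLin_one]
  rw [h1, map_smul, LinearMap.trace_comp_comm', LinearMap.comp_assoc, h2, LinearMap.comp_id,
    hφ k l _, smul_zero]

/-- The cochains `φ` for which `φ(E_k ⊗ v, E_l ⊗ v) mod F` is a multiple of `v` for all `k, l, v`. -/
noncomputable def scalarDiag (n m : ℕ) : Submodule ℝ (C2 n m) where
  carrier := {φ | ∀ k l v, modF (φ (vec n k v) (vec n l v)) ∈ Submodule.span ℝ {v}}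
  zero_mem' _ _ _ := Submodule.zero_mem _
  add_mem' hφ hψ k l v := Submodule.add_mem _ (hφ k l v) (hψ k l v)
  smul_mem' c _ hφ k l v := Submodule.smul_mem _ c (hφ k l v)

lemma isG0Submodule_scalarDiag : IsG0Submodule (scalarDiag n m) := by
  intro g φ hφ k l v
  obtain ⟨c, hc⟩ := modF_groupAct g φ k l
  rw [hc]
  obtain ⟨t, ht⟩ := Submodule.mem_span_singleton.mp (hφ k l ((g.2⁻¹ : GL (Fin m) ℝ).1.mulVec v))
  refine Submodule.smul_mem _ _ (Submodule.mem_span_singleton.mpr ⟨t, ?_⟩)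
  rw [← ht, Matrix.mulVec_smul, Matrix.mulVec_mulVec, ← Units.val_mul, mul_inv_cancel,
    Units.val_one, Matrix.one_mulVec]

lemma PhiA2tr_mem_scalarDiag (hn : 2 ≤ n) (hm : 0 < m) (α β : ℝ) :
    PhiA2tr n m α β ∈ scalarDiag n m := by
  intro k l v
  rw [(isNormalForm_PhiA2tr hn hm α β).vec_apply, modF_vecG, trForm, ← sub_smul]
  exact Submodule.smul_mem _ _ (Submodule.smul_mem _ _ (Submodule.mem_span_singleton_self v))

lemma PhiA2tf_notMem_scalarDiag (hn : 2 ≤ n) (hm : 2 ≤ m) : PhiA2tf n m ∉ scalarDiag n m := by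
  intro h
  have hm' : 0 < m := by omega
  have h1 := h 1 n (Pi.single ⟨0, hm'⟩ 1)
  rw [(isNormalForm_PhiA2tf hn hm').vec_apply, modF_vecG, tfForm, tfCoeff, tfCoeff,
    show 1 + n - 1 = n by omega, kd_self, kd_self, kd_of_ne (show 1 ≠ 0 by norm_num),
    kd_of_ne (show n ≠ 1 by omega), kd_of_ne (show n ≠ 0 by omega), Pi.single_eq_same] at h1
  obtain ⟨t, ht⟩ := Submodule.mem_span_singleton.mp h1
  have h2 := congrFun ht ⟨m - 1, Nat.sub_one_lt_of_lt hm'⟩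
  have h3 : (⟨m - 1, Nat.sub_one_lt_of_lt hm'⟩ : Fin m) ≠ ⟨0, hm'⟩ := by
    rw [Ne, Fin.ext_iff]
    simp only
    omega
  simp [Pi.single_eq_of_ne h3] at h2

lemma trace_eq_sum (f : (Fin m → ℝ) →ₗ[ℝ] (Fin m → ℝ)) :
    LinearMap.trace ℝ (Fin m → ℝ) f = ∑ b, f (Pi.single b 1) b := by
  rw [LinearMap.trace_eq_matrix_trace ℝ (Pi.basisFun ℝ (Fin m)), Matrix.trace]
  refine Finset.sum_congr rfl fun b _ => ?_
  rw [Matrix.diag_apply, LinearMap.toMatrix_apply, Pi.basisFun_apply, Pi.basisFun_repr]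

lemma PhiA2tf_mem_traceFree (hn : 2 ≤ n) (hm : 2 ≤ m) : PhiA2tf n m ∈ traceFree n m := by
  intro k l v
  have : ∀ w, (modFHom n m ∘ₗ (PhiA2tf n m).1 (vec n k v) ∘ₗ vec n l) w =
      kd n (k + l - 1) • tfForm n (show 0 < m by omega) k l v w := fun w => by
    rw [← modF_vecG, ← (isNormalForm_PhiA2tf hn (show 0 < m by omega)).vec_apply]
    rfl
  rw [trace_eq_sum]
  simp only [this, Pi.smul_apply, smul_eq_mul, ← Finset.mul_sum, trace_tfForm hm, mul_zero]

lemma PhiA2tr_notMem_traceFree (hn : 3 ≤ n) (hm : 2 ≤ m) {α β : ℝ} (hα : α ≠ 0) :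
    PhiA2tr n m α β ∉ traceFree n m := by
  intro h
  have hm' : 0 < m := by omega
  have h1 := h 2 (n - 1) (Pi.single ⟨0, hm'⟩ 1)
  have : ∀ w, (modFHom n m ∘ₗ (PhiA2tr n m α β).1 (vec n 2 (Pi.single ⟨0, hm'⟩ 1)) ∘ₗ
      vec n (n - 1)) w = trForm n hm' α β 2 (n - 1) (Pi.single ⟨0, hm'⟩ 1) w := fun w => by
    have e := (isNormalForm_PhiA2tr (show 2 ≤ n by omega) hm' α β).vec_apply 2 (n - 1)
      (Pi.single ⟨0, hm'⟩ 1) w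
    rw [show 2 + (n - 1) - 1 = n by omega] at e
    have e' := congrArg modF e
    rwa [modF_vecG, kd_self, one_smul] at e'
  rw [trace_eq_sum] at h1
  simp only [this, trace_trForm, Pi.single_eq_same, mul_one] at h1
  have e1 : trCoeff n α β 2 (n - 1) = α := by
    rw [trCoeff, kd_self, kd_of_ne (show 2 ≠ 1 by norm_num), kd_of_ne (show 2 ≠ 0 by norm_num),
      kd_of_ne (show n - 1 ≠ 0 by omega), kd_of_ne (show n - 1 ≠ 1 by omega)]
    ring
  have e2 : trCoeff n α β (n - 1) 2 = α * kd (n - 1) 2 := by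
    rw [trCoeff, kd_of_ne (show 2 ≠ 1 by norm_num), kd_of_ne (show 2 ≠ 0 by norm_num),
      kd_of_ne (show n - 1 ≠ 0 by omega), kd_of_ne (show n - 1 ≠ 1 by omega)]
    ring
  have hm2 : (2 : ℝ) ≤ m := by exact_mod_cast hm
  rw [e1, e2, mul_comm (m : ℝ), ← mul_sub] at h1
  rcases mul_eq_zero.mp h1 with h | h
  · exact hα h
  · by_cases h3 : n - 1 = 2
    · rw [h3, kd_self] at h
      linarith
    · rw [kd_of_ne h3] at h
      linarith

/-! ### Modules generated by a lowest weight vector -/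

lemma IsLowestWeightVector.glAct_eq_zero {U : Submodule ℝ (C2 n m)} {φ : C2 n m}
    (h : IsLowestWeightVector U φ) (N : Matrix (Fin m) (Fin m) ℝ) (hN : ∀ a b, a ≤ b → N a b = 0) :
    glAct N φ = 0 := h.2.2 N hN

lemma isModuleOfType_genBy {Φ : C2 n m} {s t : ℝ} {l : Fin m → ℝ} (h0 : Φ ≠ 0)
    (hst : (s = 1 ∧ t = 1) ∨ (s = 2 ∧ t = 2)) (hΦ : Φ ∈ cclassSpace n m s t)
    (hlow : ∀ N : Matrix (Fin m) (Fin m) ℝ, (∀ a b, a ≤ b → N a b = 0) → glAct N Φ = 0)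
    (hw : HasWeight Φ l)
    (hgen : ∀ ψ, IsLowestWeightVector (genBy Φ) ψ → ∃ c : ℝ, ψ = c • Φ) :
    IsModuleOfType (genBy Φ) s t l := by
  obtain ⟨h1, h2⟩ := isIrreducible_genBy h0 hst hΦ hgen
  exact ⟨h1, h2, Φ, ⟨mem_genBy Φ, h0, hlow⟩, hw⟩

/-- A module type is realized by exactly one subspace, with one lowest weight vector up to scale, if
every module of this type contains the cochain `Φ` and `Φ` is, up to scale, the only lowest weight
vector of the submodule which it generates. -/
lemma existsUnique_of_genBy {Φ : C2 n m} {s t : ℝ} {l : Fin m → ℝ} (h0 : Φ ≠ 0)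
    (hst : (s = 1 ∧ t = 1) ∨ (s = 2 ∧ t = 2)) (hΦ : Φ ∈ cclassSpace n m s t)
    (hlow : ∀ N : Matrix (Fin m) (Fin m) ℝ, (∀ a b, a ≤ b → N a b = 0) → glAct N Φ = 0)
    (hw : HasWeight Φ l)
    (hgen : ∀ ψ, IsLowestWeightVector (genBy Φ) ψ → ∃ c : ℝ, ψ = c • Φ)
    (huniq : ∀ U : Submodule ℝ (C2 n m), IsModuleOfType U s t l → Φ ∈ U) :
    (∃! U : Submodule ℝ (C2 n m), IsModuleOfType U s t l) ∧
      ∀ U : Submodule ℝ (C2 n m), IsModuleOfType U s t l →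
        ∀ φ : C2 n m, IsLowestWeightVector U φ ↔ ∃ c : ℝ, c ≠ 0 ∧ φ = c • Φ := by
  have hU : ∀ U : Submodule ℝ (C2 n m), IsModuleOfType U s t l → U = genBy Φ := fun U h =>
    h.1.eq_genBy (huniq U h) h0
  refine ⟨⟨genBy Φ, isModuleOfType_genBy h0 hst hΦ hlow hw hgen, hU⟩, fun U h φ => ?_⟩
  rw [hU U h]
  constructor
  · intro hφ
    obtain ⟨c, rfl⟩ := hgen φ hφ
    exact ⟨c, fun hc => hφ.2.1 (by rw [hc, zero_smul]), rfl⟩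
  · rintro ⟨c, hc, rfl⟩
    refine ⟨Submodule.smul_mem _ c (mem_genBy Φ), smul_ne_zero hc h0, fun N hN => ?_⟩
    rw [lieAct_ofGl, map_smul, hlow N hN, smul_zero]

/-! ### The classification in bi-grade `(2, 2)` -/

lemma glAct_lower_PhiB4 (hm : 0 < m) (N : Matrix (Fin m) (Fin m) ℝ)
    (hN : ∀ a b, a ≤ b → N a b = 0) : glAct N (PhiB4 2 m) = 0 := by
  rw [glAct_PhiB4 hm (lower_row_zero hm hN), mul_zero, zero_smul]

lemma PhiB4_ne_zero (hm : 0 < m) : PhiB4 2 m ≠ 0 := by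
  intro h
  have := yPart_PhiB4 hm (Pi.single ⟨0, hm⟩ 1) (Pi.single ⟨0, hm⟩ 1)
  rw [h, yPart, C2_zero_apply, Pi.single_eq_same] at this
  norm_num at this

/-- `yPart` as a bilinear form. -/
noncomputable def yForm (φ : C2 n m) : (Fin m → ℝ) →ₗ[ℝ] (Fin m → ℝ) →ₗ[ℝ] ℝ :=
  LinearMap.mk₂ ℝ (yPart φ) (fun _ _ _ => by simp [yPart]) (fun _ _ _ => by simp [yPart])
    (fun _ _ _ => by simp [yPart]) (fun _ _ _ => by simp [yPart])

lemma eq_smul_PhiB4 (hm : 2 ≤ m) {φ : C2 2 m} (hφ : φ ∈ cclassSpace 2 m 2 2)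
    (hlow : ∀ N : Matrix (Fin m) (Fin m) ℝ, (∀ a b, a ≤ b → N a b = 0) → glAct N φ = 0) :
    ∃ c : ℝ, φ = c • PhiB4 2 m := by
  have hm' : 0 < m := by omega
  obtain ⟨hh, ⟨h1, h2⟩, -, -⟩ := hφ
  have hd := (mem_harmonic.mp hh).1
  have hs : ∀ v w, yForm φ v w = yForm φ w v := by
    intro v w
    have := cocycle_negX_vec_vec hd 0 0 v w
    rw [negX_vec_eq_zero_of_bigrade_two h1 h2, negX_vec_eq_zero_of_bigrade_two h1 h2, zero_lie,
      zero_lie, add_zero, sub_zero, C2_skew φ (vec 2 0 w) (vec 2 (0 + 1) v)] at this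
    have := congrArg SymAlg.y this
    rw [SymAlg.lie_y, SymAlg.add_y, SymAlg.neg_y] at this
    simp only [elX, zero_mul, sub_self, mul_zero, zero_add] at this
    change (φ (vec 2 0 v) (vec 2 1 w)).y = (φ (vec 2 0 w) (vec 2 1 v)).y
    linarith
  have hN : ∀ N : Matrix (Fin m) (Fin m) ℝ, (∀ a b, a ≤ b → N a b = 0) →
      ∀ v w, yForm φ (N.mulVec v) w + yForm φ v (N.mulVec w) = 0 := by
    intro N hN v w
    have := congrArg SymAlg.y (glAct_eq_zero_apply (hlow N hN) (vec 2 0 v) (vec 2 1 w))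
    rw [glMinus_vec, glMinus_vec, SymAlg.add_y] at this
    rw [show yForm φ (N.mulVec v) w + yForm φ v (N.mulVec w) = _ from this.symm, SymAlg.lie_y]
    simp [ofGl]
  set c := yForm φ (Pi.single ⟨0, hm'⟩ 1) (Pi.single ⟨0, hm'⟩ 1) with hc
  have hy := bilin_lowest hm' hs hN
  obtain ⟨hB, ⟨b1, b2⟩, -, -⟩ := PhiB4_mem hm'
  have hsum : φ + (-(2 * c)) • PhiB4 2 m = 0 := by
    refine eq_zero_of_bigrade_two le_rfl hm ?_ ?_ ?_ fun _ v w => ?_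
    · rw [map_add, map_smul, hd, (mem_harmonic.mp hB).1, smul_zero, add_zero]
    · rw [← lieActHom_apply, map_add, map_smul, lieActHom_apply, lieActHom_apply, h1, b1,
        smul_add, smul_comm]
    · rw [← lieActHom_apply, map_add, map_smul, lieActHom_apply, lieActHom_apply, h2, b2,
        smul_add, smul_comm]
    · have e1 : yPart (φ + (-(2 * c)) • PhiB4 2 m) v w =
          yPart φ v w + (-(2 * c)) * yPart (PhiB4 2 m) v w := rfl
      rw [e1, yPart_PhiB4 hm', show yPart φ v w = _ from hy v w]
      ring
  refine ⟨2 * c, C2_ext_apply fun u w => ?_⟩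
  have := congrArg (fun ψ : C2 2 m => ψ u w) hsum
  simp only [add_apply_apply, smul_apply_apply, C2_zero_apply, neg_smul] at this
  rw [smul_apply_apply]
  exact add_neg_eq_zero.mp this

lemma isB4_spec (hm : 2 ≤ m) : IsB4 (genBy (PhiB4 2 m)) ∧
    (∃! U : Submodule ℝ (C2 2 m), IsB4 U) ∧ ∀ U : Submodule ℝ (C2 2 m), IsB4 U →
      ∀ φ : C2 2 m, IsLowestWeightVector U φ ↔ ∃ c : ℝ, c ≠ 0 ∧ φ = c • PhiB4 2 m := by
  have hm' : 0 < m := by omega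
  have hgen : ∀ ψ, IsLowestWeightVector (genBy (PhiB4 2 m)) ψ → ∃ c : ℝ, ψ = c • PhiB4 2 m :=
    fun ψ hψ => eq_smul_PhiB4 hm
      (genBy_le (isG0Submodule_cclassSpace 2 2) (PhiB4_mem hm') hψ.1) hψ.glAct_eq_zero
  refine ⟨isModuleOfType_genBy (PhiB4_ne_zero hm') (Or.inr ⟨rfl, rfl⟩) (PhiB4_mem hm')
    (glAct_lower_PhiB4 hm') (hasWeight_PhiB4 hm') hgen, existsUnique_of_genBy (PhiB4_ne_zero hm')
    (Or.inr ⟨rfl, rfl⟩) (PhiB4_mem hm')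
    (glAct_lower_PhiB4 hm') (hasWeight_PhiB4 hm') hgen fun U hU => ?_⟩
  obtain ⟨h1, h2, φ, hφ, -⟩ := hU
  obtain ⟨c, hc⟩ := eq_smul_PhiB4 hm (h1.le_cclassSpace h2 hφ.1) hφ.glAct_eq_zero
  have hc0 : c ≠ 0 := fun h => hφ.2.1 (by rw [hc, h, zero_smul])
  have := U.smul_mem c⁻¹ hφ.1
  rwa [hc, smul_smul, inv_mul_cancel₀ hc0, one_smul] at this

/-! ### The classification in bi-grade `(1, 1)` -/

/-- The value of `α` for which `PhiA2tr n m α 1` is coclosed. -/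
noncomputable def trAlpha (n m : ℕ) : ℝ := -6 * ((n : ℝ) - 1) * (m + 1) / (m * n * (n + 1) + 6)

lemma trAlpha_spec (n m : ℕ) :
    trAlpha n m * (m * n * (n + 1) + 6) = -6 * ((n : ℝ) - 1) * (m + 1) * 1 := by
  have : (m * n * (n + 1) + 6 : ℝ) ≠ 0 := by positivity
  rw [trAlpha, div_mul_cancel₀ _ this, mul_one]

lemma trAlpha_ne_zero (hn : 2 ≤ n) : trAlpha n m ≠ 0 := by
  have h1 : (m * n * (n + 1) + 6 : ℝ) ≠ 0 := by positivity
  have h2 : (2 : ℝ) ≤ n := by exact_mod_cast hn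
  have h3 : (m : ℝ) + 1 ≠ 0 := by positivity
  exact div_ne_zero (mul_ne_zero (mul_ne_zero (by norm_num) (by linarith)) h3) h1

lemma PhiA2tr_smul (c α β : ℝ) : PhiA2tr n m (c * α) (c * β) = c • PhiA2tr n m α β := by
  rw [PhiA2tr, PhiA2tr, smul_add, smul_smul, smul_smul]

variable (n m) in
/-- The lowest weight vector of `𝔸₂^tr` with `β = 1`. -/
noncomputable def trVec : C2 n m := PhiA2tr n m (trAlpha n m) 1

lemma trVec_mem (hn : 2 ≤ n) (hm : 0 < m) : trVec n m ∈ cclassSpace n m 1 1 :=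
  PhiA2tr_mem hn hm (trAlpha_spec n m)

lemma glAct_lower_trVec (hn : 2 ≤ n) (hm : 0 < m) (N : Matrix (Fin m) (Fin m) ℝ)
    (hN : ∀ a b, a ≤ b → N a b = 0) : glAct N (trVec n m) = 0 := by
  rw [trVec, glAct_PhiA2tr hn hm _ _ (lower_row_zero hm hN), neg_zero, zero_smul]

lemma glAct_lower_PhiA2tf (hn : 2 ≤ n) (hm : 0 < m) (N : Matrix (Fin m) (Fin m) ℝ)
    (hN : ∀ a b, a ≤ b → N a b = 0) : glAct N (PhiA2tf n m) = 0 := by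
  rw [glAct_PhiA2tf hn hm (lower_row_zero hm hN) (lower_mulVec_last hm hN), mul_zero, sub_zero,
    zero_smul]

lemma classForm_PhiA2tr (hn : 2 ≤ n) (hm : 0 < m) (α c : ℝ) (v w : Fin m → ℝ) :
    classForm (PhiA2tr n m α 1) (c • LinearMap.proj ⟨0, hm⟩) v w =
      ((c - α) * (n / 2) - 1) • v ⟨0, hm⟩ • w + ((c - α) * kd 2 n - 1) • w ⟨0, hm⟩ • v := by
  rw [(isNormalForm_PhiA2tr hn hm α 1).classForm_apply hn, trForm, trCoeff, trCoeff, kd_self,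
    kd_of_ne (show 1 ≠ 0 by norm_num), kd_of_ne (show 1 ≠ 2 by norm_num),
    kd_of_ne (show n ≠ 0 by omega), kd_of_ne (show n ≠ 1 by omega),
    show kd n 2 = kd 2 n by simp only [kd, eq_comm], LinearMap.smul_apply, LinearMap.smul_apply,
    LinearMap.proj_apply, LinearMap.proj_apply, smul_eq_mul, smul_eq_mul]
  module

lemma classForm_PhiA2tf (hn : 2 ≤ n) (hm : 0 < m) (v w : Fin m → ℝ) :
    classForm (PhiA2tf n m) 0 v w =
      (v ⟨0, hm⟩ * w ⟨0, hm⟩) • Pi.single ⟨m - 1, Nat.sub_one_lt_of_lt hm⟩ 1 := by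
  rw [(isNormalForm_PhiA2tf hn hm).classForm_apply hn, tfForm, tfCoeff, tfCoeff, kd_self,
    kd_of_ne (show 1 ≠ 0 by norm_num), kd_of_ne (show n ≠ 0 by omega),
    kd_of_ne (show n ≠ 1 by omega)]
  simp

/-- For `n = 2` the Doubrov–Medvedev condition is void, so that every `a` is admissible in
`classForm`; a suitable choice shows that the cochain vanishes. -/
lemma trVec_two (hm : 0 < m) : trVec 2 m = 0 := by
  refine (classForm_spec le_rfl (trVec_mem le_rfl hm)
    (a := (trAlpha 2 m + 1) • LinearMap.proj ⟨0, hm⟩) fun i j hi hj hij => by omega).2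
    fun v w => ?_
  rw [trVec, classForm_PhiA2tr le_rfl hm, kd_self]
  push_cast
  module

/-- The class form of `φ` agrees with the one of a combination of the two explicit cochains. -/
lemma exists_eq_smul_add_smul (hn : 2 ≤ n) (hm : 2 ≤ m) {φ : C2 n m}
    (hφ : φ ∈ cclassSpace n m 1 1)
    (hlow : ∀ N : Matrix (Fin m) (Fin m) ℝ, (∀ a b, a ≤ b → N a b = 0) → glAct N φ = 0) :
    ∃ x y : ℝ, φ = x • trVec n m + y • PhiA2tf n m := by
  have hm' : 0 < m := by omega
  obtain ⟨a, ha, t, s, hts⟩ := exists_classForm_lowest hn hm hφ hlow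
  have h1 := (isNormalForm_PhiA2tr hn hm' (trAlpha n m) 1).dmRel
  have h2 := (isNormalForm_PhiA2tf hn hm').dmRel
  have hsum : φ + (t • trVec n m + (-s) • PhiA2tf n m) = 0 := by
    refine (classForm_spec hn (Submodule.add_mem _ hφ (Submodule.add_mem _
      (Submodule.smul_mem _ t (trVec_mem hn hm')) (Submodule.smul_mem _ (-s) (PhiA2tf_mem hn hm))))
      (ha.add ((h1.smul t).add (h2.smul (-s))))).2 fun v w => ?_
    rw [classForm_add, classForm_add, classForm_smul, classForm_smul, hts, classForm_PhiA2tf hn hm',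
      trVec, classForm_PhiA2tr hn hm']
    module
  refine ⟨-t, s, C2_ext_apply fun u w => ?_⟩
  have := congrArg (fun ψ : C2 n m => ψ u w) hsum
  simp only [add_apply_apply, smul_apply_apply, C2_zero_apply] at this ⊢
  rw [eq_neg_of_add_eq_zero_left this]
  module

/-- The diagonal entries of `diag(1, 0, …, 0, -1)`, which distinguishes the weights of the two
cochains. -/
noncomputable def weightGen (hm : 2 ≤ m) : Fin m → ℝ :=
  Pi.single ⟨0, by omega⟩ 1 - Pi.single ⟨m - 1, by omega⟩ 1

lemma weightGen_spec (hm : 2 ≤ m) : weightGen hm ⟨0, by omega⟩ = 1 ∧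
    weightGen hm ⟨m - 1, by omega⟩ = -1 ∧ ∑ a, weightGen hm a = 0 ∧
      (⟨0, by omega⟩ : Fin m) ≠ ⟨m - 1, by omega⟩ := by
  have h : (⟨0, by omega⟩ : Fin m) ≠ ⟨m - 1, by omega⟩ := by
    rw [Ne, Fin.ext_iff]
    simp only
    omega
  refine ⟨?_, ?_, ?_, h⟩
  · simp [weightGen, Pi.single_eq_of_ne h]
  · simp [weightGen, Pi.single_eq_of_ne h.symm]
  · simp [weightGen]

lemma glAct_weightGen (hn : 2 ≤ n) (hm : 2 ≤ m) (x y : ℝ) :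
    glAct (Matrix.diagonal (weightGen hm)) (x • trVec n m + y • PhiA2tf n m) =
      (-x) • trVec n m + (-3 * y) • PhiA2tf n m := by
  have hm' : 0 < m := by omega
  obtain ⟨h1, h2, -, -⟩ := weightGen_spec hm
  rw [map_add, map_smul, map_smul, trVec, glAct_PhiA2tr hn hm' _ _ (diagonal_row_zero hm' _),
    glAct_PhiA2tf hn hm' (diagonal_row_zero hm' _) (diagonal_mulVec_last hm' _), h1, h2]
  module

/-- A `G₀`-submodule contains the weight components of its elements. -/
lemma smul_mem_of_add_mem (hn : 2 ≤ n) (hm : 2 ≤ m) {U : Submodule ℝ (C2 n m)}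
    (hU : IsG0Submodule U) {x y : ℝ} (h : x • trVec n m + y • PhiA2tf n m ∈ U) :
    (x ≠ 0 → trVec n m ∈ U) ∧ (y ≠ 0 → PhiA2tf n m ∈ U) := by
  -- The two cochains are eigenvectors of `diag(1, 0, …, 0, -1)` for the eigenvalues `-1` and `-3`.
  have h1 := glAct_diagonal_mem hU (weightGen_spec hm).2.2.2 h
  change glAct (Matrix.diagonal (weightGen hm)) _ ∈ U at h1
  rw [glAct_weightGen hn hm] at h1
  constructor
  · intro hx
    have := U.smul_mem (1 / (2 * x)) (U.add_mem h1 (U.smul_mem 3 h))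
    convert this using 1
    have e : ∀ A B : C2 n m, A = (1 / (2 * x)) • ((-x) • A + (-3 * y) • B +
        (3 : ℝ) • (x • A + y • B)) := fun A B => by
      have : (1 / (2 * x)) • ((-x) • A + (-3 * y) • B + (3 : ℝ) • (x • A + y • B)) =
        (1 / (2 * x) * (2 * x)) • A := by module
      rw [this, one_div_mul_cancel (by positivity), one_smul]
    exact e _ _
  · intro hy
    have := U.smul_mem (-1 / (2 * y)) (U.add_mem h1 h)
    convert this using 1
    have e : ∀ A B : C2 n m, B = (-1 / (2 * y)) • ((-x) • A + (-3 * y) • B +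
        (x • A + y • B)) := fun A B => by
      have : (-1 / (2 * y)) • ((-x) • A + (-3 * y) • B + (x • A + y • B)) =
        (1 / (2 * y) * (2 * y)) • B := by module
      rw [this, one_div_mul_cancel (by positivity), one_smul]
    exact e _ _

lemma PhiA2tf_ne_zero (hn : 2 ≤ n) (hm : 2 ≤ m) : PhiA2tf n m ≠ 0 := fun h =>
  PhiA2tf_notMem_scalarDiag hn hm (h ▸ Submodule.zero_mem _)

lemma trVec_ne_zero (hn : 3 ≤ n) (hm : 2 ≤ m) : trVec n m ≠ 0 := fun h =>
  PhiA2tr_notMem_traceFree hn hm (trAlpha_ne_zero (m := m) (show 2 ≤ n by omega)) (β := 1)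
    (show trVec n m ∈ _ from h ▸ Submodule.zero_mem _)

lemma isA2tf_spec (hn : 2 ≤ n) (hm : 2 ≤ m) : IsA2tf (genBy (PhiA2tf n m)) ∧
    (∃! U : Submodule ℝ (C2 n m), IsA2tf U) ∧ ∀ U : Submodule ℝ (C2 n m), IsA2tf U →
      ∀ φ : C2 n m, IsLowestWeightVector U φ ↔ ∃ c : ℝ, c ≠ 0 ∧ φ = c • PhiA2tf n m := by
  have hm' : 0 < m := by omega
  have h0 := PhiA2tf_ne_zero hn hm
  have hmem := PhiA2tf_mem hn hm
  have hgen : ∀ ψ, IsLowestWeightVector (genBy (PhiA2tf n m)) ψ → ∃ c : ℝ, ψ = c • PhiA2tf n m := by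
    intro ψ hψ
    obtain ⟨x, y, rfl⟩ := exists_eq_smul_add_smul hn hm
      (genBy_le (isG0Submodule_cclassSpace 1 1) hmem hψ.1) hψ.glAct_eq_zero
    refine ⟨y, ?_⟩
    rcases hn.eq_or_lt with rfl | hn3
    · rw [trVec_two hm', smul_zero, zero_add]
    · have hx : x = 0 := by
        by_contra hx
        have := (smul_mem_of_add_mem hn hm (isG0Submodule_genBy _) hψ.1).1 hx
        exact PhiA2tr_notMem_traceFree hn3 hm (trAlpha_ne_zero hn)
          (genBy_le isG0Submodule_traceFree (PhiA2tf_mem_traceFree hn hm) this)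
      rw [hx, zero_smul, zero_add]
  refine ⟨isModuleOfType_genBy h0 (Or.inl ⟨rfl, rfl⟩) hmem (glAct_lower_PhiA2tf hn hm')
    (hasWeight_PhiA2tf hn hm') hgen, existsUnique_of_genBy h0 (Or.inl ⟨rfl, rfl⟩) hmem
    (glAct_lower_PhiA2tf hn hm') (hasWeight_PhiA2tf hn hm') hgen fun U hU => ?_⟩
  obtain ⟨h1, h2, φ, hφ, hw⟩ := hU
  obtain ⟨x, y, rfl⟩ := exists_eq_smul_add_smul hn hm (h1.le_cclassSpace h2 hφ.1) hφ.glAct_eq_zero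
  refine (smul_mem_of_add_mem hn hm h1.invariant hφ.1).2 fun hy => hφ.2.1 ?_
  obtain ⟨e1, e2, e3, -⟩ := weightGen_spec hm
  have := hw _ e3
  rw [lieAct_ofGl, glAct_weightGen hn hm, hy] at this
  simp only [Pi.sub_apply, Pi.smul_apply, smul_eq_mul, sub_mul, mul_assoc, ← Finset.mul_sum,
    Finset.sum_sub_distrib, sum_eps_one hm', sum_eps_last hm', e1, e2, mul_zero, zero_smul,
    add_zero] at this
  rw [hy, zero_smul, add_zero]
  have h3 : (2 * x) • trVec n m = 0 := by
    rw [smul_smul] at this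
    have e : ∀ A : C2 n m, (-x) • A = ((-1 - 2 * 1) * x) • A → (2 * x) • A = 0 := fun A h => by
      rw [show (2 * x) • A = (-x) • A + (3 * x) • A by module, h]
      module
    exact e _ this
  rw [mul_smul] at h3
  exact (smul_eq_zero.mp h3).resolve_left two_ne_zero

lemma isA2tr_spec (hn : 3 ≤ n) (hm : 2 ≤ m) : IsA2tr (genBy (trVec n m)) ∧
    (∃! U : Submodule ℝ (C2 n m), IsA2tr U) ∧ ∀ U : Submodule ℝ (C2 n m), IsA2tr U →
      ∀ φ : C2 n m, IsLowestWeightVector U φ ↔ ∃ c : ℝ, c ≠ 0 ∧ φ = c • trVec n m := by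
  have hm' : 0 < m := by omega
  have hn' : 2 ≤ n := by omega
  have h0 := trVec_ne_zero hn hm
  have hmem := trVec_mem hn' hm'
  have hgen : ∀ ψ, IsLowestWeightVector (genBy (trVec n m)) ψ → ∃ c : ℝ, ψ = c • trVec n m := by
    intro ψ hψ
    obtain ⟨x, y, rfl⟩ := exists_eq_smul_add_smul hn' hm
      (genBy_le (isG0Submodule_cclassSpace 1 1) hmem hψ.1) hψ.glAct_eq_zero
    refine ⟨x, ?_⟩
    have hy : y = 0 := by
      by_contra hy
      have := (smul_mem_of_add_mem hn' hm (isG0Submodule_genBy _) hψ.1).2 hy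
      exact PhiA2tf_notMem_scalarDiag hn' hm
        (genBy_le isG0Submodule_scalarDiag (PhiA2tr_mem_scalarDiag hn' hm' _ _) this)
    rw [hy, zero_smul, add_zero]
  refine ⟨isModuleOfType_genBy h0 (Or.inl ⟨rfl, rfl⟩) hmem (glAct_lower_trVec hn' hm')
    (hasWeight_PhiA2tr hn' hm' _ _) hgen, existsUnique_of_genBy h0 (Or.inl ⟨rfl, rfl⟩) hmem
    (glAct_lower_trVec hn' hm') (hasWeight_PhiA2tr hn' hm' _ _) hgen fun U hU => ?_⟩
  obtain ⟨h1, h2, φ, hφ, hw⟩ := hU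
  obtain ⟨x, y, rfl⟩ := exists_eq_smul_add_smul hn' hm (h1.le_cclassSpace h2 hφ.1)
    hφ.glAct_eq_zero
  refine (smul_mem_of_add_mem hn' hm h1.invariant hφ.1).1 fun hx => hφ.2.1 ?_
  obtain ⟨e1, e2, e3, -⟩ := weightGen_spec hm
  have := hw _ e3
  rw [lieAct_ofGl, glAct_weightGen hn' hm, hx] at this
  simp only [Pi.neg_apply, neg_mul, Finset.sum_neg_distrib, sum_eps_one hm', e1, neg_zero,
    zero_smul, zero_add] at this
  rw [hx, zero_smul, zero_add]
  have h3 : (2 * y) • PhiA2tf n m = 0 := by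
    rw [smul_smul] at this
    have e : ∀ A : C2 n m, (-(3 * y)) • A = (-1 * y) • A → (2 * y) • A = 0 := fun A h => by
      rw [show (2 * y) • A = -((-(3 * y)) • A) + (-1 * y) • A by module, h]
      module
    exact e _ this
  rw [mul_smul] at h3
  exact (smul_eq_zero.mp h3).resolve_left two_ne_zero

lemma classification (hn : 2 ≤ n) (hm : 2 ≤ m) {U : Submodule ℝ (C2 n m)}
    (hU : IsIrreducibleCClassModule U) :
    (n = 2 ∧ IsB4 U) ∨ (3 ≤ n ∧ IsA2tr U) ∨ IsA2tf U := by
  obtain ⟨φ, hφ⟩ := exists_isLowestWeightVector hU.invariant hU.ne_bot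
  rcases hU.bigrade with hb | hb
  · have hmem := hU.le_cclassSpace hb hφ.1
    obtain ⟨x, y, rfl⟩ := exists_eq_smul_add_smul hn hm hmem hφ.glAct_eq_zero
    obtain ⟨h1, h2⟩ := smul_mem_of_add_mem hn hm hU.invariant hφ.1
    by_cases hy : y = 0
    · have hx : x ≠ 0 := fun hx => hφ.2.1 (by rw [hx, hy, zero_smul, zero_smul, add_zero])
      rcases hn.eq_or_lt with rfl | hn3
      · refine absurd ?_ hφ.2.1
        rw [hy, trVec_two (by omega), smul_zero, zero_smul, add_zero]
      · rw [hU.eq_genBy (h1 hx) (trVec_ne_zero hn3 hm)]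
        exact Or.inr (Or.inl ⟨hn3, (isA2tr_spec hn3 hm).1⟩)
    · rw [hU.eq_genBy (h2 hy) (PhiA2tf_ne_zero hn hm)]
      exact Or.inr (Or.inr (isA2tf_spec hn hm).1)
  · have hmem := hU.le_cclassSpace hb hφ.1
    by_cases h2 : n = 2
    · subst h2
      obtain ⟨c, hc⟩ := eq_smul_PhiB4 hm hmem hφ.glAct_eq_zero
      have hc0 : c ≠ 0 := fun h => hφ.2.1 (by rw [hc, h, zero_smul])
      have h3 := U.smul_mem c⁻¹ hφ.1
      rw [hc, smul_smul, inv_mul_cancel₀ hc0, one_smul] at h3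
      rw [hU.eq_genBy h3 (PhiB4_ne_zero (by omega))]
      exact Or.inl ⟨rfl, (isB4_spec hm).1⟩
    · exact absurd (eq_zero_of_bigrade_two hn hm (mem_harmonic.mp hmem.1).1 hmem.2.1.1
        hmem.2.1.2 fun h => absurd h h2) hφ.2.1

end CClass

/-- Lowest weight vectors of the irreducible C-class modules: classification of the modules, their
existence and uniqueness, and the explicit harmonic lowest weight vectors, unique up to scale. -/
theorem theorem3p1 (n m : ℕ) (hn : 2 ≤ n) (hm : 2 ≤ m) :
    (∀ U : Submodule ℝ (C2 n m), IsIrreducibleCClassModule U →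
      (n = 2 ∧ IsB4 U) ∨ (3 ≤ n ∧ IsA2tr U) ∨ IsA2tf U) ∧
    (n = 2 → (∃! U : Submodule ℝ (C2 n m), IsB4 U) ∧
      ∀ U : Submodule ℝ (C2 n m), IsB4 U →
        ∀ φ : C2 n m, IsLowestWeightVector U φ ↔ ∃ c : ℝ, c ≠ 0 ∧ φ = c • PhiB4 n m) ∧
    (3 ≤ n → (∃! U : Submodule ℝ (C2 n m), IsA2tr U) ∧
      ∀ U : Submodule ℝ (C2 n m), IsA2tr U →
        ∀ φ : C2 n m, IsLowestWeightVector U φ ↔ ∃ α β : ℝ, β ≠ 0 ∧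
          α = -6 * ((n : ℝ) - 1) * (m + 1) / (m * n * (n + 1) + 6) * β ∧
          φ = PhiA2tr n m α β) ∧
    ((∃! U : Submodule ℝ (C2 n m), IsA2tf U) ∧
      ∀ U : Submodule ℝ (C2 n m), IsA2tf U →
        ∀ φ : C2 n m, IsLowestWeightVector U φ ↔ ∃ c : ℝ, c ≠ 0 ∧ φ = c • PhiA2tf n m) := by
  refine ⟨fun U hU => classification hn hm hU, fun h2 => ?_, fun h3 => ?_, (isA2tf_spec hn hm).2⟩
  · subst h2
    exact (isB4_spec hm).2
  · obtain ⟨-, h1, h4⟩ := isA2tr_spec h3 hm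
    refine ⟨h1, fun U hU φ => (h4 U hU φ).trans ⟨?_, ?_⟩⟩
    · rintro ⟨c, hc, rfl⟩
      refine ⟨c * trAlpha n m, c, hc, mul_comm _ _, ?_⟩
      rw [trVec, ← PhiA2tr_smul, mul_one]
    · rintro ⟨α, β, hβ, hα, rfl⟩
      refine ⟨β, hβ, ?_⟩
      rw [trVec, ← PhiA2tr_smul, mul_one, hα, mul_comm β]
      rfl
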